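/- Consider the optimal control problem (P): minimize $\varphi_0(x(0),x(T))$ subject to $$\dot x=F(x,u,v):=f_0(x,u)+\sum_{i=1}^m v_i f_i(x,u)\ \text{ a.e. on }[0,T],\qquad u(t)\in U,\ v(t)\in V\ \text{ a.e. on }[0,T],$$ $$\eta_j(x(0),x(T))=0\ (j=1,\dots,d_\eta),\qquad \varphi_i(x(0),x(T))\le 0\ (i=1,\dots,d_\varphi),$$ where $T>0$, $w=(x,u,v)\in\mathcal W:=W^{1,\infty}(0,T;\mathbb R^n)\times L^\infty(0,T;\mathbb R^l)\times L^\infty(0,T;\mathbb R^m)$, the sets $U\subset\mathbb R^l$, $V\subset\mathbb R^m$ are open, and all the functions $f_i:\mathbb R^{n+l}\to\mathbb R^n$, $\varphi_i,\eta_j:\mathbb R^{2n}\to\mathbb R$ are $C^2$ with Lipschitz-continuous second order derivatives. A triple $w\in\mathcal W$ satisfying all the constraints is called feasible. A feasible $\hat w=(\hat x,\hat u,\hat v)$ is a weak minimum if there is $\varepsilon>0$ such that $\varphi_0(\hat x(0),\hat x(T))\le\varphi_0(x(0),x(T))$ for every feasible $(x,u,v)$ with $\|x-\hat x\|_\infty,\|u-\hat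 u\|_\infty,\|v-\hat v\|_\infty<\varepsilon$. Let $\hat w$ be a feasible triple such that $\varphi_i(\hat x(0),\hat x(T))=0$ for $i=1,\dots,d_\varphi$ and such that, for some $\delta>0$, the closed ball of radius $\delta$ around $(\hat u(t),\hat v(t))$ is contained in $U\times V$ for a.e. $t\in[0,T]$. For $\lambda=(\alpha,\beta,p)$ with $\alpha\in\mathbb R^{d_\varphi+1}$, $\beta\in\mathbb R^{d_\eta}$ and $p\in W^{1,\infty}(0,T;\mathbb R^{n,*})$ put $$H[\lambda](x,u,v,t):=p(t)F(x,u,v),\qquad \ell[\lambda]:=\sum_{i=0}^{d_\varphi}\alpha_i\varphi_i+\sum_{j=1}^{d_\eta}\beta_j\eta_j .$$ In what follows the derivatives of $F$ and $H[\lambda]$ are evaluated along $\hat w$, and those of $\ell[\lambda],\varphi_i,\eta_j$ at $(\hat x(0),\hat x(T))$. Let $\Lambda$ be the set of all $\lambda$ such that $$\sum_{i}|\alpha_i|+\sum_j|\beta_j|=1,\quad \alpha\ge 0,\quad -\dot p=H_x[\lambda]\ \text{a.e.},\quad p(0)=-D_{x_0}\ell[\lambda],\quad p(T)=D_{x_T}\ell[\lambda],\quad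 H_u[\lambda]=0,\ H_v[\lambda]=0\ \text{a.e.},$$ and let ${\rm co}\,\Lambda$ be its convex hull. Let $\mathcal H_2$ be the set of $\bar w=(\bar x,\bar u,\bar v)\in W^{1,2}\times L^2\times L^2$ with $\dot{\bar x}=F_x\bar x+F_u\bar u+F_v\bar v$ a.e. on $[0,T]$, let $\mathcal C_2$ be the set of $\bar w\in\mathcal H_2$ with $D\eta_j(\bar x(0),\bar x(T))=0$ for $1\le j\le d_\eta$ and $D\varphi_i(\bar x(0),\bar x(T))\le 0$ for $0\le i\le d_\varphi$, and let $$\Omega[\lambda](\bar w):=\tfrac12 D^2\ell[\lambda](\bar x(0),\bar x(T))^2+\int_0^T\Big(\tfrac12\bar x^\top H_{xx}[\lambda]\bar x+\bar u^\top H_{ux}[\lambda]\bar x+\bar v^\top H_{vx}[\lambda]\bar x+\tfrac12\bar u^\top H_{uu}[\lambda]\bar u+\bar v^\top H_{vu}[\lambda]\bar u\Big)\,dt .$$ Finally let $({\rm co}\,\Lambda)^{\#}$ be the set of $\lambda\in{\rm co}\,\Lambda$ for which $\Omega[\lambda]$ is sequentially lower semicontinuous on $\mathcal H_2$ for the weak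 topology of $W^{1,2}\times L^2\times L^2$. **Theorem.** If $\hat w$ is a weak minimum of (P), then for every $\bar w\in\mathcal C_2$ the maximum of $\Omega[\lambda](\bar w)$ over $\lambda\in({\rm co}\,\Lambda)^{\#}$ is attained and $$\max_{\lambda\in({\rm co}\,\Lambda)^{\#}}\Omega[\lambda](\bar w)\ge 0 .$$ Moreover, $$({\rm co}\,\Lambda)^{\#}=\{\lambda\in{\rm co}\,\Lambda:\ H_{uu}[\lambda]\succeq 0\ \text{ and }\ H_{vu}[\lambda]=0\ \text{ a.e. on }[0,T]\}.$$ -/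

import Mathlib

open MeasureTheory Set Filter Topology

noncomputable section

namespace PartiallyAffine

/-- Column vectors `ℝ^k` with the Euclidean norm. -/
abbrev Vec (k : ℕ) : Type := EuclideanSpace ℝ (Fin k)

/-- Row vectors `ℝ^{k,*}`, that is, linear forms on `ℝ^k`. -/
abbrev Covec (k : ℕ) : Type := Vec k →L[ℝ] ℝ

/-- Lebesgue measure on `[0,T]`. -/
abbrev timeMeasure (T : ℝ) : Measure ℝ := volume.restrict (Icc 0 T)

section Sobolev

variable {E : Type*} [NormedAddCommGroup E] [NormedSpace ℝ E]

/-- `x` is absolutely continuous on `[0,T]` and `ẋ = y` a.e. on `[0,T]`. -/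
def HasDerivativeAE (T : ℝ) (x y : ℝ → E) : Prop :=
  IntegrableOn y (Icc 0 T) ∧ ∀ t ∈ Icc 0 T, x t = x 0 + ∫ s in (0 : ℝ)..t, y s

/-- `x` belongs to the Sobolev space `W^{1,q}(0,T;E)` (we use the continuous representative). -/
def MemSobolev (T : ℝ) (q : ENNReal) (x : ℝ → E) : Prop :=
  ∃ y : ℝ → E, MemLp y q (timeMeasure T) ∧ HasDerivativeAE T x y

/-- Lipschitz-continuous second order derivative. -/
def HasLipschitzSecondDeriv {G : Type*} [NormedAddCommGroup G] [NormedSpace ℝ G]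
    (g : E → G) : Prop :=
  ContDiff ℝ 2 g ∧ ∃ K : NNReal, LipschitzWith K (fderiv ℝ (fderiv ℝ g))

end Sobolev

section WeakConvergence

variable {k : ℕ}

/-- Weak convergence of a sequence in `L²(0,T;ℝ^k)`. -/
def WeaklyConvergesL2 (T : ℝ) (g : ℕ → ℝ → Vec k) (g' : ℝ → Vec k) : Prop :=
  ∀ h : ℝ → Vec k, MemLp h 2 (timeMeasure T) →
    Tendsto (fun j => ∫ t, inner ℝ (g j t) (h t) ∂(timeMeasure T)) atTop
      (𝓝 (∫ t, inner ℝ (g' t) (h t) ∂(timeMeasure T)))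

/-- Weak convergence of a sequence in `W^{1,2}(0,T;ℝ^k)`: weak convergence in `L²` of the functions
and of their derivatives. -/
def WeaklyConvergesW12 (T : ℝ) (x : ℕ → ℝ → Vec k) (x' : ℝ → Vec k) : Prop :=
  WeaklyConvergesL2 T x x' ∧
    ∃ (y : ℕ → ℝ → Vec k) (y' : ℝ → Vec k),
      (∀ j, HasDerivativeAE T (x j) (y j)) ∧ HasDerivativeAE T x' y' ∧ WeaklyConvergesL2 T y y'

end WeakConvergence

/-- A triple `w = (x,u,v)` of a state, a nonlinear control and an affine control, as functions of
time; only the values on `[0,T]` matter, those of `u` and `v` only up to null sets. -/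
structure Triple (n l m : ℕ) where
  x : ℝ → Vec n
  u : ℝ → Vec l
  v : ℝ → Vec m

/-- The space `𝒲 = W^{1,∞} × L^∞ × L^∞`. -/
def MemW {n l m : ℕ} (T : ℝ) (w : Triple n l m) : Prop :=
  MemSobolev T ⊤ w.x ∧ MemLp w.u ⊤ (timeMeasure T) ∧ MemLp w.v ⊤ (timeMeasure T)

/-- The space `𝒲₂ = W^{1,2} × L² × L²`. -/
def MemW2 {n l m : ℕ} (T : ℝ) (w : Triple n l m) : Prop :=
  MemSobolev T 2 w.x ∧ MemLp w.u 2 (timeMeasure T) ∧ MemLp w.v 2 (timeMeasure T)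

/-- Weak convergence of a sequence in `𝒲₂`. -/
def WeaklyConvergesW2 {n l m : ℕ} (T : ℝ) (w : ℕ → Triple n l m) (w' : Triple n l m) : Prop :=
  WeaklyConvergesW12 T (fun j => (w j).x) w'.x ∧
    WeaklyConvergesL2 T (fun j => (w j).u) w'.u ∧
    WeaklyConvergesL2 T (fun j => (w j).v) w'.v

/-- The data of problem (P): horizon `T`, vector fields `f₀, f₁, …, f_m`, cost `φ₀`, inequality
constraints `φ₁, …, φ_{dφ}`, equality constraints `η₁, …, η_{dη}`, and control sets. -/
structure Problem (n l m dφ dη : ℕ) where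
  T : ℝ
  f₀ : Vec n × Vec l → Vec n
  f : Fin m → Vec n × Vec l → Vec n
  φ : Fin (dφ + 1) → Vec n × Vec n → ℝ
  η : Fin dη → Vec n × Vec n → ℝ
  U : Set (Vec l)
  V : Set (Vec m)

/-- Elements `λ = (α, β, p)`. -/
abbrev Multiplier (n dφ dη : ℕ) : Type :=
  (Fin (dφ + 1) → ℝ) × (Fin dη → ℝ) × (ℝ → Covec n)

namespace Problem

variable {n l m dφ dη : ℕ} (P : Problem n l m dφ dη)

/-- All data functions have Lipschitz-continuous second order derivatives. -/
def Regular : Prop :=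
  HasLipschitzSecondDeriv P.f₀ ∧ (∀ i, HasLipschitzSecondDeriv (P.f i)) ∧
    (∀ i, HasLipschitzSecondDeriv (P.φ i)) ∧ ∀ j, HasLipschitzSecondDeriv (P.η j)

/-- `F(x,u,v) = f₀(x,u) + ∑ vᵢ fᵢ(x,u)`. -/
def F (x : Vec n) (u : Vec l) (v : Vec m) : Vec n :=
  P.f₀ (x, u) + ∑ i, v i • P.f i (x, u)

/-- A trajectory: an element of `𝒲` with `ẋ = F(x,u,v)` a.e. -/
def IsTrajectory (w : Triple n l m) : Prop :=
  MemW P.T w ∧ HasDerivativeAE P.T w.x (fun t => P.F (w.x t) (w.u t) (w.v t))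

def IsFeasible (w : Triple n l m) : Prop :=
  P.IsTrajectory w ∧
    (∀ j, P.η j (w.x 0, w.x P.T) = 0) ∧
    (∀ i : Fin dφ, P.φ i.succ (w.x 0, w.x P.T) ≤ 0) ∧
    ∀ᵐ t ∂(timeMeasure P.T), w.u t ∈ P.U ∧ w.v t ∈ P.V

def IsWeakMinimum (w : Triple n l m) : Prop :=
  P.IsFeasible w ∧ ∃ ε : ℝ, 0 < ε ∧ ∀ z : Triple n l m, P.IsFeasible z →
    eLpNorm (fun t => z.x t - w.x t) ⊤ (timeMeasure P.T) < ENNReal.ofReal ε →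
    eLpNorm (fun t => z.u t - w.u t) ⊤ (timeMeasure P.T) < ENNReal.ofReal ε →
    eLpNorm (fun t => z.v t - w.v t) ⊤ (timeMeasure P.T) < ENNReal.ofReal ε →
    P.φ 0 (w.x 0, w.x P.T) ≤ P.φ 0 (z.x 0, z.x P.T)

/-- The controls stay a.e. at a uniform positive distance from the boundary of `U × V`
(the value of `δ` depends on the norm of `ℝ^{l+m}`, its existence does not). -/
def ControlsInterior (w : Triple n l m) : Prop :=
  ∃ δ : ℝ, 0 < δ ∧ ∀ᵐ t ∂(timeMeasure P.T),
    Metric.closedBall (w.u t, w.v t) δ ⊆ P.U ×ˢ P.V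

/-- The pre-Hamiltonian `H[λ](x,u,v,t) = p(t) F(x,u,v)`. -/
def H (lam : Multiplier n dφ dη) (x : Vec n) (u : Vec l) (v : Vec m) (t : ℝ) : ℝ :=
  lam.2.2 t (P.F x u v)

/-- The endpoint Lagrangian `ℓ[λ] = ∑ αᵢ φᵢ + ∑ βⱼ ηⱼ`. -/
def ell (lam : Multiplier n dφ dη) (z : Vec n × Vec n) : ℝ :=
  ∑ i, lam.1 i * P.φ i z + ∑ j, lam.2.1 j * P.η j z

section AlongTriple

/-! Derivatives of `F`, `H[λ]` and `ℓ[λ]` along a given triple `w`. -/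

variable (lam : Multiplier n dφ dη) (w : Triple n l m) (t : ℝ)

def Fx : Vec n →L[ℝ] Vec n := fderiv ℝ (fun x => P.F x (w.u t) (w.v t)) (w.x t)

def Fu : Vec l →L[ℝ] Vec n := fderiv ℝ (fun u => P.F (w.x t) u (w.v t)) (w.u t)

def Fv : Vec m →L[ℝ] Vec n := fderiv ℝ (fun v => P.F (w.x t) (w.u t) v) (w.v t)

def Hx : Covec n := fderiv ℝ (fun x => P.H lam x (w.u t) (w.v t) t) (w.x t)

def Hu : Covec l := fderiv ℝ (fun u => P.H lam (w.x t) u (w.v t) t) (w.u t)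

def Hv : Covec m := fderiv ℝ (fun v => P.H lam (w.x t) (w.u t) v t) (w.v t)

/-- `Hxx a b = bᵀ H_xx a`. -/
def Hxx : Vec n →L[ℝ] Covec n :=
  fderiv ℝ (fun x => fderiv ℝ (fun x' => P.H lam x' (w.u t) (w.v t) t) x) (w.x t)

/-- `Hux a b = bᵀ H_ux a`. -/
def Hux : Vec n →L[ℝ] Covec l :=
  fderiv ℝ (fun x => fderiv ℝ (fun u => P.H lam x u (w.v t) t) (w.u t)) (w.x t)

/-- `Hvx a b = bᵀ H_vx a`. -/
def Hvx : Vec n →L[ℝ] Covec m :=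
  fderiv ℝ (fun x => fderiv ℝ (fun v => P.H lam x (w.u t) v t) (w.v t)) (w.x t)

/-- `Huu a b = bᵀ H_uu a`. -/
def Huu : Vec l →L[ℝ] Covec l :=
  fderiv ℝ (fun u => fderiv ℝ (fun u' => P.H lam (w.x t) u' (w.v t) t) u) (w.u t)

/-- `Hvu a b = bᵀ H_vu a`. -/
def Hvu : Vec l →L[ℝ] Covec m :=
  fderiv ℝ (fun u => fderiv ℝ (fun v => P.H lam (w.x t) u v t) (w.v t)) (w.u t)

/-- The partial derivative of `ℓ[λ]` with respect to the initial state. -/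
def ellx0 : Covec n := fderiv ℝ (fun a => P.ell lam (a, w.x P.T)) (w.x 0)

/-- The partial derivative of `ℓ[λ]` with respect to the final state. -/
def ellxT : Covec n := fderiv ℝ (fun b => P.ell lam (w.x 0, b)) (w.x P.T)

end AlongTriple

/-- The set `Λ` of Lagrange multipliers associated with `w`. -/
def multipliers (w : Triple n l m) : Set (Multiplier n dφ dη) :=
  {lam |
    MemSobolev P.T ⊤ lam.2.2 ∧
    ∑ i, |lam.1 i| + ∑ j, |lam.2.1 j| = 1 ∧
    (∀ i, 0 ≤ lam.1 i) ∧
    HasDerivativeAE P.T lam.2.2 (fun t => -P.Hx lam w t) ∧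
    lam.2.2 0 = -P.ellx0 lam w ∧
    lam.2.2 P.T = P.ellxT lam w ∧
    ∀ᵐ t ∂(timeMeasure P.T), P.Hu lam w t = 0 ∧ P.Hv lam w t = 0}

/-- The space `ℋ₂` of those `w̄ ∈ 𝒲₂` that solve the state equation linearized at `w`. -/
def linearizedSolutions (w : Triple n l m) : Set (Triple n l m) :=
  {b | MemW2 P.T b ∧ HasDerivativeAE P.T b.x
    (fun t => P.Fx w t (b.x t) + P.Fu w t (b.u t) + P.Fv w t (b.v t))}

/-- The critical cone `𝒞₂`. -/
def criticalCone (w : Triple n l m) : Set (Triple n l m) :=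
  {b | b ∈ P.linearizedSolutions w ∧
    (∀ j, fderiv ℝ (P.η j) (w.x 0, w.x P.T) (b.x 0, b.x P.T) = 0) ∧
    ∀ i, fderiv ℝ (P.φ i) (w.x 0, w.x P.T) (b.x 0, b.x P.T) ≤ 0}

/-- The second variation `Ω[λ]` at `w`. -/
def Omega (w : Triple n l m) (lam : Multiplier n dφ dη) (b : Triple n l m) : ℝ :=
  (1 / 2) * fderiv ℝ (fderiv ℝ (P.ell lam)) (w.x 0, w.x P.T)
      (b.x 0, b.x P.T) (b.x 0, b.x P.T) +
    ∫ t in (0 : ℝ)..P.T,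
      ((1 / 2) * P.Hxx lam w t (b.x t) (b.x t) + P.Hux lam w t (b.x t) (b.u t) +
        P.Hvx lam w t (b.x t) (b.v t) + (1 / 2) * P.Huu lam w t (b.u t) (b.u t) +
        P.Hvu lam w t (b.u t) (b.v t))

/-- `Q` is (sequentially) weakly lower semicontinuous on `ℋ₂`. -/
def WeaklyLSC (w : Triple n l m) (Q : Triple n l m → ℝ) : Prop :=
  ∀ (b : ℕ → Triple n l m) (b' : Triple n l m),
    (∀ j, b j ∈ P.linearizedSolutions w) → b' ∈ P.linearizedSolutions w →
    WeaklyConvergesW2 P.T b b' → ∀ c < Q b', ∀ᶠ j in atTop, c < Q (b j)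

/-- The set `(co Λ)^#` of those `λ ∈ co Λ` with `Ω[λ]` weakly l.s.c. on `ℋ₂`. -/
def coSharp (w : Triple n l m) : Set (Multiplier n dφ dη) :=
  {lam | lam ∈ convexHull ℝ (P.multipliers w) ∧ P.WeaklyLSC w (P.Omega w lam)}

end Problem

end PartiallyAffine

end

open MeasureTheory Set Filter Topology

set_option linter.unusedSectionVars false

noncomputable section

/-! Put both controls together as z = (u,v) and regard the problem as a control system with finitely
many endpoint functions: the φ_i, all active, and the η_j. A nearby trajectory that satisfies the
equalities and strictly decreases every φ_i would be feasible and cheaper, so a weak minimum admits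
none (`noDecrease_of_isWeakMinimum`).

A direction is an initial variation together with an L² control variation; it determines the
linearized state. Each endpoint function g_k receives its own costate, hence its own second
variation Ω_k, and everything attached to a multiplier e is the linear combination of these pieces
with coefficients e_k. The multipliers thus live in a finite-dimensional space, the costate being
recovered from e by solving a backward linear equation.

For a critical direction X with bounded control, no bounded Y can satisfy Dη_j(Y) = -Ω_j(X,X) for
all j and Dφ_i(Y) < -Ω_i(X,X) for all i when the linearized equalities are surjective: otherwise a
parabola σX + σ²(Y + correction), repaired by a quantitative open mapping argument, would produce a
forbidden trajectory (`exists_decrease_of_second_order`, `not_decreasing_of_noDecrease`).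

The decisive point is to obtain one multiplier that serves X and satisfies the Legendre condition as
well. The closure Γ of the values (Ω_k(X,X))_k over bounded critical directions need not be convex.
It is, however, stable under adding limits of Ω(z_k,z_k) along bounded weakly null sequences z_k,
since the cross terms disappear, and all translations preserving Γ form a convex cone. Separating
the value at X plus this cone from the forbidden values gives e with e·Ω(X,X) ≥ 0 and e·r ≥ 0 for
every such limit r (`exists_multiplier`). For the controls √2 cos(kt) c on a set B, the limit of Ω_k
is half the integral over B of the Hessian of the Hamiltonian of g_k in the direction c
(`tendsto_secondVariation_oscillationDir`); hence e·r ≥ 0 is the Legendre condition in (u,v)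
(`legendre_iff`). As H is affine in v, that condition reads H_uu ≥ 0 and H_vu = 0.

If the linearized equalities are not surjective, a multiplier supported on the η_j and its opposite
are both normalized, so 0 lies in the convex hull and serves trivially
(`zero_mem_convexHull_of_not_surjective`).

The maximum is attained because the admissible e form a compact set on which Ω(X,X) is linear
(`isCompact_legendreMultipliers`). Weak lower semicontinuity is equivalent to the Legendre
condition: along weakly null directions the states converge strongly and only the control-control
term matters, while the oscillating controls show necessity (`weaklyLSC_iff`). -/

namespace PartiallyAffine

/-! ### Absolutely continuous functions on [0,T] and integration by parts -/

section Basics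

variable {E G : Type*} [NormedAddCommGroup E] [NormedSpace ℝ E] [NormedAddCommGroup G]
  [NormedSpace ℝ G] {T : ℝ}

theorem exists_ae_norm_le_of_memLp_top {A : ℝ → G} (hA : MemLp A ⊤ (timeMeasure T)) :
    ∃ M : ℝ, 0 ≤ M ∧ ∀ᵐ t ∂(timeMeasure T), ‖A t‖ ≤ M := by
  refine ⟨(eLpNorm A ⊤ (timeMeasure T)).toReal, ENNReal.toReal_nonneg, ?_⟩
  filter_upwards [ae_le_eLpNormEssSup (f := A) (μ := timeMeasure T)] with t ht
  have h2 : eLpNorm A ⊤ (timeMeasure T) ≠ ⊤ := hA.2.ne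
  rw [eLpNorm_exponent_top] at *
  have := (ENNReal.toReal_le_toReal (by simp) h2).2 ht
  simpa using this

theorem intervalIntegrable_of_integrableOn {g : ℝ → E} (hg : IntegrableOn g (Icc 0 T)) {s t : ℝ}
    (hs : s ∈ Icc 0 T) (ht : t ∈ Icc 0 T) : IntervalIntegrable g volume s t := by
  refine intervalIntegrable_iff.2 (hg.mono_set ?_)
  exact uIoc_subset_uIcc.trans ((ordConnected_Icc).uIcc_subset hs ht)

theorem intervalIntegral_congr_ae_time {g g' : ℝ → E} (h : g =ᵐ[timeMeasure T] g') {t : ℝ}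
    (ht : t ∈ Icc 0 T) : ∫ s in (0 : ℝ)..t, g s = ∫ s in (0 : ℝ)..t, g' s := by
  rw [intervalIntegral.integral_of_le ht.1, intervalIntegral.integral_of_le ht.1]
  refine setIntegral_congr_ae measurableSet_Ioc ?_
  have := (ae_restrict_iff' measurableSet_Icc).1 h
  filter_upwards [this] with s hs hs'
  exact hs ⟨hs'.1.le, hs'.2.trans ht.2⟩

theorem integral_time_eq (hT : 0 ≤ T) (g : ℝ → E) :
    ∫ t, g t ∂(timeMeasure T) = ∫ t in (0 : ℝ)..T, g t := by
  rw [intervalIntegral.integral_of_le hT, integral_Icc_eq_integral_Ioc]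

theorem norm_intervalIntegral_le_integral_time {g : ℝ → E} (hg : IntegrableOn g (Icc 0 T)) {t : ℝ}
    (ht : t ∈ Icc 0 T) : ‖∫ s in (0 : ℝ)..t, g s‖ ≤ ∫ s, ‖g s‖ ∂(timeMeasure T) := by
  rw [intervalIntegral.integral_of_le ht.1]
  refine (norm_integral_le_integral_norm _).trans ?_
  exact setIntegral_mono_set hg.norm (Eventually.of_forall fun _ => norm_nonneg _)
    (LE.le.eventuallyLE fun s hs => ⟨hs.1.le, hs.2.trans ht.2⟩)

namespace HasDerivativeAE

theorem continuousOn {x y : ℝ → E} (h : HasDerivativeAE T x y) (hT : 0 ≤ T) :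
    ContinuousOn x (Icc 0 T) := by
  have h1 : ContinuousOn (fun t => x 0 + ∫ s in (0 : ℝ)..t, y s) (Icc 0 T) := by
    refine continuousOn_const.add ?_
    have := intervalIntegral.continuousOn_primitive_interval (f := y) (μ := volume) (a := 0) (b := T)
      (by rw [uIcc_of_le hT]; exact h.1)
    rwa [uIcc_of_le hT] at this
  exact h1.congr fun t ht => h.2 t ht

theorem congr {x x' y y' : ℝ → E} (h : HasDerivativeAE T x y) (hT : 0 ≤ T)
    (hx : EqOn x' x (Icc 0 T)) (hy : y' =ᵐ[timeMeasure T] y) : HasDerivativeAE T x' y' := by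
  refine ⟨(integrable_congr hy).2 h.1, fun t ht => ?_⟩
  rw [hx ht, hx ⟨le_rfl, hT⟩, h.2 t ht, intervalIntegral_congr_ae_time hy ht]

theorem add {x x' y y' : ℝ → E} (h : HasDerivativeAE T x y) (h' : HasDerivativeAE T x' y') :
    HasDerivativeAE T (x + x') (y + y') := by
  refine ⟨h.1.add h'.1, fun t ht => ?_⟩
  have h0 : (0 : ℝ) ∈ Icc 0 T := ⟨le_rfl, ht.1.trans ht.2⟩
  simp only [Pi.add_apply]
  rw [intervalIntegral.integral_add (intervalIntegrable_of_integrableOn h.1 h0 ht)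
    (intervalIntegrable_of_integrableOn h'.1 h0 ht), h.2 t ht, h'.2 t ht]
  abel

theorem const_smul {x y : ℝ → E} (h : HasDerivativeAE T x y) (c : ℝ) :
    HasDerivativeAE T (c • x) (c • y) := by
  refine ⟨h.1.smul c, fun t ht => ?_⟩
  simp only [Pi.smul_apply]
  rw [intervalIntegral.integral_smul, h.2 t ht, smul_add]

theorem clm [CompleteSpace E] [CompleteSpace G] {x y : ℝ → E} (h : HasDerivativeAE T x y)
    (Φ : E →L[ℝ] G) :
    HasDerivativeAE T (fun t => Φ (x t)) (fun t => Φ (y t)) := by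
  refine ⟨Φ.integrable_comp h.1, fun t ht => ?_⟩
  have h0 : (0 : ℝ) ∈ Icc 0 T := ⟨le_rfl, ht.1.trans ht.2⟩
  simp only
  rw [Φ.intervalIntegral_comp_comm (intervalIntegrable_of_integrableOn h.1 h0 ht), h.2 t ht,
    map_add]

theorem integral_mul {x x' y y' : ℝ → ℝ} (h : HasDerivativeAE T x y)
    (h' : HasDerivativeAE T x' y') (hT : 0 ≤ T) :
    ∫ t in (0 : ℝ)..T, (y t * x' t + x t * y' t) = x T * x' T - x 0 * x' 0 := by
  have h0 : (0 : ℝ) ∈ Icc 0 T := ⟨le_rfl, hT⟩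
  have h1 : T ∈ Icc 0 T := ⟨hT, le_rfl⟩
  -- The values of x off [0,T] are arbitrary, so the classical statements are applied to the
  -- primitive of y, with which x agrees on [0,T].
  have key : ∀ {x y : ℝ → ℝ}, HasDerivativeAE T x y →
      AbsolutelyContinuousOnInterval (fun t => x 0 + ∫ s in (0 : ℝ)..t, y s) 0 T ∧
      ∀ᵐ t, t ∈ uIcc 0 T → HasDerivAt (fun t => x 0 + ∫ s in (0 : ℝ)..t, y s) (y t) t := by
    intro x y h
    have hi := intervalIntegrable_of_integrableOn h.1 h0 h1
    constructor
    · have hc : AbsolutelyContinuousOnInterval (fun _ : ℝ => x 0) 0 T :=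
        (LipschitzWith.const (x 0)).lipschitzOnWith.absolutelyContinuousOnInterval
      exact hc.add (hi.absolutelyContinuousOnInterval_intervalIntegral (c := 0) (by simp))
    · filter_upwards [hi.ae_hasDerivAt_integral] with t ht ht'
      exact (ht ht' 0 (by simp)).const_add _
  obtain ⟨a1, b1⟩ := key h
  obtain ⟨a2, b2⟩ := key h'
  have := a1.integral_deriv_mul_eq_sub a2
  simp only [← h.2 T h1, ← h'.2 T h1, intervalIntegral.integral_same, add_zero] at this
  rw [← this]
  refine intervalIntegral.integral_congr_ae ?_
  filter_upwards [b1, b2] with t ht1 ht2 ht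
  have ht' : t ∈ uIcc 0 T := uIoc_subset_uIcc ht
  have ht'' : t ∈ Icc 0 T := by rwa [uIcc_of_le hT] at ht'
  rw [(ht1 ht').deriv, (ht2 ht').deriv, ← h.2 t ht'', ← h'.2 t ht'']

/-- In a basis the duality pairing is a finite sum of products of scalar absolutely continuous
functions. This is the identity that turns costates into endpoint formulas. -/
theorem integral_apply [FiniteDimensional ℝ E] [CompleteSpace E] {p q : ℝ → E →L[ℝ] ℝ}
    {x y : ℝ → E} (h : HasDerivativeAE T p q) (h' : HasDerivativeAE T x y) (hT : 0 ≤ T) :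
    ∫ t in (0 : ℝ)..T, (q t (x t) + p t (y t)) = p T (x T) - p 0 (x 0) := by
  have h0 : (0 : ℝ) ∈ Icc 0 T := ⟨le_rfl, hT⟩
  have h1 : T ∈ Icc 0 T := ⟨hT, le_rfl⟩
  let b := Module.finBasis ℝ E
  have hb : ∀ (l : E →L[ℝ] ℝ) (e : E),
      l e = ∑ i, l (b i) * (b.coord i).toContinuousLinearMap e := by
    intro l e
    conv_lhs => rw [← b.sum_repr e]
    simp only [map_sum, map_smul, smul_eq_mul, LinearMap.coe_toContinuousLinearMap',
      Module.Basis.coord_apply]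
    exact Finset.sum_congr rfl fun i _ => mul_comm _ _
  have hp : ∀ i, HasDerivativeAE T (fun t => p t (b i)) (fun t => q t (b i)) := fun i =>
    h.clm (ContinuousLinearMap.apply ℝ ℝ (b i))
  have hx : ∀ i, HasDerivativeAE T (fun t => (b.coord i).toContinuousLinearMap (x t))
      (fun t => (b.coord i).toContinuousLinearMap (y t)) := fun i =>
    h'.clm _
  rw [hb (p T), hb (p 0), ← Finset.sum_sub_distrib]
  simp_rw [← (hp _).integral_mul (hx _) hT]
  rw [← intervalIntegral.integral_finsetSum]
  · refine intervalIntegral.integral_congr fun t _ => ?_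
    rw [hb (q t), hb (p t), ← Finset.sum_add_distrib]
  · intro i _
    have hI := fun {z : ℝ → ℝ} (hz : IntegrableOn z (Icc 0 T)) =>
      intervalIntegrable_of_integrableOn hz h0 h1
    exact ((hI (hp i).1).mul_continuousOn (by
        rw [uIcc_of_le hT]; exact (hx i).continuousOn hT)).add
      ((hI (hx i).1).continuousOn_mul (by
        rw [uIcc_of_le hT]; exact (hp i).continuousOn hT))

end HasDerivativeAE

end Basics

/-! ### Linear differential equations through the Volterra operator -/

section Volterra

variable {E : Type*} [NormedAddCommGroup E] [NormedSpace ℝ E] [CompleteSpace E] {T : ℝ}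

/-- The primitive vanishing at `0` of an integrable function, as a continuous function on
`[0,T]` (zero if the function is not integrable). -/
def primitive (T : ℝ) (g : ℝ → E) : C(Icc (0 : ℝ) T, E) :=
  open Classical in
  if h : 0 ≤ T ∧ IntegrableOn g (Icc 0 T) then
    ⟨fun t => ∫ s in (0 : ℝ)..t, g s, by
      have := intervalIntegral.continuousOn_primitive_interval (f := g) (μ := volume) (a := 0)
        (b := T) (by rw [uIcc_of_le h.1]; exact h.2)
      rw [uIcc_of_le h.1] at this
      exact this.comp_continuous continuous_subtype_val fun t => t.2⟩
  else 0

theorem primitive_apply (hT : 0 ≤ T) {g : ℝ → E} (hg : IntegrableOn g (Icc 0 T))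
    (t : Icc (0 : ℝ) T) : primitive T g t = ∫ s in (0 : ℝ)..t, g s := by
  rw [primitive, dif_pos ⟨hT, hg⟩]; rfl

theorem primitive_congr (hT : 0 ≤ T) {g g' : ℝ → E} (hg : IntegrableOn g (Icc 0 T))
    (h : g =ᵐ[timeMeasure T] g') : primitive T g = primitive T g' := by
  ext t
  rw [primitive_apply hT hg, primitive_apply hT ((integrable_congr h).1 hg),
    intervalIntegral_congr_ae_time h t.2]

theorem primitive_add (hT : 0 ≤ T) {g g' : ℝ → E} (hg : IntegrableOn g (Icc 0 T))
    (hg' : IntegrableOn g' (Icc 0 T)) :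
    primitive T (fun t => g t + g' t) = primitive T g + primitive T g' := by
  ext t
  have h0 : (0 : ℝ) ∈ Icc 0 T := ⟨le_rfl, hT⟩
  rw [ContinuousMap.add_apply, primitive_apply hT hg, primitive_apply hT hg',
    primitive_apply hT (g := fun t => g t + g' t) (hg.add hg'),
    intervalIntegral.integral_add (intervalIntegrable_of_integrableOn hg h0 t.2)
    (intervalIntegrable_of_integrableOn hg' h0 t.2)]

theorem primitive_smul (hT : 0 ≤ T) {g : ℝ → E} (hg : IntegrableOn g (Icc 0 T)) (c : ℝ) :
    primitive T (fun t => c • g t) = c • primitive T g := by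
  ext t
  rw [ContinuousMap.smul_apply, primitive_apply hT hg, primitive_apply hT (g := fun t => c • g t) (hg.smul c),
    intervalIntegral.integral_smul]

theorem norm_primitive_le (hT : 0 ≤ T) {g : ℝ → E} (hg : IntegrableOn g (Icc 0 T)) :
    ‖primitive T g‖ ≤ ∫ s, ‖g s‖ ∂(timeMeasure T) := by
  refine (ContinuousMap.norm_le _ (integral_nonneg fun _ => norm_nonneg _)).2 fun t => ?_
  rw [primitive_apply hT hg]
  exact norm_intervalIntegral_le_integral_time hg t.2

/-- Extension by constants of a function on `[0,T]`. -/
def extend (hT : 0 ≤ T) (x : C(Icc (0 : ℝ) T, E)) : ℝ → E := IccExtend hT x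

theorem continuous_extend (hT : 0 ≤ T) (x : C(Icc (0 : ℝ) T, E)) : Continuous (extend hT x) :=
  x.continuous.Icc_extend'

theorem extend_of_mem (hT : 0 ≤ T) (x : C(Icc (0 : ℝ) T, E)) {t : ℝ} (ht : t ∈ Icc 0 T) :
    extend hT x t = x ⟨t, ht⟩ := IccExtend_of_mem hT _ ht

theorem norm_extend_le (hT : 0 ≤ T) (x : C(Icc (0 : ℝ) T, E)) (t : ℝ) : ‖extend hT x t‖ ≤ ‖x‖ :=
  x.norm_coe_le_norm _

theorem extend_add (hT : 0 ≤ T) (x y : C(Icc (0 : ℝ) T, E)) (t : ℝ) :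
    extend hT (x + y) t = extend hT x t + extend hT y t := rfl

theorem extend_sub (hT : 0 ≤ T) (x y : C(Icc (0 : ℝ) T, E)) (t : ℝ) :
    extend hT (x - y) t = extend hT x t - extend hT y t := rfl

theorem extend_smul (hT : 0 ≤ T) (c : ℝ) (x : C(Icc (0 : ℝ) T, E)) (t : ℝ) :
    extend hT (c • x) t = c • extend hT x t := rfl

theorem hasDerivativeAE_extend_primitive (hT : 0 ≤ T) {g : ℝ → E}
    (hg : IntegrableOn g (Icc 0 T)) (x0 : E) {x : C(Icc (0 : ℝ) T, E)}
    (hx : x = ContinuousMap.const _ x0 + primitive T g) :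
    HasDerivativeAE T (extend hT x) g ∧ extend hT x 0 = x0 := by
  have h0 : (0 : ℝ) ∈ Icc 0 T := ⟨le_rfl, hT⟩
  have hv : ∀ t ∈ Icc 0 T, extend hT x t = x0 + ∫ s in (0 : ℝ)..t, g s := by
    intro t ht
    rw [extend_of_mem hT x ht, hx, ContinuousMap.add_apply, primitive_apply hT hg]; rfl
  have h00 : extend hT x 0 = x0 := by rw [hv 0 h0]; simp
  exact ⟨⟨hg, fun t ht => by rw [hv t ht, h00]⟩, h00⟩

/-- The restriction to `[0,T]` of a function continuous there. -/
def restrictIcc (x : ℝ → E) (hx : ContinuousOn x (Icc 0 T)) : C(Icc (0 : ℝ) T, E) :=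
  ⟨fun t => x t, hx.comp_continuous continuous_subtype_val fun t => t.2⟩

theorem HasDerivativeAE.restrictIcc_eq {x y : ℝ → E} (h : HasDerivativeAE T x y) (hT : 0 ≤ T) :
    restrictIcc x (h.continuousOn hT) = ContinuousMap.const _ (x 0) + primitive T y := by
  ext t
  rw [ContinuousMap.add_apply, primitive_apply hT h.1]
  exact h.2 t t.2

theorem memLp_apply {G H : Type*} [NormedAddCommGroup G] [NormedSpace ℝ G]
    [NormedAddCommGroup H] [NormedSpace ℝ H] {q : ENNReal} {A : ℝ → G →L[ℝ] H} {z : ℝ → G}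
    (hA : MemLp A ⊤ (timeMeasure T)) (hz : MemLp z q (timeMeasure T)) :
    MemLp (fun t => A t (z t)) q (timeMeasure T) := by
  exact (ContinuousLinearMap.id ℝ (G →L[ℝ] H)).memLp_of_bilin q hA hz

theorem integrableOn_apply {G H : Type*} [NormedAddCommGroup G] [NormedSpace ℝ G]
    [NormedAddCommGroup H] [NormedSpace ℝ H] {A : ℝ → G →L[ℝ] H} {z : ℝ → G}
    (hA : MemLp A ⊤ (timeMeasure T)) (hz : IntegrableOn z (Icc 0 T)) :
    IntegrableOn (fun t => A t (z t)) (Icc 0 T) :=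
  memLp_one_iff_integrable.1 (memLp_apply hA (memLp_one_iff_integrable.2 hz))

theorem memLp_extend (hT : 0 ≤ T) (x : C(Icc (0 : ℝ) T, E)) (q : ENNReal) :
    MemLp (extend hT x) q (timeMeasure T) :=
  MemLp.of_bound (continuous_extend hT x).aestronglyMeasurable ‖x‖
    (.of_forall fun t => norm_extend_le hT x t)

theorem integrableOn_apply_extend (hT : 0 ≤ T) {A : ℝ → E →L[ℝ] E}
    (hA : MemLp A ⊤ (timeMeasure T)) (x : C(Icc (0 : ℝ) T, E)) :
    IntegrableOn (fun t => A t (extend hT x t)) (Icc 0 T) :=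
  integrableOn_apply hA (memLp_one_iff_integrable.1 (memLp_extend hT x 1))

/-- The Volterra operator `x ↦ ∫₀ A x`. -/
def volterra (hT : 0 ≤ T) {A : ℝ → E →L[ℝ] E} (hA : MemLp A ⊤ (timeMeasure T)) :
    C(Icc (0 : ℝ) T, E) →L[ℝ] C(Icc (0 : ℝ) T, E) :=
  LinearMap.mkContinuous
    { toFun := fun x => primitive T (fun t => A t (extend hT x t))
      map_add' := fun x y => by
        rw [← primitive_add hT (integrableOn_apply_extend hT hA x)
          (integrableOn_apply_extend hT hA y)]
        simp only [extend_add, map_add]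
      map_smul' := fun c x => by
        simp only [RingHom.id_apply]
        rw [← primitive_smul hT (integrableOn_apply_extend hT hA x)]
        simp only [extend_smul, map_smul] }
    (∫ t, ‖A t‖ ∂(timeMeasure T)) (fun x => by
      refine (norm_primitive_le hT (integrableOn_apply_extend hT hA x)).trans ?_
      rw [← integral_mul_const]
      refine integral_mono (integrableOn_apply_extend hT hA x).norm
        ((hA.integrable le_top).norm.mul_const _) fun t => ?_
      exact ((A t).le_opNorm _).trans
        (mul_le_mul_of_nonneg_left (norm_extend_le hT x t) (norm_nonneg _)))

theorem volterra_apply (hT : 0 ≤ T) {A : ℝ → E →L[ℝ] E} (hA : MemLp A ⊤ (timeMeasure T))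
    (x : C(Icc (0 : ℝ) T, E)) :
    volterra hT hA x = primitive T (fun t => A t (extend hT x t)) := rfl

/-- Integrating the bound for the k-th iterate gains a factor Mt/(k+1). The resulting factorial
makes some power of the operator a strict contraction, whatever the length of the interval. -/
theorem norm_volterra_pow_apply_le (hT : 0 ≤ T) {A : ℝ → E →L[ℝ] E}
    (hA : MemLp A ⊤ (timeMeasure T)) {M : ℝ} (hM0 : 0 ≤ M)
    (hM : ∀ᵐ t ∂(timeMeasure T), ‖A t‖ ≤ M) (x : C(Icc (0 : ℝ) T, E)) (k : ℕ)
    (t : Icc (0 : ℝ) T) :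
    ‖((volterra hT hA) ^ k) x t‖ ≤ (M * t) ^ k / k.factorial * ‖x‖ := by
  induction k generalizing t with
  | zero => simpa using x.norm_coe_le_norm t
  | succ k ih =>
    rw [pow_succ', mul_apply_eq_comp, volterra_apply,
      primitive_apply hT (integrableOn_apply_extend hT hA _)]
    have hb : ∀ᵐ s ∂(timeMeasure T), ‖A s (extend hT ((volterra hT hA ^ k) x) s)‖ ≤
        M * ((M * s) ^ k / k.factorial * ‖x‖) := by
      filter_upwards [hM, ae_restrict_mem measurableSet_Icc] with s hs hs'
      refine ((A s).le_opNorm _).trans (mul_le_mul hs ?_ (norm_nonneg _) hM0)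
      rw [extend_of_mem hT _ hs']
      exact ih ⟨s, hs'⟩
    have hb' : ∀ᵐ s, s ∈ Ioc 0 (t : ℝ) → ‖A s (extend hT ((volterra hT hA ^ k) x) s)‖ ≤
        M * ((M * s) ^ k / k.factorial * ‖x‖) := by
      filter_upwards [(ae_restrict_iff' measurableSet_Icc).1 hb] with s hs hs'
      exact hs ⟨hs'.1.le, hs'.2.trans t.2.2⟩
    refine (intervalIntegral.norm_integral_le_of_norm_le t.2.1 hb'
      (Continuous.intervalIntegrable (by fun_prop) _ _)).trans (le_of_eq ?_)
    have : ∀ s : ℝ, M * ((M * s) ^ k / k.factorial * ‖x‖) =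
        (M ^ (k + 1) / k.factorial * ‖x‖) * s ^ k := fun s => by rw [mul_pow]; ring
    simp_rw [this]
    rw [intervalIntegral.integral_const_mul, integral_pow, Nat.factorial_succ]
    have h1 : (k.factorial : ℝ) ≠ 0 := by positivity
    have h2 : (k : ℝ) + 1 ≠ 0 := by positivity
    push_cast
    field_simp
    ring

theorem isUnit_one_sub_volterra (hT : 0 ≤ T) {A : ℝ → E →L[ℝ] E}
    (hA : MemLp A ⊤ (timeMeasure T)) : IsUnit (1 - volterra hT hA) := by
  obtain ⟨M, hM0, hM⟩ := exists_ae_norm_le_of_memLp_top hA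
  have hlim := FloorSemiring.tendsto_pow_div_factorial_atTop (M * T)
  obtain ⟨k, hk⟩ := ((tendsto_order.1 hlim).2 1 one_pos).exists
  have hn : ‖volterra hT hA ^ k‖ < 1 := by
    refine lt_of_le_of_lt (ContinuousLinearMap.opNorm_le_bound _ (by positivity) fun x => ?_) hk
    refine (ContinuousMap.norm_le _ (by positivity)).2 fun t => ?_
    refine (norm_volterra_pow_apply_le hT hA hM0 hM x k t).trans ?_
    have : M * t ≤ M * T := mul_le_mul_of_nonneg_left t.2.2 hM0
    have h0 : 0 ≤ M * (t : ℝ) := mul_nonneg hM0 t.2.1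
    gcongr
  have h1 := isUnit_one_sub_of_norm_lt_one (R := C(Icc (0 : ℝ) T, E) →L[ℝ] C(Icc (0 : ℝ) T, E)) hn
  -- With K the Volterra operator, 1 - K^k is the product of 1 - K and a polynomial in K. The
  -- factors commute, so invertibility of the product passes to 1 - K.
  rw [← mul_neg_geom_sum] at h1
  refine ((Commute.isUnit_mul_iff ?_).1 h1).1
  refine Commute.sub_left (Commute.one_left _) ?_
  exact Commute.sum_right _ _ _ fun i _ => Commute.self_pow _ _

/-- The resolvent of the Volterra operator: `x = resolvent h` solves `x = h + ∫₀ A x`. -/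
def resolvent (hT : 0 ≤ T) {A : ℝ → E →L[ℝ] E} (hA : MemLp A ⊤ (timeMeasure T)) :
    C(Icc (0 : ℝ) T, E) →L[ℝ] C(Icc (0 : ℝ) T, E) :=
  ((isUnit_one_sub_volterra hT hA).unit⁻¹ : (C(Icc (0 : ℝ) T, E) →L[ℝ] C(Icc (0 : ℝ) T, E))ˣ)

theorem resolvent_eq (hT : 0 ≤ T) {A : ℝ → E →L[ℝ] E} (hA : MemLp A ⊤ (timeMeasure T))
    (h : C(Icc (0 : ℝ) T, E)) :
    resolvent hT hA h = h + primitive T (fun t => A t (extend hT (resolvent hT hA h) t)) := by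
  have h1 : (1 - volterra hT hA) * resolvent hT hA = 1 :=
    (isUnit_one_sub_volterra hT hA).mul_val_inv
  have h2 := congrArg (fun Φ : C(Icc (0 : ℝ) T, E) →L[ℝ] C(Icc (0 : ℝ) T, E) => Φ h) h1
  simp only [mul_apply_eq_comp, sub_apply,
    one_apply_eq_self, volterra_apply] at h2
  exact sub_eq_iff_eq_add.1 h2

theorem eq_resolvent (hT : 0 ≤ T) {A : ℝ → E →L[ℝ] E} (hA : MemLp A ⊤ (timeMeasure T))
    {h x : C(Icc (0 : ℝ) T, E)} (hx : x = h + primitive T (fun t => A t (extend hT x t))) :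
    x = resolvent hT hA h := by
  have h1 : resolvent hT hA * (1 - volterra hT hA) = 1 :=
    (isUnit_one_sub_volterra hT hA).val_inv_mul
  have h2 := congrArg (fun Φ : C(Icc (0 : ℝ) T, E) →L[ℝ] C(Icc (0 : ℝ) T, E) => Φ x) h1
  simp only [mul_apply_eq_comp, sub_apply,
    one_apply_eq_self, volterra_apply] at h2
  rw [← sub_eq_iff_eq_add.2 hx, h2]

theorem exists_linear_ode (hT : 0 ≤ T) {A : ℝ → E →L[ℝ] E} (hA : MemLp A ⊤ (timeMeasure T))
    {g : ℝ → E} (hg : IntegrableOn g (Icc 0 T)) (x0 : E) :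
    ∃ x : ℝ → E, Continuous x ∧ x 0 = x0 ∧ HasDerivativeAE T x (fun t => A t (x t) + g t) := by
  let y := resolvent hT hA (ContinuousMap.const _ x0 + primitive T g)
  have hy := resolvent_eq hT hA (ContinuousMap.const _ x0 + primitive T g)
  rw [add_assoc, add_comm (primitive T g), ← primitive_add hT
    (integrableOn_apply_extend hT hA _) hg] at hy
  have := hasDerivativeAE_extend_primitive hT
    ((integrableOn_apply_extend hT hA y).add hg) x0 hy
  exact ⟨extend hT y, continuous_extend hT y, this.2, this.1⟩

theorem linear_ode_unique (hT : 0 ≤ T) {A : ℝ → E →L[ℝ] E} (hA : MemLp A ⊤ (timeMeasure T))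
    {g x x' : ℝ → E} (hx : HasDerivativeAE T x (fun t => A t (x t) + g t))
    (hx' : HasDerivativeAE T x' (fun t => A t (x' t) + g t)) (h0 : x 0 = x' 0) :
    EqOn x x' (Icc 0 T) := by
  have hd : HasDerivativeAE T (x + (-1 : ℝ) • x') (fun t => A t ((x + (-1 : ℝ) • x') t)) := by
    refine (hx.add (hx'.const_smul (-1))).congr hT (fun _ _ => rfl) (.of_forall fun t => ?_)
    simp only [Pi.add_apply, Pi.smul_apply, map_add, map_smul]
    module
  have hc := hd.restrictIcc_eq hT
  set y := restrictIcc (x + (-1 : ℝ) • x') (hd.continuousOn hT) with hy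
  have hz : y = 0 + primitive T (fun t => A t (extend hT y t)) := by
    rw [zero_add, hc]
    have : ContinuousMap.const (Icc (0 : ℝ) T) ((x + (-1 : ℝ) • x') 0) = 0 := by
      ext; simp [h0]
    rw [this, zero_add]
    -- The constant extension of y agrees with the difference x - x' only on [0,T], which suffices
    -- under the integral.
    refine primitive_congr hT hd.1 ?_
    filter_upwards [ae_restrict_mem measurableSet_Icc] with t ht
    rw [extend_of_mem hT _ ht, ← zero_add (primitive T _), ← this, ← hc]
    rfl
  have h2 := eq_resolvent hT hA hz
  rw [map_zero] at h2
  intro t ht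
  have := DFunLike.congr_fun h2 ⟨t, ht⟩
  have h3 : x t + (-1 : ℝ) • x' t = 0 := this
  rw [neg_one_smul, ← sub_eq_add_neg] at h3
  exact sub_eq_zero.1 h3

end Volterra

/-! ### Backward linear equations and costates -/

section Costate

variable {E : Type*} [NormedAddCommGroup E] [NormedSpace ℝ E] [CompleteSpace E] {T : ℝ}

theorem measurePreserving_reverse (T : ℝ) :
    MeasurePreserving (fun t => T - t) (timeMeasure T) (timeMeasure T) := by
  have := (Measure.measurePreserving_sub_left volume T).restrict_preimage
    (measurableSet_Icc (a := (0 : ℝ)) (b := T))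
  have h : (fun t => T - t) ⁻¹' Icc 0 T = Icc 0 T := by
    ext t
    simp only [mem_Icc, mem_preimage]
    constructor <;> rintro ⟨h1, h2⟩ <;> constructor <;> linarith
  rwa [h] at this

theorem HasDerivativeAE.reverse {x y : ℝ → E} (h : HasDerivativeAE T x y) :
    HasDerivativeAE T (fun t => x (T - t)) (fun t => -y (T - t)) := by
  refine ⟨((measurePreserving_reverse T).integrable_comp_of_integrable h.1).neg, fun t ht => ?_⟩
  have hT : 0 ≤ T := ht.1.trans ht.2
  have h1 : T ∈ Icc 0 T := ⟨hT, le_rfl⟩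
  have h0 : (0 : ℝ) ∈ Icc 0 T := ⟨le_rfl, hT⟩
  have h2 : T - t ∈ Icc 0 T := ⟨by linarith [ht.2], by linarith [ht.1]⟩
  simp only
  rw [intervalIntegral.integral_neg, intervalIntegral.integral_comp_sub_left (fun s => y s) T,
    sub_zero, h.2 _ h2, h.2 _ h1, ← sub_eq_add_neg, add_sub_assoc,
    ← intervalIntegral.integral_add_adjacent_intervals
      (intervalIntegrable_of_integrableOn h.1 h0 h2)
      (intervalIntegrable_of_integrableOn h.1 h2 h1)]
  abel_nf

theorem memLp_clm_comp {G H : Type*} [NormedAddCommGroup G] [NormedSpace ℝ G]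
    [NormedAddCommGroup H] [NormedSpace ℝ H] {q : ENNReal} (Φ : G →L[ℝ] H) {z : ℝ → G}
    (hz : MemLp z q (timeMeasure T)) : MemLp (fun t => Φ (z t)) q (timeMeasure T) :=
  Φ.comp_memLp' hz

section Abstract

variable {D : Type*} [NormedAddCommGroup D] [NormedSpace ℝ D] [CompleteSpace D]

/-- Time reversal reduces the final value problem to an initial value problem. The linear map Φ lets
the coefficients act on another space D; taking p ↦ p ∘ A(t) on linear forms yields the costate
equation. -/
theorem exists_linear_ode_reverse (hT : 0 ≤ T) {A : ℝ → E →L[ℝ] E}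
    (hA : MemLp A ⊤ (timeMeasure T)) (Φ : (E →L[ℝ] E) →L[ℝ] (D →L[ℝ] D)) (π : D) :
    ∃ p : ℝ → D, Continuous p ∧ p T = π ∧ HasDerivativeAE T p (fun t => -(Φ (A t) (p t))) := by
  have hA' : MemLp (fun t => Φ (A (T - t))) ⊤ (timeMeasure T) :=
    memLp_clm_comp Φ (hA.comp_measurePreserving (measurePreserving_reverse T))
  obtain ⟨r, hc, h0, hr⟩ := exists_linear_ode hT hA' (g := 0) (integrable_zero _ _ _) π
  refine ⟨fun t => r (T - t), hc.comp (by fun_prop), by simpa using h0, ?_⟩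
  refine hr.reverse.congr hT (fun _ _ => rfl) (.of_forall fun t => ?_)
  simp

theorem linear_ode_reverse_unique (hT : 0 ≤ T) {A : ℝ → E →L[ℝ] E}
    (hA : MemLp A ⊤ (timeMeasure T)) (Φ : (E →L[ℝ] E) →L[ℝ] (D →L[ℝ] D)) {p p' : ℝ → D}
    (hp : HasDerivativeAE T p (fun t => -(Φ (A t) (p t))))
    (hp' : HasDerivativeAE T p' (fun t => -(Φ (A t) (p' t)))) (h : p T = p' T) :
    EqOn p p' (Icc 0 T) := by
  have hA' : MemLp (fun t => Φ (A (T - t))) ⊤ (timeMeasure T) :=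
    memLp_clm_comp Φ (hA.comp_measurePreserving (measurePreserving_reverse T))
  have key : ∀ {p : ℝ → D}, HasDerivativeAE T p (fun t => -(Φ (A t) (p t))) →
      HasDerivativeAE T (fun t => p (T - t))
        (fun t => Φ (A (T - t)) (p (T - t)) + (0 : ℝ → D) t) :=
    fun hp => hp.reverse.congr hT (fun _ _ => rfl) (.of_forall fun t => by simp)
  have := linear_ode_unique hT hA' (key hp) (key hp') (by simpa using h)
  intro t ht
  simpa using this (x := T - t) ⟨by linarith [ht.2], by linarith [ht.1]⟩

end Abstract

theorem exists_costate (hT : 0 ≤ T) {A : ℝ → E →L[ℝ] E} (hA : MemLp A ⊤ (timeMeasure T))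
    (π : E →L[ℝ] ℝ) :
    ∃ p : ℝ → E →L[ℝ] ℝ, Continuous p ∧ p T = π ∧
      HasDerivativeAE T p (fun t => -(p t ∘L A t)) :=
  exists_linear_ode_reverse hT hA (ContinuousLinearMap.compL ℝ E E ℝ).flip π

theorem costate_unique (hT : 0 ≤ T) {A : ℝ → E →L[ℝ] E} (hA : MemLp A ⊤ (timeMeasure T))
    {p p' : ℝ → E →L[ℝ] ℝ} (hp : HasDerivativeAE T p (fun t => -(p t ∘L A t)))
    (hp' : HasDerivativeAE T p' (fun t => -(p' t ∘L A t))) (h : p T = p' T) :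
    EqOn p p' (Icc 0 T) :=
  linear_ode_reverse_unique hT hA (ContinuousLinearMap.compL ℝ E E ℝ).flip hp hp' h

end Costate

/-! ### Taylor estimates uniform in the base point -/

section Taylor

variable {W E : Type*} [NormedAddCommGroup W] [NormedSpace ℝ W] [FiniteDimensional ℝ W]
  [NormedAddCommGroup E] [NormedSpace ℝ E] {F : W → E}

theorem second_fderiv_symm (hF : ContDiff ℝ 2 F) (w a b : W) :
    fderiv ℝ (fderiv ℝ F) w a b = fderiv ℝ (fderiv ℝ F) w b a :=
  (hF.contDiffAt.isSymmSndFDerivAt (by simp)).eq a b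

/-- Closed balls are compact in finite dimension. Uniformity over ‖w‖ ≤ R is needed because the
estimates are applied along a reference trajectory that is only measurable and essentially bounded.
-/
theorem exists_uniform_modulus {G : Type*} [NormedAddCommGroup G] {f : W → G} (hf : Continuous f)
    (R : ℝ) {ε : ℝ} (hε : 0 < ε) :
    ∃ δ > 0, ∀ w h : W, ‖w‖ ≤ R → ‖h‖ ≤ δ → ‖f (w + h) - f w‖ ≤ ε := by
  have : ProperSpace W := FiniteDimensional.proper ℝ W
  have hc := (isCompact_closedBall (0 : W) (R + 1)).uniformContinuousOn_of_continuous
    hf.continuousOn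
  obtain ⟨δ, hδ, h⟩ := Metric.uniformContinuousOn_iff.1 hc ε hε
  -- The bound by 1 keeps w + k in the ball of radius R + 1; halving δ makes the distance strictly
  -- smaller than δ.
  refine ⟨min (δ / 2) 1, by positivity, fun w k hw hk => ?_⟩
  have h1 : ‖k‖ ≤ 1 := hk.trans (min_le_right _ _)
  have h2 : ‖k‖ < δ := (hk.trans (min_le_left _ _)).trans_lt (by linarith)
  rw [← dist_eq_norm]
  refine (h _ ?_ _ ?_ ?_).le
  · simpa using (norm_add_le w k).trans (add_le_add hw h1)
  · simpa using hw.trans (by linarith)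
  · simpa [dist_eq_norm] using h2

/-- Mean value inequality on a small ball for k ↦ F(w+k) - F'(w)k, whose derivative is small there
by uniform continuity of F'. -/
theorem exists_uniform_strict_bound (hF : ContDiff ℝ 1 F) (R : ℝ) {ε : ℝ} (hε : 0 < ε) :
    ∃ δ > 0, ∀ w h h' : W, ‖w‖ ≤ R → ‖h‖ ≤ δ → ‖h'‖ ≤ δ →
      ‖F (w + h) - F (w + h') - fderiv ℝ F w (h - h')‖ ≤ ε * ‖h - h'‖ := by
  obtain ⟨δ, hδ, H⟩ := exists_uniform_modulus (hF.continuous_fderiv one_ne_zero) R hε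
  refine ⟨δ, hδ, fun w h h' hw hh hh' => ?_⟩
  have hd : ∀ k ∈ Metric.closedBall (0 : W) δ,
      HasFDerivWithinAt (fun k => F (w + k) - fderiv ℝ F w k)
        (fderiv ℝ F (w + k) - fderiv ℝ F w) (Metric.closedBall 0 δ) k := by
    intro k _
    have h1 := ((hF.differentiable one_ne_zero (w + k)).hasFDerivAt).comp k
      ((hasFDerivAt_id k).const_add w)
    exact (h1.sub (fderiv ℝ F w).hasFDerivAt).hasFDerivWithinAt
  have := (convex_closedBall (0 : W) δ).norm_image_sub_le_of_norm_hasFDerivWithin_le hd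
    (fun k hk => H w k hw (by simpa using hk)) (x := h') (y := h) (by simpa using hh')
    (by simpa using hh)
  convert this using 2
  rw [map_sub]; abel

/-- The derivative of the second order remainder is the first order remainder of F', at most ε‖k‖ by
the strict bound for F'. The mean value inequality on the ball of radius ‖h‖ supplies the second
factor ‖h‖. -/
theorem exists_uniform_taylor_bound (hF : ContDiff ℝ 2 F) (R : ℝ) {ε : ℝ} (hε : 0 < ε) :
    ∃ δ > 0, ∀ w h : W, ‖w‖ ≤ R → ‖h‖ ≤ δ →
      ‖F (w + h) - F w - fderiv ℝ F w h - (1 / 2 : ℝ) • fderiv ℝ (fderiv ℝ F) w h h‖ ≤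
        ε * ‖h‖ ^ 2 := by
  have hF' : ContDiff ℝ 1 (fderiv ℝ F) := hF.fderiv_right (by norm_num)
  obtain ⟨δ, hδ, H⟩ := exists_uniform_strict_bound hF' R hε
  refine ⟨δ, hδ, fun w h hw hh => ?_⟩
  set S := fderiv ℝ (fderiv ℝ F) w with hS
  have hd : ∀ k ∈ Metric.closedBall (0 : W) ‖h‖,
      HasFDerivWithinAt (fun k => F (w + k) - fderiv ℝ F w k - (1 / 2 : ℝ) • S k k)
        (fderiv ℝ F (w + k) - fderiv ℝ F w - S k) (Metric.closedBall 0 ‖h‖) k := by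
    intro k _
    have h1 := ((hF.differentiable two_ne_zero (w + k)).hasFDerivAt).comp k
      ((hasFDerivAt_id k).const_add w)
    have h2 : HasFDerivAt (fun k => S k k) (S k + S.flip k) k := by
      exact (S.hasFDerivAt (x := k)).clm_apply (hasFDerivAt_id k)
    -- Symmetry of the second derivative: half the quadratic form has derivative S k.
    have h3 : (1 / 2 : ℝ) • (S k + S.flip k) = S k := by
      ext v
      have : S v k = S k v := second_fderiv_symm hF w v k
      simp only [smul_apply, add_apply, ContinuousLinearMap.flip_apply, this]
      module
    have h4 := (h1.sub (fderiv ℝ F w).hasFDerivAt).sub (h2.const_smul (1 / 2 : ℝ))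
    rw [h3] at h4
    exact h4.hasFDerivWithinAt
  have := (convex_closedBall (0 : W) ‖h‖).norm_image_sub_le_of_norm_hasFDerivWithin_le hd
    (C := ε * ‖h‖) (fun k hk => ?_) (x := 0) (y := h) (by simp) (by simp)
  · simp only [map_zero, add_zero, sub_zero, smul_zero] at this
    rw [mul_assoc, ← pow_two] at this
    convert this using 2
    abel
  · have hk' : ‖k‖ ≤ ‖h‖ := by simpa using hk
    have := H w k 0 hw (hk'.trans hh) (by simpa using hδ.le)
    simp only [add_zero, sub_zero] at this
    exact this.trans (mul_le_mul_of_nonneg_left hk' hε.le)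

end Taylor

/-! ### Second order expansions and exact solutions near a parabola -/

section SecondOrder

variable {X Y : Type*} [NormedAddCommGroup X] [NormedSpace ℝ X]
  [NormedAddCommGroup Y] [NormedSpace ℝ Y]

/-- `f x = f 0 + f' x + ½ Q(x,x) + o(‖x‖²)` as `x → 0`. -/
def HasSecondOrderExpansion (f : X → Y) (f' : X →L[ℝ] Y) (Q : X →L[ℝ] X →L[ℝ] Y) : Prop :=
  ∀ ε > 0, ∀ᶠ x in 𝓝 (0 : X), ‖f x - f 0 - f' x - (1 / 2 : ℝ) • Q x x‖ ≤ ε * ‖x‖ ^ 2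

/-- On the curve σx₁ + σ²x₂ the coefficient of σ² is f'x₂ + ½Q(x₁,x₁). An extra displacement y of
size a small multiple of σ² changes the value by a small multiple of σ² only. The bound for all η' ≤
η allows one common radius for finitely many functions. -/
theorem HasSecondOrderExpansion.along_parabola {f : X → Y} {f' : X →L[ℝ] Y}
    {Q : X →L[ℝ] X →L[ℝ] Y} (hf : HasSecondOrderExpansion f f' Q) (x₁ x₂ : X) {ε : ℝ}
    (hε : 0 < ε) :
    ∃ η > 0, ∀ η' ≤ η, ∀ᶠ σ in 𝓝[>] (0 : ℝ), ∀ y, ‖y‖ ≤ η' * σ ^ 2 →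
      ‖f (σ • x₁ + σ ^ 2 • x₂ + y) - f 0 - σ • f' x₁ -
        σ ^ 2 • (f' x₂ + (1 / 2 : ℝ) • Q x₁ x₁)‖ ≤ ε * σ ^ 2 := by
  set m := ‖x₁‖ + 1 with hm
  have hm0 : 0 < m := by positivity
  -- The error splits into three parts of size εσ²/3: the remainder of f, the term f'y, and the
  -- change of Q between x₁ and the nearby vector x₁ + k below. The factor m² is the bound on ‖x₁ +
  -- k‖².
  obtain ⟨δ, hδ, hδ'⟩ := Metric.eventually_nhds_iff.1 (hf (ε / (3 * m ^ 2)) (by positivity))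
  have hQ : Tendsto (fun k : X => Q (x₁ + k) (x₁ + k)) (𝓝 0) (𝓝 (Q x₁ x₁)) := by
    have : Continuous fun k : X => Q (x₁ + k) (x₁ + k) := by fun_prop
    simpa using this.tendsto 0
  obtain ⟨δ₁, hδ₁, hδ₁'⟩ := Metric.tendsto_nhds_nhds.1 hQ (ε / 3) (by positivity)
  refine ⟨ε / (3 * (‖f'‖ + 1)), by positivity, fun η' hη' => ?_⟩
  set η := ε / (3 * (‖f'‖ + 1)) with hη
  have hη0 : 0 < η := by positivity
  set c := ‖x₂‖ + η with hc
  have hc0 : 0 < c := by positivity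
  have h1 : ∀ᶠ σ in 𝓝[>] (0 : ℝ), σ < min (min 1 (δ / m)) (min (δ₁ / c) (1 / c)) :=
    nhdsWithin_le_nhds (eventually_lt_nhds (by positivity))
  filter_upwards [h1, self_mem_nhdsWithin] with σ hσ hσ0 y hy
  have hσ0 : 0 < σ := hσ0
  rw [lt_min_iff, lt_min_iff, lt_min_iff, lt_div_iff₀ hm0, lt_div_iff₀ hc0, lt_div_iff₀ hc0] at hσ
  obtain ⟨⟨hs1, hs2⟩, hs3, hs4⟩ := hσ
  have hy' : ‖y‖ ≤ η * σ ^ 2 := hy.trans (by gcongr)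
  -- Factoring out σ turns the displaced point into σ(x₁ + k), and k = O(σ) because y = O(σ²).
  set k := σ • x₂ + σ⁻¹ • y with hk
  have hX : σ • x₁ + σ ^ 2 • x₂ + y = σ • (x₁ + k) := by
    rw [hk, smul_add, smul_add, smul_smul, smul_smul, mul_inv_cancel₀ hσ0.ne', one_smul, pow_two,
      add_assoc]
  have hkn : ‖k‖ ≤ σ * c := by
    refine (norm_add_le _ _).trans ?_
    rw [norm_smul, norm_smul, norm_inv, Real.norm_of_nonneg hσ0.le, hc, mul_add]
    refine add_le_add le_rfl ?_
    rw [inv_mul_le_iff₀ hσ0]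
    linarith
  have hxk : ‖x₁ + k‖ ≤ m := (norm_add_le _ _).trans (by linarith)
  have hXn : ‖σ • (x₁ + k)‖ ≤ σ * m := by
    rw [norm_smul, Real.norm_of_nonneg hσ0.le]; gcongr
  have e1 : ‖f (σ • (x₁ + k)) - f 0 - f' (σ • (x₁ + k)) -
      (1 / 2 : ℝ) • Q (σ • (x₁ + k)) (σ • (x₁ + k))‖ ≤ ε / 3 * σ ^ 2 := by
    refine (hδ' (by rw [dist_zero_right]; exact hXn.trans_lt hs2)).trans ?_
    calc ε / (3 * m ^ 2) * ‖σ • (x₁ + k)‖ ^ 2 ≤ ε / (3 * m ^ 2) * (σ * m) ^ 2 := by gcongr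
      _ = ε / 3 * σ ^ 2 := by field_simp
  have e2 : ‖f' y‖ ≤ ε / 3 * σ ^ 2 := by
    refine (f'.le_opNorm y).trans ?_
    calc ‖f'‖ * ‖y‖ ≤ (‖f'‖ + 1) * (η * σ ^ 2) := by gcongr; linarith
      _ = ε / 3 * σ ^ 2 := by rw [hη]; field_simp
  have e3 : ‖(σ ^ 2 / 2) • (Q (x₁ + k) (x₁ + k) - Q x₁ x₁)‖ ≤ ε / 3 * σ ^ 2 := by
    have := hδ₁' (x := k) (by rw [dist_zero_right]; exact hkn.trans_lt hs3)
    rw [dist_eq_norm] at this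
    rw [norm_smul, Real.norm_of_nonneg (by positivity)]
    calc σ ^ 2 / 2 * ‖Q (x₁ + k) (x₁ + k) - Q x₁ x₁‖ ≤ σ ^ 2 / 2 * (ε / 3) := by gcongr
      _ ≤ ε / 3 * σ ^ 2 := by nlinarith [mul_pos hε (pow_pos hσ0 2)]
  have hf'X : f' (σ • (x₁ + k)) = σ • f' x₁ + σ ^ 2 • f' x₂ + f' y := by
    rw [← hX]; simp
  have hdec : f (σ • x₁ + σ ^ 2 • x₂ + y) - f 0 - σ • f' x₁ -
        σ ^ 2 • (f' x₂ + (1 / 2 : ℝ) • Q x₁ x₁) =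
      (f (σ • (x₁ + k)) - f 0 - f' (σ • (x₁ + k)) -
        (1 / 2 : ℝ) • Q (σ • (x₁ + k)) (σ • (x₁ + k))) + f' y +
        (σ ^ 2 / 2) • (Q (x₁ + k) (x₁ + k) - Q x₁ x₁) := by
    rw [hX, hf'X, map_smul, map_smul, smul_apply]
    module
  rw [hdec]
  refine (norm_add₃_le).trans ?_
  linarith

/-- Second order necessary condition for an abstract problem: a critical direction of first order
and a second order correction along which all the functions `φ i` decrease strictly lead to exact
solutions of `G x = G 0` at which all the functions `φ i` have decreased. -/
theorem exists_decrease_of_second_order [CompleteSpace X] [CompleteSpace Y] {ι : Type*} [Finite ι]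
    {G : X → Y} {G' : X →L[ℝ] Y}
    {Q : X →L[ℝ] X →L[ℝ] Y} (hG : HasStrictFDerivAt G G' 0)
    (hG2 : HasSecondOrderExpansion G G' Q) (hsurj : Function.Surjective G')
    {φ : ι → X → ℝ} {φ' : ι → X →L[ℝ] ℝ} {q : ι → X →L[ℝ] X →L[ℝ] ℝ}
    (hφ : ∀ i, HasSecondOrderExpansion (φ i) (φ' i) (q i)) {x₁ x₂ : X} (h1 : G' x₁ = 0)
    (h2 : G' x₂ + (1 / 2 : ℝ) • Q x₁ x₁ = 0) (h3 : ∀ i, φ' i x₁ ≤ 0)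
    (h4 : ∀ i, φ' i x₂ + (1 / 2 : ℝ) * q i x₁ x₁ < 0) {ρ : ℝ} (hρ : 0 < ρ) :
    ∃ x, ‖x‖ < ρ ∧ G x = G 0 ∧ ∀ i, φ i x < φ i 0 := by
  have hr : G'.range = ⊤ := LinearMap.range_eq_top.2 hsurj
  set s := G'.nonlinearRightInverseOfSurjective hr
  have hs : 0 < s.nnnorm := G'.nonlinearRightInverseOfSurjective_nnnorm_pos hr
  -- Linearization error at half the openness constant of G', so that the margin κ below stays
  -- positive and G maps a ball of radius r onto a set containing the ball of radius κr around the
  -- image of the center.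
  set c : NNReal := s.nnnorm⁻¹ / 2 with hc
  have hc0 : 0 < c := by positivity
  obtain ⟨U, hU, hGU⟩ := hG.approximates_deriv_on_nhds (c := c) (Or.inr hc0)
  obtain ⟨R, hR, hRU⟩ := Metric.mem_nhds_iff.1 hU
  have hφη : ∀ i, ∃ η > 0, ∀ η' ≤ η, ∀ᶠ σ in 𝓝[>] (0 : ℝ), ∀ y, ‖y‖ ≤ η' * σ ^ 2 →
      φ i (σ • x₁ + σ ^ 2 • x₂ + y) < φ i 0 := by
    intro i
    have hε : 0 < -(φ' i x₂ + (1 / 2 : ℝ) * q i x₁ x₁) / 2 := by linarith [h4 i]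
    obtain ⟨η, hη, H⟩ := (hφ i).along_parabola x₁ x₂ hε
    refine ⟨η, hη, fun η' hη' => ?_⟩
    filter_upwards [H η' hη', self_mem_nhdsWithin] with σ hσ hσ0 y hy
    have hσ0 : 0 < σ := hσ0
    have := (le_abs_self _).trans (hσ y hy)
    simp only [smul_eq_mul] at this
    have a1 : σ * φ' i x₁ ≤ 0 := mul_nonpos_of_nonneg_of_nonpos hσ0.le (h3 i)
    nlinarith [h4 i, pow_pos hσ0 2]
  choose η hη H using hφη
  obtain ⟨η₀, hη₀, hη₀'⟩ : ∃ η₀ > 0, ∀ i, η₀ ≤ η i := by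
    have := Fintype.ofFinite ι
    rcases isEmpty_or_nonempty ι with hι | hι
    · exact ⟨1, one_pos, fun i => hι.elim i⟩
    · obtain ⟨j, hj⟩ := Finite.exists_min η
      exact ⟨η j, hη j, hj⟩
  set κ : ℝ := (s.nnnorm : ℝ)⁻¹ - c with hκ
  have hκ0 : 0 < κ := by
    rw [hκ, hc]; push_cast
    have : (0 : ℝ) < (s.nnnorm : ℝ)⁻¹ := by positivity
    linarith
  -- The point of the parabola itself misses G = G 0 by at most κη₀σ². The covered ball has exactly
  -- this radius when the source ball has radius η₀σ², within which every φ i still decreases.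
  obtain ⟨ηG, hηG, HG⟩ := hG2.along_parabola x₁ x₂ (ε := κ * η₀) (by positivity)
  have hball : ∀ᶠ σ in 𝓝[>] (0 : ℝ), ‖σ • x₁ + σ ^ 2 • x₂‖ + η₀ * σ ^ 2 < min R ρ := by
    have : Continuous fun σ : ℝ => ‖σ • x₁ + σ ^ 2 • x₂‖ + η₀ * σ ^ 2 := by fun_prop
    have := this.tendsto 0
    simp only [zero_smul, ne_eq, OfNat.ofNat_ne_zero, not_false_eq_true, zero_pow, add_zero,
      norm_zero, mul_zero] at this
    exact nhdsWithin_le_nhds ((tendsto_order.1 this).2 _ (lt_min hR hρ))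
  obtain ⟨σ, hσ1, hσ2, hσ3⟩ := ((eventually_all.2 fun i => H i η₀ (hη₀' i)).and
    ((HG 0 hηG.le).and hball)).exists
  have hσ2 := hσ2 0 (by simp)
  rw [h1, h2, add_zero, smul_zero, smul_zero, sub_zero, sub_zero] at hσ2
  have hsub : Metric.closedBall (σ • x₁ + σ ^ 2 • x₂) (η₀ * σ ^ 2) ⊆ Metric.ball 0 (min R ρ) := by
    intro x hx
    rw [mem_ball_zero_iff]
    rw [mem_closedBall_iff_norm] at hx
    have := norm_add_le (x - (σ • x₁ + σ ^ 2 • x₂)) (σ • x₁ + σ ^ 2 • x₂)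
    rw [sub_add_cancel] at this
    linarith
  have hS := hGU.surjOn_closedBall_of_nonlinearRightInverse s (ε := η₀ * σ ^ 2)
    (b := σ • x₁ + σ ^ 2 • x₂) (by positivity)
    ((hsub.trans (Metric.ball_subset_ball (min_le_left _ _))).trans hRU)
  obtain ⟨x, hx, hGx⟩ := hS (show G 0 ∈ _ by
    rw [mem_closedBall_iff_norm, norm_sub_rev]
    refine hσ2.trans (le_of_eq ?_)
    rw [hκ]; ring)
  refine ⟨x, ?_, hGx, fun i => ?_⟩
  · have := hsub hx
    rw [mem_ball_zero_iff] at this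
    exact this.trans_le (min_le_right _ _)
  · have := hσ1 i (x - (σ • x₁ + σ ^ 2 • x₂)) (by rwa [← mem_closedBall_iff_norm])
    rwa [add_sub_cancel] at this

end SecondOrder

theorem HasSecondOrderExpansion.prodMk {X Y Y' : Type*} [NormedAddCommGroup X] [NormedSpace ℝ X]
    [NormedAddCommGroup Y] [NormedSpace ℝ Y] [NormedAddCommGroup Y'] [NormedSpace ℝ Y']
    {f : X → Y} {f' : X →L[ℝ] Y} {Q : X →L[ℝ] X →L[ℝ] Y} {g : X → Y'} {g' : X →L[ℝ] Y'}
    {R : X →L[ℝ] X →L[ℝ] Y'} (hf : HasSecondOrderExpansion f f' Q)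
    (hg : HasSecondOrderExpansion g g' R) {P : X →L[ℝ] X →L[ℝ] Y × Y'}
    (hP : ∀ x, P x x = (Q x x, R x x)) :
    HasSecondOrderExpansion (fun x => (f x, g x)) (f'.prod g') P := by
  intro ε hε
  filter_upwards [hf ε hε, hg ε hε] with x h1 h2
  rw [hP]
  exact max_le h1 h2

theorem hasSecondOrderExpansion_comp_affine {X W Y : Type*} [NormedAddCommGroup X]
    [NormedSpace ℝ X] [NormedAddCommGroup Y] [NormedSpace ℝ Y] [NormedAddCommGroup W]
    [NormedSpace ℝ W] [FiniteDimensional ℝ W] {f : W → Y} (hf : ContDiff ℝ 2 f) (w : W)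
    (L : X →L[ℝ] W) :
    HasSecondOrderExpansion (fun x => f (w + L x)) (fderiv ℝ f w ∘L L)
      ((fderiv ℝ (fderiv ℝ f) w).bilinearComp L L) := by
  intro ε hε
  obtain ⟨δ, hδ, H⟩ := exists_uniform_taylor_bound hf ‖w‖ (ε := ε / (‖L‖ + 1) ^ 2) (by positivity)
  have h1 : ∀ᶠ x in 𝓝 (0 : X), ‖L x‖ ≤ δ := by
    have : Tendsto (fun x => ‖L x‖) (𝓝 0) (𝓝 0) := by
      have : Continuous fun x => ‖L x‖ := by fun_prop
      simpa using this.tendsto 0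
    exact ((tendsto_order.1 this).2 δ hδ).mono fun _ h => h.le
  filter_upwards [h1] with x hx
  have := H w (L x) le_rfl hx
  simp only [map_zero, add_zero]
  refine this.trans ?_
  have hL : ‖L x‖ ≤ (‖L‖ + 1) * ‖x‖ := (L.le_opNorm x).trans (by gcongr; linarith)
  calc ε / (‖L‖ + 1) ^ 2 * ‖L x‖ ^ 2 ≤ ε / (‖L‖ + 1) ^ 2 * ((‖L‖ + 1) * ‖x‖) ^ 2 := by gcongr
    _ = ε * ‖x‖ ^ 2 := by field_simp

theorem memLp_top_comp {W G : Type*} [NormedAddCommGroup W] [NormedSpace ℝ W]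
    [FiniteDimensional ℝ W] [NormedAddCommGroup G] {T : ℝ} {f : W → G} (hf : Continuous f)
    {h : ℝ → W} (hh : MemLp h ⊤ (timeMeasure T)) :
    MemLp (fun t => f (h t)) ⊤ (timeMeasure T) := by
  have : ProperSpace W := FiniteDimensional.proper ℝ W
  obtain ⟨M, _, hM⟩ := exists_ae_norm_le_of_memLp_top hh
  obtain ⟨C, hC⟩ := (isCompact_closedBall (0 : W) M).exists_bound_of_continuousOn hf.continuousOn
  refine memLp_top_of_bound (hf.comp_aestronglyMeasurable hh.1) C ?_
  filter_upwards [hM] with t ht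
  exact hC _ (by simpa using ht)

/-- A control system `ẋ = F(x,z)` on `[0,T]` together with a reference trajectory. -/
structure ControlSystem (E Z : Type*) [NormedAddCommGroup E] [NormedSpace ℝ E]
    [NormedAddCommGroup Z] [NormedSpace ℝ Z] where
  T : ℝ
  T_pos : 0 < T
  F : E × Z → E
  contDiff_F : ContDiff ℝ 2 F
  x : ℝ → E
  z : ℝ → Z
  memLp_z : MemLp z ⊤ (timeMeasure T)
  hasDerivativeAE_x : HasDerivativeAE T x (fun t => F (x t, z t))

theorem primitive_sub {E : Type*} [NormedAddCommGroup E] [NormedSpace ℝ E] [CompleteSpace E]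
    {T : ℝ} (hT : 0 ≤ T) {g g' : ℝ → E} (hg : IntegrableOn g (Icc 0 T))
    (hg' : IntegrableOn g' (Icc 0 T)) :
    primitive T (fun t => g t - g' t) = primitive T g - primitive T g' := by
  have := primitive_add hT (g := fun t => g t - g' t) (hg.sub hg') hg'
  simp only [sub_add_cancel] at this
  rw [this, add_sub_cancel_right]

/-! ### Linearization of the dynamics along the reference trajectory -/

namespace ControlSystem

variable {E Z : Type*} [NormedAddCommGroup E] [NormedSpace ℝ E] [FiniteDimensional ℝ E]
  [CompleteSpace E] [NormedAddCommGroup Z] [NormedSpace ℝ Z] [FiniteDimensional ℝ Z]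
  (sys : ControlSystem E Z)

theorem T_nonneg : 0 ≤ sys.T := sys.T_pos.le

/-- The reference trajectory. -/
def ref (t : ℝ) : E × Z := (sys.x t, sys.z t)

/-- The derivative of the dynamics along the reference trajectory. -/
def D (t : ℝ) : E × Z →L[ℝ] E := fderiv ℝ sys.F (sys.ref t)

/-- The second derivative of the dynamics along the reference trajectory. -/
def S (t : ℝ) : E × Z →L[ℝ] E × Z →L[ℝ] E := fderiv ℝ (fderiv ℝ sys.F) (sys.ref t)

/-- The partial derivative of the dynamics with respect to the state. -/
def A (t : ℝ) : E →L[ℝ] E := sys.D t ∘L ContinuousLinearMap.inl ℝ E Z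

theorem memLp_x : MemLp sys.x ⊤ (timeMeasure sys.T) := by
  have hc := sys.hasDerivativeAE_x.continuousOn sys.T_nonneg
  obtain ⟨C, hC⟩ := (isCompact_Icc (a := (0 : ℝ)) (b := sys.T)).exists_bound_of_continuousOn hc
  exact memLp_top_of_bound (hc.aestronglyMeasurable measurableSet_Icc) C
    ((ae_restrict_mem measurableSet_Icc).mono hC)

theorem memLp_ref : MemLp sys.ref ⊤ (timeMeasure sys.T) := by
  obtain ⟨M, _, hM⟩ := exists_ae_norm_le_of_memLp_top sys.memLp_x
  obtain ⟨M', _, hM'⟩ := exists_ae_norm_le_of_memLp_top sys.memLp_z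
  refine memLp_top_of_bound (sys.memLp_x.1.prodMk sys.memLp_z.1) (max M M') ?_
  filter_upwards [hM, hM'] with t h1 h2
  exact max_le_max h1 h2

theorem memLp_D : MemLp sys.D ⊤ (timeMeasure sys.T) :=
  memLp_top_comp (sys.contDiff_F.continuous_fderiv two_ne_zero) sys.memLp_ref

theorem memLp_S : MemLp sys.S ⊤ (timeMeasure sys.T) :=
  memLp_top_comp ((sys.contDiff_F.fderiv_right (m := 1) (by norm_num)).continuous_fderiv
    one_ne_zero) sys.memLp_ref

theorem memLp_A : MemLp sys.A ⊤ (timeMeasure sys.T) :=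
  memLp_top_comp (f := fun w => fderiv ℝ sys.F w ∘L ContinuousLinearMap.inl ℝ E Z)
    ((sys.contDiff_F.continuous_fderiv two_ne_zero).clm_comp continuous_const) sys.memLp_ref

theorem S_symm (t : ℝ) (a b : E × Z) : sys.S t a b = sys.S t b a :=
  second_fderiv_symm sys.contDiff_F _ a b

end ControlSystem

/-- A family of perturbations of the controls and of the initial state, depending linearly on a
parameter in `Θ`. -/
structure Perturbation {E Z : Type*} [NormedAddCommGroup E] [NormedSpace ℝ E]
    [NormedAddCommGroup Z] [NormedSpace ℝ Z] (sys : ControlSystem E Z) (Θ : Type*)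
    [NormedAddCommGroup Θ] [NormedSpace ℝ Θ] where
  init : Θ →L[ℝ] E
  ctrl : ℝ → Θ →L[ℝ] Z
  memLp_ctrl : MemLp ctrl ⊤ (timeMeasure sys.T)

/-! ### The integrated state equation on a family of bounded perturbations -/

namespace Perturbation

variable {E Z Θ : Type*} [NormedAddCommGroup E] [NormedSpace ℝ E] [FiniteDimensional ℝ E]
  [CompleteSpace E] [NormedAddCommGroup Z] [NormedSpace ℝ Z] [FiniteDimensional ℝ Z]
  [NormedAddCommGroup Θ] [NormedSpace ℝ Θ] [CompleteSpace Θ]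
  {sys : ControlSystem E Z} (B : Perturbation sys Θ)

/-- The perturbation of the state and the controls at time `t`. -/
def dir (X : C(Icc (0 : ℝ) sys.T, E) × Θ) (t : ℝ) : E × Z :=
  (extend sys.T_nonneg X.1 t, B.ctrl t X.2)

theorem dir_add (X Y : C(Icc (0 : ℝ) sys.T, E) × Θ) (t : ℝ) :
    B.dir (X + Y) t = B.dir X t + B.dir Y t := by
  simp [dir, extend_add]

theorem dir_sub (X Y : C(Icc (0 : ℝ) sys.T, E) × Θ) (t : ℝ) :
    B.dir (X - Y) t = B.dir X t - B.dir Y t := by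
  simp [dir, extend_sub]

theorem dir_smul (c : ℝ) (X : C(Icc (0 : ℝ) sys.T, E) × Θ) (t : ℝ) :
    B.dir (c • X) t = c • B.dir X t := by
  simp [dir, extend_smul]

theorem exists_norm_dir_le : ∃ b > 0, ∀ᵐ t ∂(timeMeasure sys.T), ∀ X, ‖B.dir X t‖ ≤ b * ‖X‖ := by
  obtain ⟨M, _, hM⟩ := exists_ae_norm_le_of_memLp_top B.memLp_ctrl
  refine ⟨max 1 M, by positivity, ?_⟩
  filter_upwards [hM] with t ht X
  refine max_le ?_ ?_
  · refine (norm_extend_le sys.T_nonneg X.1 t).trans ((norm_fst_le X).trans ?_)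
    exact le_mul_of_one_le_left (norm_nonneg _) (le_max_left _ _)
  · refine ((B.ctrl t).le_opNorm _).trans ?_
    exact mul_le_mul (ht.trans (le_max_right _ _)) (norm_snd_le X) (norm_nonneg _) (by positivity)

theorem memLp_dir (X : C(Icc (0 : ℝ) sys.T, E) × Θ) : MemLp (B.dir X) ⊤ (timeMeasure sys.T) := by
  obtain ⟨b, _, hb⟩ := B.exists_norm_dir_le
  refine memLp_top_of_bound ?_ (b * ‖X‖) (hb.mono fun t ht => ht X)
  exact (continuous_extend sys.T_nonneg X.1).aestronglyMeasurable.prodMk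
    (memLp_apply (q := ⊤) B.memLp_ctrl (memLp_const X.2)).1

theorem integrableOn_top {G : Type*} [NormedAddCommGroup G] {T : ℝ} {f : ℝ → G}
    (hf : MemLp f ⊤ (timeMeasure T)) : IntegrableOn f (Icc 0 T) := hf.integrable le_top

theorem memLp_increment (X : C(Icc (0 : ℝ) sys.T, E) × Θ) :
    MemLp (fun t => sys.F (sys.ref t + B.dir X t) - sys.F (sys.ref t)) ⊤ (timeMeasure sys.T) :=
  (memLp_top_comp sys.contDiff_F.continuous (sys.memLp_ref.add (B.memLp_dir X))).sub
    (memLp_top_comp sys.contDiff_F.continuous sys.memLp_ref)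

/-- The defect of a perturbation in the integrated state equation. -/
def defect (X : C(Icc (0 : ℝ) sys.T, E) × Θ) : C(Icc (0 : ℝ) sys.T, E) :=
  X.1 - ContinuousMap.const _ (B.init X.2) -
    primitive sys.T (fun t => sys.F (sys.ref t + B.dir X t) - sys.F (sys.ref t))

theorem memLp_D_dir (X : C(Icc (0 : ℝ) sys.T, E) × Θ) :
    MemLp (fun t => sys.D t (B.dir X t)) ⊤ (timeMeasure sys.T) :=
  memLp_apply sys.memLp_D (B.memLp_dir X)

theorem memLp_S_dir (X Y : C(Icc (0 : ℝ) sys.T, E) × Θ) :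
    MemLp (fun t => sys.S t (B.dir X t) (B.dir Y t)) ⊤ (timeMeasure sys.T) :=
  memLp_apply (memLp_apply sys.memLp_S (B.memLp_dir X)) (B.memLp_dir Y)

theorem norm_primitive_le_of_ae_le {f : ℝ → E} (hf : IntegrableOn f (Icc 0 sys.T)) {C : ℝ}
    (h : ∀ᵐ t ∂(timeMeasure sys.T), ‖f t‖ ≤ C) : ‖primitive sys.T f‖ ≤ sys.T * C := by
  refine (norm_primitive_le sys.T_nonneg hf).trans ?_
  refine (integral_mono_ae hf.norm (integrable_const C) h).trans (le_of_eq ?_)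
  simp [Measure.real, sys.T_nonneg]

/-- The derivative of the defect. -/
def linDefect : C(Icc (0 : ℝ) sys.T, E) × Θ →L[ℝ] C(Icc (0 : ℝ) sys.T, E) :=
  ContinuousLinearMap.fst ℝ _ _ -
    ContinuousLinearMap.const ℝ (Icc (0 : ℝ) sys.T) ∘L B.init ∘L ContinuousLinearMap.snd ℝ _ _ -
    LinearMap.mkContinuousOfExistsBound
      { toFun := fun X => primitive sys.T (fun t => sys.D t (B.dir X t))
        map_add' := fun X Y => by
          rw [← primitive_add sys.T_nonneg (integrableOn_top (B.memLp_D_dir X))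
            (integrableOn_top (B.memLp_D_dir Y))]
          simp only [dir_add, map_add]
        map_smul' := fun c X => by
          rw [RingHom.id_apply, ← primitive_smul sys.T_nonneg (integrableOn_top (B.memLp_D_dir X))]
          simp only [dir_smul, map_smul] } (by
      obtain ⟨b, hb0, hb⟩ := B.exists_norm_dir_le
      obtain ⟨M, hM0, hM⟩ := exists_ae_norm_le_of_memLp_top sys.memLp_D
      refine ⟨sys.T * (M * b), fun X => ?_⟩
      rw [mul_assoc]
      refine norm_primitive_le_of_ae_le (integrableOn_top (B.memLp_D_dir X)) ?_
      filter_upwards [hb, hM] with t h1 h2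
      rw [mul_assoc]
      exact ((sys.D t).le_opNorm _).trans (mul_le_mul h2 (h1 X) (norm_nonneg _) hM0))

theorem linDefect_apply (X : C(Icc (0 : ℝ) sys.T, E) × Θ) :
    B.linDefect X = X.1 - ContinuousMap.const _ (B.init X.2) -
      primitive sys.T (fun t => sys.D t (B.dir X t)) := rfl

/-- The second derivative of the defect. -/
def quadDefect : C(Icc (0 : ℝ) sys.T, E) × Θ →L[ℝ] C(Icc (0 : ℝ) sys.T, E) × Θ →L[ℝ]
    C(Icc (0 : ℝ) sys.T, E) :=
  LinearMap.mkContinuousOfExistsBound₂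
    (LinearMap.mk₂ ℝ (fun X Y => -primitive sys.T (fun t => sys.S t (B.dir X t) (B.dir Y t)))
      (fun X Y W => by
        rw [← neg_add, ← primitive_add sys.T_nonneg (integrableOn_top (B.memLp_S_dir X W))
          (integrableOn_top (B.memLp_S_dir Y W))]
        simp only [dir_add, map_add, add_apply])
      (fun c X W => by
        rw [smul_neg, ← primitive_smul sys.T_nonneg (integrableOn_top (B.memLp_S_dir X W))]
        simp only [dir_smul, map_smul, smul_apply])
      (fun X Y W => by
        rw [← neg_add, ← primitive_add sys.T_nonneg (integrableOn_top (B.memLp_S_dir X Y))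
          (integrableOn_top (B.memLp_S_dir X W))]
        simp only [dir_add, map_add])
      (fun c X W => by
        rw [smul_neg, ← primitive_smul sys.T_nonneg (integrableOn_top (B.memLp_S_dir X W))]
        simp only [dir_smul, map_smul]))
    (by
      obtain ⟨b, hb0, hb⟩ := B.exists_norm_dir_le
      obtain ⟨M, hM0, hM⟩ := exists_ae_norm_le_of_memLp_top
        (G := E × Z →L[ℝ] E × Z →L[ℝ] E) sys.memLp_S
      refine ⟨sys.T * (M * b * b), fun X Y => ?_⟩
      rw [LinearMap.mk₂_apply, norm_neg, mul_assoc, mul_assoc]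
      refine norm_primitive_le_of_ae_le (integrableOn_top (B.memLp_S_dir X Y)) ?_
      filter_upwards [hb, hM] with t h1 h2
      refine ((sys.S t).le_opNorm₂ _ _).trans ?_
      calc ‖sys.S t‖ * ‖B.dir X t‖ * ‖B.dir Y t‖ ≤ M * (b * ‖X‖) * (b * ‖Y‖) := by
            gcongr
            · exact h1 X
            · exact h1 Y
        _ = M * b * b * (‖X‖ * ‖Y‖) := by ring)

theorem quadDefect_apply (X Y : C(Icc (0 : ℝ) sys.T, E) × Θ) :
    B.quadDefect X Y = -primitive sys.T (fun t => sys.S t (B.dir X t) (B.dir Y t)) := rfl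

theorem dir_zero (t : ℝ) : B.dir 0 t = 0 := by simpa using B.dir_smul 0 0 t

theorem defect_zero : B.defect 0 = 0 := by
  have : primitive sys.T (fun _ => (0 : E)) = 0 := by
    simpa using primitive_smul sys.T_nonneg (g := fun _ => (0 : E)) (integrable_zero _ _ _) 0
  simp only [defect, dir_zero, add_zero, sub_self, this, Prod.snd_zero, map_zero, sub_zero,
    Prod.fst_zero]
  ext; simp

/-- Both the state and the control variations are bounded by b‖X‖ for almost every t, so the uniform
strict estimate for F applies pointwise and is then integrated. Working with essentially bounded
controls is what allows this: with L² controls the perturbations would not be small at almost every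
time. -/
theorem hasStrictFDerivAt_defect : HasStrictFDerivAt B.defect B.linDefect 0 := by
  rw [hasStrictFDerivAt_iff_isLittleO, Asymptotics.isLittleO_iff]
  intro c hc
  obtain ⟨b, hb0, hb⟩ := B.exists_norm_dir_le
  obtain ⟨R, hR0, hR⟩ := exists_ae_norm_le_of_memLp_top sys.memLp_ref
  have hT := sys.T_pos
  -- The factor b is lost in passing from X to its values, the factor T in integrating.
  obtain ⟨δ, hδ, H⟩ := exists_uniform_strict_bound (sys.contDiff_F.of_le one_le_two) R
    (ε := c / (sys.T * b)) (by positivity)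
  have hn : Metric.ball (0 : (C(Icc (0 : ℝ) sys.T, E) × Θ) × (C(Icc (0 : ℝ) sys.T, E) × Θ)) (δ / b) ∈
    𝓝 ((0 : C(Icc (0 : ℝ) sys.T, E) × Θ), (0 : C(Icc (0 : ℝ) sys.T, E) × Θ)) :=
    Metric.ball_mem_nhds _ (by positivity)
  filter_upwards [hn] with XY hXY
  obtain ⟨X, Y⟩ := XY
  have hXY : max ‖X‖ ‖Y‖ < δ / b := by simpa [Prod.norm_def] using hXY
  rw [max_lt_iff, lt_div_iff₀' hb0, lt_div_iff₀' hb0] at hXY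
  have e : B.defect X - B.defect Y - B.linDefect (X - Y) =
      -primitive sys.T (fun t => (sys.F (sys.ref t + B.dir X t) - sys.F (sys.ref t)) -
        (sys.F (sys.ref t + B.dir Y t) - sys.F (sys.ref t)) - sys.D t (B.dir (X - Y) t)) := by
    rw [primitive_sub sys.T_nonneg
      (g := fun t => (sys.F (sys.ref t + B.dir X t) - sys.F (sys.ref t)) -
        (sys.F (sys.ref t + B.dir Y t) - sys.F (sys.ref t)))
      (integrableOn_top ((B.memLp_increment X).sub (B.memLp_increment Y)))
      (integrableOn_top (B.memLp_D_dir _)), primitive_sub sys.T_nonneg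
      (integrableOn_top (B.memLp_increment X)) (integrableOn_top (B.memLp_increment Y)),
      linDefect_apply, defect, defect]
    have : ContinuousMap.const (Icc (0 : ℝ) sys.T) (B.init (X - Y).2) =
      ContinuousMap.const _ (B.init X.2) - ContinuousMap.const _ (B.init Y.2) := by
      ext; simp
    rw [this, Prod.fst_sub]
    abel
  rw [e, norm_neg]
  have : c * ‖X - Y‖ = sys.T * (c / sys.T * ‖X - Y‖) := by field_simp
  rw [this]
  refine norm_primitive_le_of_ae_le (integrableOn_top
    (((B.memLp_increment X).sub (B.memLp_increment Y)).sub (B.memLp_D_dir _))) ?_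
  filter_upwards [hb, hR] with t h1 h2
  have := H (sys.ref t) (B.dir X t) (B.dir Y t) h2 ((h1 X).trans hXY.1.le)
    ((h1 Y).trans hXY.2.le)
  simp only [Pi.sub_apply]
  rw [sub_sub_sub_cancel_right, dir_sub]
  refine this.trans ?_
  rw [← dir_sub]
  calc c / (sys.T * b) * ‖B.dir (X - Y) t‖ ≤ c / (sys.T * b) * (b * ‖X - Y‖) := by
        gcongr; exact h1 _
    _ = c / sys.T * ‖X - Y‖ := by field_simp

theorem hasSecondOrderExpansion_defect :
    HasSecondOrderExpansion B.defect B.linDefect B.quadDefect := by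
  intro c hc
  obtain ⟨b, hb0, hb⟩ := B.exists_norm_dir_le
  obtain ⟨R, hR0, hR⟩ := exists_ae_norm_le_of_memLp_top sys.memLp_ref
  have hT := sys.T_pos
  obtain ⟨δ, hδ, H⟩ := exists_uniform_taylor_bound sys.contDiff_F R
    (ε := c / (sys.T * b ^ 2)) (by positivity)
  filter_upwards [Metric.ball_mem_nhds (0 : C(Icc (0 : ℝ) sys.T, E) × Θ)
    (show 0 < δ / b by positivity)] with X hX
  rw [mem_ball_zero_iff, lt_div_iff₀' hb0] at hX
  have hi := (B.memLp_increment X).sub (B.memLp_D_dir X)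
  have hS := (B.memLp_S_dir X X).const_smul (1 / 2 : ℝ)
  have e : B.defect X - B.defect 0 - B.linDefect X - (1 / 2 : ℝ) • B.quadDefect X X =
      -primitive sys.T (fun t => (sys.F (sys.ref t + B.dir X t) - sys.F (sys.ref t)) -
        sys.D t (B.dir X t) - (1 / 2 : ℝ) • sys.S t (B.dir X t) (B.dir X t)) := by
    rw [primitive_sub sys.T_nonneg
      (g := fun t => (sys.F (sys.ref t + B.dir X t) - sys.F (sys.ref t)) -
        sys.D t (B.dir X t)) (g' := fun t => (1 / 2 : ℝ) • sys.S t (B.dir X t) (B.dir X t))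
      (integrableOn_top hi) (integrableOn_top hS),
      primitive_sub sys.T_nonneg (integrableOn_top (B.memLp_increment X))
      (integrableOn_top (B.memLp_D_dir X)), primitive_smul sys.T_nonneg
      (integrableOn_top (B.memLp_S_dir X X)), linDefect_apply, defect_zero, quadDefect_apply, defect]
    module
  rw [e, norm_neg]
  have : c * ‖X‖ ^ 2 = sys.T * (c / sys.T * ‖X‖ ^ 2) := by field_simp
  rw [this]
  refine norm_primitive_le_of_ae_le (integrableOn_top (hi.sub hS)) ?_
  filter_upwards [hb, hR] with t h1 h2
  refine (H (sys.ref t) (B.dir X t) h2 ((h1 X).trans hX.le)).trans ?_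
  calc c / (sys.T * b ^ 2) * ‖B.dir X t‖ ^ 2 ≤ c / (sys.T * b ^ 2) * (b * ‖X‖) ^ 2 := by
        gcongr; exact h1 _
    _ = c / sys.T * ‖X‖ ^ 2 := by field_simp

/-- The endpoints of the perturbation of the state. -/
def ends : C(Icc (0 : ℝ) sys.T, E) × Θ →L[ℝ] E × E :=
  (B.init ∘L ContinuousLinearMap.snd ℝ _ _).prod
    (ContinuousMap.evalCLM ℝ ⟨sys.T, sys.T_nonneg, le_rfl⟩ ∘L ContinuousLinearMap.fst ℝ _ _)

theorem ends_apply (X : C(Icc (0 : ℝ) sys.T, E) × Θ) :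
    B.ends X = (B.init X.2, X.1 ⟨sys.T, sys.T_nonneg, le_rfl⟩) := rfl

theorem hasDerivativeAE_of_defect_eq_zero {X : C(Icc (0 : ℝ) sys.T, E) × Θ}
    (hX : B.defect X = 0) :
    HasDerivativeAE sys.T (fun t => sys.x t + extend sys.T_nonneg X.1 t)
      (fun t => sys.F (sys.x t + extend sys.T_nonneg X.1 t, sys.z t + B.ctrl t X.2)) ∧
    extend sys.T_nonneg X.1 0 = B.init X.2 := by
  rw [defect, sub_sub, sub_eq_zero] at hX
  obtain ⟨h1, h2⟩ := hasDerivativeAE_extend_primitive sys.T_nonneg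
    (integrableOn_top (B.memLp_increment X)) (B.init X.2) hX
  refine ⟨(sys.hasDerivativeAE_x.add h1).congr sys.T_nonneg (fun _ _ => rfl)
    (.of_forall fun t => ?_), h2⟩
  simp [ControlSystem.ref, dir]

/-- The resolvent equation itself: a source term in the linearized state equation is absorbed by the
state alone, with unperturbed controls and initial value. -/
theorem linDefect_resolvent (g : C(Icc (0 : ℝ) sys.T, E)) :
    B.linDefect (resolvent sys.T_nonneg sys.memLp_A g, 0) = g := by
  rw [linDefect_apply]
  have h1 : ContinuousMap.const (Icc (0 : ℝ) sys.T) (B.init 0) = 0 := by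
    ext; simp
  have h2 := resolvent_eq sys.T_nonneg sys.memLp_A g
  rw [h1, sub_zero, sub_eq_iff_eq_add]
  convert h2 using 4 with t
  simp [dir, ControlSystem.A]

/-- The resolvent first solves the state equation; the endpoint condition is then corrected inside
the kernel of the linearized defect. -/
theorem surjective_linDefect_prod {Y : Type*} [NormedAddCommGroup Y] [NormedSpace ℝ Y]
    (L : E × E →L[ℝ] Y)
    (h : ∀ y, ∃ X, B.linDefect X = 0 ∧ L (B.ends X) = y) :
    Function.Surjective (B.linDefect.prod (L ∘L B.ends)) := by
  rintro ⟨g, y⟩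
  let d := resolvent sys.T_nonneg sys.memLp_A g
  have hd : B.linDefect (d, 0) = g := B.linDefect_resolvent g
  obtain ⟨X, hX, hX'⟩ := h (y - L (B.ends (d, 0)))
  refine ⟨X + (d, 0), ?_⟩
  simp only [ContinuousLinearMap.prod_apply, map_add, hX, hd,
    ContinuousLinearMap.comp_apply, hX', Prod.mk_add_mk, zero_add, sub_add_cancel]

/-- Second order necessary condition along a finite-dimensional family of perturbations. -/
theorem exists_decrease {Y ι : Type*} [NormedAddCommGroup Y] [NormedSpace ℝ Y] [CompleteSpace Y]
    [Finite ι] {η : E × E → Y} (hη : ContDiff ℝ 2 η) {φ : ι → E × E → ℝ}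
    (hφ : ∀ i, ContDiff ℝ 2 (φ i))
    (hsurj : ∀ y, ∃ X, B.linDefect X = 0 ∧
      fderiv ℝ η (sys.x 0, sys.x sys.T) (B.ends X) = y)
    {X₁ X₂ : C(Icc (0 : ℝ) sys.T, E) × Θ} (h1 : B.linDefect X₁ = 0)
    (h2 : B.linDefect X₂ + (1 / 2 : ℝ) • B.quadDefect X₁ X₁ = 0)
    (h3 : fderiv ℝ η (sys.x 0, sys.x sys.T) (B.ends X₁) = 0)
    (h4 : fderiv ℝ η (sys.x 0, sys.x sys.T) (B.ends X₂) + (1 / 2 : ℝ) •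
      fderiv ℝ (fderiv ℝ η) (sys.x 0, sys.x sys.T) (B.ends X₁) (B.ends X₁) = 0)
    (h5 : ∀ i, fderiv ℝ (φ i) (sys.x 0, sys.x sys.T) (B.ends X₁) ≤ 0)
    (h6 : ∀ i, fderiv ℝ (φ i) (sys.x 0, sys.x sys.T) (B.ends X₂) + (1 / 2 : ℝ) *
      fderiv ℝ (fderiv ℝ (φ i)) (sys.x 0, sys.x sys.T) (B.ends X₁) (B.ends X₁) < 0)
    {ρ : ℝ} (hρ : 0 < ρ) :
    ∃ X, ‖X‖ < ρ ∧ B.defect X = 0 ∧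
      η ((sys.x 0, sys.x sys.T) + B.ends X) = η (sys.x 0, sys.x sys.T) ∧
      ∀ i, φ i ((sys.x 0, sys.x sys.T) + B.ends X) < φ i (sys.x 0, sys.x sys.T) := by
  set w := (sys.x 0, sys.x sys.T) with hw
  have hs : HasStrictFDerivAt (fun X => (B.defect X, η (w + B.ends X)))
      (B.linDefect.prod (fderiv ℝ η w ∘L B.ends)) 0 := by
    refine B.hasStrictFDerivAt_defect.prodMk ?_
    have := (hη.contDiffAt (x := w + B.ends 0)).hasStrictFDerivAt two_ne_zero
    have := this.comp (0 : C(Icc (0 : ℝ) sys.T, E) × Θ)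
      ((B.ends.hasStrictFDerivAt (x := 0)).const_add w)
    simpa using this
  let P : C(Icc (0 : ℝ) sys.T, E) × Θ →L[ℝ] C(Icc (0 : ℝ) sys.T, E) × Θ →L[ℝ]
      C(Icc (0 : ℝ) sys.T, E) × Y :=
    (ContinuousLinearMap.compL ℝ _ _ _ (ContinuousLinearMap.inl ℝ _ Y)) ∘L B.quadDefect +
    (ContinuousLinearMap.compL ℝ _ _ _ (ContinuousLinearMap.inr ℝ _ Y)) ∘L
      ((fderiv ℝ (fderiv ℝ η) w).bilinearComp B.ends B.ends)
  have hP : ∀ X, P X X = (B.quadDefect X X,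
      (fderiv ℝ (fderiv ℝ η) w).bilinearComp B.ends B.ends X X) := by
    intro X; simp [P]
  obtain ⟨X, hX1, hX2, hX3⟩ := exists_decrease_of_second_order hs
    (B.hasSecondOrderExpansion_defect.prodMk
      (hasSecondOrderExpansion_comp_affine hη w B.ends) hP)
    (B.surjective_linDefect_prod _ hsurj)
    (fun i => hasSecondOrderExpansion_comp_affine (hφ i) w B.ends)
    (x₁ := X₁) (x₂ := X₂) (by simp [h1, h3])
    (by
      rw [hP]
      simp only [ContinuousLinearMap.prod_apply, ContinuousLinearMap.comp_apply,
        ContinuousLinearMap.bilinearComp_apply, Prod.smul_mk, Prod.mk_add_mk, h2, h4]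
      rfl)
    (by simpa using h5) (by simpa using h6) hρ
  simp only [Prod.mk.injEq, map_zero, add_zero, B.defect_zero] at hX2 hX3
  exact ⟨X, hX1, hX2.1, hX2.2, hX3⟩

end Perturbation

/-! ### Separation and multipliers compatible with oscillations -/

section AbstractMultipliers

variable {X V : Type*} [NormedAddCommGroup X] [NormedSpace ℝ X]
  [NormedAddCommGroup V] [NormedSpace ℝ V]

/-- `r` is the limit of `b(z,z)` along a bounded weakly null sequence in `S`. -/
def IsOscillationLimit (S : Submodule ℝ X) (b : X →L[ℝ] X →L[ℝ] V) (r : V) : Prop :=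
  ∃ z : ℕ → X, (∀ k, z k ∈ S) ∧ (∃ C, ∀ k, ‖z k‖ ≤ C) ∧
    (∀ φ : X →L[ℝ] ℝ, Tendsto (fun k => φ (z k)) atTop (𝓝 0)) ∧
    Tendsto (fun k => b (z k) (z k)) atTop (𝓝 r)

/-- L(S) is a finite-dimensional subspace, hence closed, and it is dense in the range of L; so the
two coincide. A linear right inverse over this range takes its values in S. -/
theorem exists_correction [FiniteDimensional ℝ V] {S : Submodule ℝ X} (hS : Dense (S : Set X))
    (L : X →L[ℝ] V) : ∃ ρ : V →L[ℝ] X, (∀ v, ρ v ∈ S) ∧ ∀ x, L (ρ (L x)) = L x := by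
  let M : S →ₗ[ℝ] V := L.toLinearMap ∘ₗ S.subtype
  obtain ⟨g₀, hg₀⟩ := M.rangeRestrict.exists_rightInverse_of_surjective
    (LinearMap.range_rangeRestrict M)
  obtain ⟨g, hg⟩ := LinearMap.exists_extend g₀
  refine ⟨(S.subtype ∘ₗ g).toContinuousLinearMap, fun v => (g v).2, fun x => ?_⟩
  have hx : L x ∈ LinearMap.range M := by
    have hcl : IsClosed (LinearMap.range M : Set V) := Submodule.closed_of_finiteDimensional _
    have : L x ∈ closure (L '' S) :=
      image_closure_subset_closure_image L.continuous ⟨x, hS x, rfl⟩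
    refine hcl.closure_subset_iff.2 ?_ this
    rintro _ ⟨s, hs, rfl⟩
    exact ⟨⟨s, hs⟩, rfl⟩
  have h1 : g (L x) = g₀ ⟨L x, hx⟩ := by rw [← hg]; rfl
  have h2 := congrArg Subtype.val (LinearMap.congr_fun hg₀ ⟨L x, hx⟩)
  change L ((g (L x) : S) : X) = L x
  rw [h1]
  exact h2

/-- The approximants meet the constraint only in the limit. Subtracting a preimage in S of L(x_k) -
L(x₀) restores it exactly; the correction tends to zero in norm and, the x_k being bounded, does not
alter the limit of the quadratic values. -/
theorem mem_closure_of_approximation [FiniteDimensional ℝ V] {S : Submodule ℝ X}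
    (hS : Dense (S : Set X)) (L : X →L[ℝ] V) (b : X →L[ℝ] X →L[ℝ] V) {C : Set V} {x₀ : X}
    (hx₀ : L x₀ ∈ C) {x : ℕ → X} (hx : ∀ k, x k ∈ S) {R : ℝ} (hR : ∀ k, ‖x k‖ ≤ R)
    (hL : Tendsto (fun k => L (x k)) atTop (𝓝 (L x₀))) {γ : V}
    (hb : Tendsto (fun k => b (x k) (x k)) atTop (𝓝 γ)) :
    γ ∈ closure ((fun x => b x x) '' {x | x ∈ S ∧ L x ∈ C}) := by
  obtain ⟨ρ, hρS, hρ⟩ := exists_correction hS L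
  set y : ℕ → X := fun k => ρ (L (x k) - L x₀) with hy
  have hy0 : Tendsto y atTop (𝓝 0) := by
    have : Tendsto (fun k => L (x k) - L x₀) atTop (𝓝 0) := by
      simpa using hL.sub_const (L x₀)
    have := (ρ.continuous.tendsto 0).comp this
    rwa [map_zero] at this
  have hyn : Tendsto (fun k => ‖y k‖) atTop (𝓝 0) := by simpa using hy0.norm
  have hLy : ∀ k, L (x k - y k) = L x₀ := by
    intro k
    have := hρ (x k - x₀)
    rw [map_sub L] at this
    rw [map_sub, hy, this, sub_sub_cancel]
  refine mem_closure_of_tendsto (f := fun k => b (x k - y k) (x k - y k)) (b := atTop) ?_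
    (.of_forall fun k => ⟨x k - y k, ⟨S.sub_mem (hx k) (hρS _), by rw [hLy k]; exact hx₀⟩, rfl⟩)
  have h1 : Tendsto (fun k => b (x k) (y k)) atTop (𝓝 0) := by
    refine squeeze_zero_norm (a := fun k => ‖b‖ * R * ‖y k‖) (fun k => ?_) ?_
    · refine (b.le_opNorm₂ _ _).trans ?_
      gcongr
      exact hR k
    · simpa using hyn.const_mul (‖b‖ * R)
  have h2 : Tendsto (fun k => b (y k) (x k)) atTop (𝓝 0) := by
    refine squeeze_zero_norm (a := fun k => ‖b‖ * ‖y k‖ * R) (fun k => ?_) ?_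
    · refine (b.le_opNorm₂ _ _).trans ?_
      gcongr
      exact hR k
    · simpa using (hyn.const_mul ‖b‖).mul_const R
  have h3 : Tendsto (fun k => b (y k) (y k)) atTop (𝓝 0) := by
    have : Continuous fun y => b y y := by fun_prop
    have := (this.tendsto 0).comp hy0
    rwa [map_zero] at this
  have := ((hb.sub h1).sub h2).add h3
  simp only [sub_zero, add_zero] at this
  refine this.congr fun k => ?_
  simp only [map_sub, sub_apply]
  abel

variable {I J : Type*} [Fintype I] [Fintype J]

theorem nonneg_of_forall_pos_add_mul {a c : ℝ} (h : ∀ τ > 0, 0 < a + τ * c) : 0 ≤ a := by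
  have h1 : Tendsto (fun τ : ℝ => a + τ * c) (𝓝[>] 0) (𝓝 a) := by
    have : Continuous fun τ : ℝ => a + τ * c := by fun_prop
    have := this.tendsto 0
    rw [zero_mul, add_zero] at this
    exact this.mono_left nhdsWithin_le_nhds
  exact ge_of_tendsto h1 (by filter_upwards [self_mem_nhdsWithin] with τ hτ; exact (h τ hτ).le)

theorem nonneg_of_forall_nonneg_add_mul {a c : ℝ} (h : ∀ τ ≥ 0, 0 < a + τ * c) : 0 ≤ c := by
  refine nonneg_of_forall_pos_add_mul (a := c) (c := a) fun τ hτ => ?_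
  have := h τ⁻¹ (by positivity)
  have h2 := mul_pos hτ this
  rw [mul_add, ← mul_assoc, mul_inv_cancel₀ hτ.ne', one_mul] at h2
  linarith

/-- The cone of critical first order values: nonpositive inequalities, vanishing equalities. -/
def criticalValues (I J : Type*) : Set (I ⊕ J → ℝ) :=
  {v | (∀ j, v (Sum.inr j) = 0) ∧ ∀ i, v (Sum.inl i) ≤ 0}

/-- A small change of the equality values is followed by moving z along a linear right inverse with
values in S; the strict inequalities survive such a move. -/
theorem isOpen_strict_values {S : Submodule ℝ X} (L : X →L[ℝ] (I ⊕ J → ℝ))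
    (hsurj : ∀ y : J → ℝ, ∃ z ∈ S, ∀ j, L z (Sum.inr j) = y j) :
    IsOpen {o : I ⊕ J → ℝ | ∃ z ∈ S, (∀ j, L z (Sum.inr j) = o (Sum.inr j)) ∧
      ∀ i, L z (Sum.inl i) < o (Sum.inl i)} := by
  let M : S →ₗ[ℝ] (J → ℝ) :=
    LinearMap.funLeft ℝ ℝ Sum.inr ∘ₗ L.toLinearMap ∘ₗ S.subtype
  have hM : Function.Surjective M := fun y => by
    obtain ⟨z, hz, h⟩ := hsurj y
    exact ⟨⟨z, hz⟩, funext h⟩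
  obtain ⟨g, hg⟩ := M.exists_rightInverse_of_surjective (LinearMap.range_eq_top.2 hM)
  let σ : (J → ℝ) →L[ℝ] X := (S.subtype ∘ₗ g).toContinuousLinearMap
  have hσ : ∀ y j, L (σ y) (Sum.inr j) = y j := fun y j =>
    congrFun (LinearMap.congr_fun hg y) j
  rw [isOpen_iff_mem_nhds]
  rintro o ⟨z, hz, h1, h2⟩
  let Z : (I ⊕ J → ℝ) → X := fun o' => z + σ (fun j => o' (Sum.inr j) - o (Sum.inr j))
  have hZ : Continuous Z := by fun_prop
  have hZo : Z o = z := by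
    have : (fun j => o (Sum.inr j) - o (Sum.inr j)) = (0 : J → ℝ) := by ext; simp
    simp only [Z, this, map_zero, add_zero]
  have hev : ∀ᶠ o' in 𝓝 o, ∀ i, L (Z o') (Sum.inl i) < o' (Sum.inl i) := by
    refine eventually_all.2 fun i => ?_
    refine (isOpen_lt (f := fun o' => L (Z o') (Sum.inl i)) (by fun_prop)
      (continuous_apply _)).mem_nhds ?_
    rw [mem_ofPred, hZo]
    exact h2 i
  filter_upwards [hev] with o' ho'
  refine ⟨Z o', S.add_mem hz (g _).2, fun j => ?_, ho'⟩
  simp only [Z, map_add, Pi.add_apply, hσ, h1]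
  ring

/-- In the separating inequality r ranges over a cone, z over a subspace and s over an open orthant.
Each conclusion comes from blowing up one of them, or, for the last one, from letting s tend to
zero. -/
theorem multiplier_properties {S : Submodule ℝ X} (hS : Dense (S : Set X))
    (L : X →L[ℝ] (I ⊕ J → ℝ)) {R : Set (I ⊕ J → ℝ)} {e β : I ⊕ J → ℝ}
    (hR0 : (0 : I ⊕ J → ℝ) ∈ R) (hRsmul : ∀ τ : ℝ, 0 ≤ τ → ∀ r ∈ R, τ • r ∈ R)
    (key : ∀ r ∈ R, ∀ z ∈ S, ∀ s : I → ℝ, (∀ i, 0 < s i) →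
      0 < ∑ k, e k * β k + ∑ k, e k * r k + ∑ k, e k * L z k + ∑ i, e (Sum.inl i) * s i) :
    e ≠ 0 ∧ (∀ i, 0 ≤ e (Sum.inl i)) ∧ (∀ z, ∑ k, e k * L z k = 0) ∧
      (∀ r ∈ R, 0 ≤ ∑ k, e k * r k) ∧ 0 ≤ ∑ k, e k * β k := by
  classical
  have hLS : ∀ z ∈ S, ∑ k, e k * L z k = 0 := by
    have hge : ∀ z ∈ S, 0 ≤ ∑ k, e k * L z k := by
      intro z hz
      refine nonneg_of_forall_nonneg_add_mul
        (a := ∑ k, e k * β k + ∑ i, e (Sum.inl i)) fun τ _ => ?_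
      have := key 0 hR0 (τ • z) (S.smul_mem _ hz) (fun _ => 1) (fun _ => one_pos)
      have h2 : ∑ k, e k * L (τ • z) k = τ * ∑ k, e k * L z k := by
        rw [Finset.mul_sum]
        refine Finset.sum_congr rfl fun k _ => ?_
        simp only [map_smul, Pi.smul_apply, smul_eq_mul]; ring
      rw [h2] at this
      simp only [Pi.zero_apply, mul_zero, Finset.sum_const_zero, add_zero, mul_one] at this
      linarith
    intro z hz
    refine le_antisymm ?_ (hge z hz)
    have := hge (-z) (S.neg_mem hz)
    simp only [map_neg, Pi.neg_apply, mul_neg, Finset.sum_neg_distrib] at this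
    linarith
  refine ⟨?_, fun i => ?_, fun z => ?_, fun r hr => ?_, ?_⟩
  · rintro h0
    have := key 0 hR0 0 S.zero_mem (fun _ => 1) (fun _ => one_pos)
    simp [h0] at this
  · refine nonneg_of_forall_nonneg_add_mul
      (a := ∑ k, e k * β k + ∑ i, e (Sum.inl i)) fun τ hτ => ?_
    have := key 0 hR0 0 S.zero_mem (fun i' => 1 + τ * Pi.single (M := fun _ => ℝ) i 1 i')
      (fun i' => by
        have : 0 ≤ Pi.single (M := fun _ => ℝ) i (1 : ℝ) i' := by
          rw [Pi.single_apply]; split_ifs <;> norm_num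
        positivity)
    simp only [Pi.zero_apply, mul_zero, Finset.sum_const_zero, add_zero, map_zero, mul_add,
      mul_one, Finset.sum_add_distrib] at this
    have h2 : ∑ i', e (Sum.inl i') * (τ * Pi.single (M := fun _ => ℝ) i 1 i') =
        τ * e (Sum.inl i) := by
      rw [Finset.sum_eq_single i (fun j _ hj => by simp [hj]) (by simp)]
      simp; ring
    rw [h2] at this
    linarith
  · have h1 : Continuous fun z => ∑ k, e k * L z k := by fun_prop
    exact congrFun (h1.ext_on hS continuous_const hLS) z
  · refine nonneg_of_forall_nonneg_add_mul
      (a := ∑ k, e k * β k + ∑ i, e (Sum.inl i)) fun τ hτ => ?_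
    have := key (τ • r) (hRsmul τ hτ r hr) 0 S.zero_mem (fun _ => 1) (fun _ => one_pos)
    have h2 : ∑ k, e k * (τ • r) k = τ * ∑ k, e k * r k := by
      rw [Finset.mul_sum]
      refine Finset.sum_congr rfl fun k _ => ?_
      simp only [Pi.smul_apply, smul_eq_mul]; ring
    rw [h2] at this
    simp only [Pi.zero_apply, mul_zero, Finset.sum_const_zero, add_zero, mul_one, map_zero] at this
    linarith
  · refine nonneg_of_forall_pos_add_mul (c := ∑ i, e (Sum.inl i)) fun τ hτ => ?_
    have := key 0 hR0 0 S.zero_mem (fun _ => τ) (fun _ => hτ)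
    simp only [Pi.zero_apply, mul_zero, Finset.sum_const_zero, add_zero, map_zero,
      ← Finset.sum_mul] at this
    linarith

/-- The set of values b(x,x) need not be convex, so the separated set is built at one fixed x: the
value there, plus a convex cone of translations that preserve the closure of all critical values.
Oscillation limits belong to this cone, which is why the same e is nonnegative on them. Density of S
admits every critical x, although `hnec` concerns elements of S only. -/
theorem exists_multiplier {S : Submodule ℝ X} (hS : Dense (S : Set X))
    (L : X →L[ℝ] (I ⊕ J → ℝ)) (b : X →L[ℝ] X →L[ℝ] (I ⊕ J → ℝ))
    (hsurj : ∀ y : J → ℝ, ∃ z ∈ S, ∀ j, L z (Sum.inr j) = y j)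
    (hnec : ∀ x ∈ S, L x ∈ criticalValues I J → ∀ z ∈ S,
      ¬ ((∀ j, L z (Sum.inr j) = - b x x (Sum.inr j)) ∧
        ∀ i, L z (Sum.inl i) < - b x x (Sum.inl i)))
    {x : X} (hx : L x ∈ criticalValues I J) :
    ∃ e : I ⊕ J → ℝ, e ≠ 0 ∧ (∀ i, 0 ≤ e (Sum.inl i)) ∧ (∀ z, ∑ k, e k * L z k = 0) ∧
      (∀ r, IsOscillationLimit S b r → 0 ≤ ∑ k, e k * r k) ∧ 0 ≤ ∑ k, e k * b x x k := by
  classical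
  set C := criticalValues I J with hC
  set Γ := closure ((fun x => b x x) '' {x | x ∈ S ∧ L x ∈ C}) with hΓ
  have hxΓ : b x x ∈ Γ := by
    obtain ⟨y, hyS, hy⟩ := mem_closure_iff_seq_limit.1 (hS x)
    obtain ⟨R, hR⟩ := (Metric.isBounded_range_of_tendsto y hy).exists_norm_le
    refine mem_closure_of_approximation hS L b hx hyS (fun k => hR _ ⟨k, rfl⟩)
      ((L.continuous.tendsto x).comp hy) ?_
    have : Continuous fun x => b x x := by fun_prop
    exact (this.tendsto x).comp hy
  -- Add the weakly null sequence to a critical y: the first order values still converge to those of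
  -- y, and the cross terms of b vanish in the limit.
  have hosc : ∀ r, IsOscillationLimit S b r → ∀ γ ∈ Γ, γ + r ∈ Γ := by
    rintro r ⟨z, hzS, ⟨R, hR⟩, hz, hzr⟩ γ hγ
    rw [hΓ, ← closure_closure]
    refine map_mem_closure (f := fun γ => γ + r) (by fun_prop) hγ ?_
    rintro _ ⟨y, ⟨hyS, hyC⟩, rfl⟩
    refine mem_closure_of_approximation hS L b hyC (x := fun k => y + z k)
      (fun k => S.add_mem hyS (hzS k)) (R := ‖y‖ + R)
      (fun k => (norm_add_le _ _).trans (by gcongr; exact hR k)) ?_ ?_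
    · have : Tendsto (fun k => L (z k)) atTop (𝓝 0) :=
        tendsto_pi_nhds.2 fun i => hz (ContinuousLinearMap.proj (R := ℝ) (φ := fun _ : I ⊕ J => ℝ) i ∘L L)
      simpa using this.const_add (L y)
    · have h1 : Tendsto (fun k => b y (z k)) atTop (𝓝 0) :=
        tendsto_pi_nhds.2 fun i => hz (ContinuousLinearMap.proj (R := ℝ) (φ := fun _ : I ⊕ J => ℝ) i ∘L b y)
      have h2 : Tendsto (fun k => b (z k) y) atTop (𝓝 0) :=
        tendsto_pi_nhds.2 fun i => hz (ContinuousLinearMap.proj (R := ℝ) (φ := fun _ : I ⊕ J => ℝ) i ∘L b.flip y)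
      have := ((h1.add h2).add hzr).const_add (b y y)
      rw [add_zero, zero_add] at this
      refine this.congr fun k => ?_
      simp only [map_add, add_apply]
      abel
  have hscale : ∀ τ : ℝ, 0 ≤ τ → ∀ γ ∈ Γ, τ • γ ∈ Γ := by
    intro τ hτ γ hγ
    refine map_mem_closure (f := fun γ => τ • γ) (by fun_prop) hγ ?_
    rintro _ ⟨y, ⟨hyS, hyC⟩, rfl⟩
    -- Quadratic values scale by the square, so the square root realizes the factor τ.
    refine ⟨√τ • y, ⟨S.smul_mem _ hyS, ?_, ?_⟩, ?_⟩
    · intro j; simp [hyC.1 j]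
    · intro i
      have := mul_nonpos_of_nonneg_of_nonpos (Real.sqrt_nonneg τ) (hyC.2 i)
      simpa using this
    · simp only [map_smul, smul_apply, smul_smul, Real.mul_self_sqrt hτ]
  -- Translations preserving Γ compose, and Γ is stable under nonnegative scaling; hence R is a
  -- convex cone even when Γ is not convex.
  set R : Set (I ⊕ J → ℝ) := {r | ∀ γ ∈ Γ, γ + r ∈ Γ} with hR
  have hR0 : (0 : I ⊕ J → ℝ) ∈ R := fun γ hγ => by rwa [add_zero]
  have hRadd : ∀ r ∈ R, ∀ r' ∈ R, r + r' ∈ R := fun r hr r' hr' γ hγ => by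
    rw [← add_assoc]; exact hr' _ (hr _ hγ)
  have hRsmul : ∀ τ : ℝ, 0 ≤ τ → ∀ r ∈ R, τ • r ∈ R := by
    intro τ hτ r hr
    rcases hτ.eq_or_lt with rfl | hτ'
    · simpa using hR0
    · intro γ hγ
      have := hscale τ hτ _ (hr _ (hscale τ⁻¹ (by positivity) γ hγ))
      rwa [smul_add, smul_smul, mul_inv_cancel₀ hτ'.ne', one_smul] at this
  set O : Set (I ⊕ J → ℝ) := {o | ∃ z ∈ S, (∀ j, L z (Sum.inr j) = o (Sum.inr j)) ∧
    ∀ i, L z (Sum.inl i) < o (Sum.inl i)} with hO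
  have hOopen : IsOpen O := isOpen_strict_values L hsurj
  set D : Set (I ⊕ J → ℝ) := {d | ∃ r ∈ R, d - b x x - r ∈ O} with hD
  have hDopen : IsOpen D := by
    have : D = ⋃ r ∈ R, (fun d => d - b x x - r) ⁻¹' O := by ext; simp [hD]
    rw [this]
    exact isOpen_biUnion fun r _ => hOopen.preimage (by fun_prop)
  have hDconv : Convex ℝ D := by
    rintro d ⟨r, hr, z, hz, h1, h2⟩ d' ⟨r', hr', z', hz', h1', h2'⟩ τ τ' hτ hτ' hττ
    refine ⟨τ • r + τ' • r', hRadd _ (hRsmul τ hτ r hr) _ (hRsmul τ' hτ' r' hr'),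
      τ • z + τ' • z', S.add_mem (S.smul_mem _ hz) (S.smul_mem _ hz'), fun j => ?_, fun i => ?_⟩
    · have a1 := h1 j
      have a2 := h1' j
      simp only [Pi.sub_apply, map_add, map_smul, Pi.add_apply, Pi.smul_apply, smul_eq_mul] at *
      rw [a1, a2]
      linear_combination (- b x x (Sum.inr j)) * hττ
    · have a1 := h2 i
      have a2 := h2' i
      simp only [Pi.sub_apply, map_add, map_smul, Pi.add_apply, Pi.smul_apply, smul_eq_mul] at *
      have e : τ * d (Sum.inl i) + τ' * d' (Sum.inl i) - b x x (Sum.inl i) -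
          (τ * r (Sum.inl i) + τ' * r' (Sum.inl i)) =
          τ * (d (Sum.inl i) - b x x (Sum.inl i) - r (Sum.inl i)) +
          τ' * (d' (Sum.inl i) - b x x (Sum.inl i) - r' (Sum.inl i)) := by
        linear_combination (b x x (Sum.inl i)) * hττ
      rw [e]
      rcases hτ.eq_or_lt with h0 | h0
      · rw [← h0] at hττ ⊢
        have : τ' = 1 := by linarith
        rw [this]; linarith
      · exact add_lt_add_of_lt_of_le (mul_lt_mul_of_pos_left a1 h0)
          (mul_le_mul_of_nonneg_left a2.le hτ')
  -- If 0 were in D, the point b(x,x) + r of Γ would have its opposite in the open set O. By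
  -- openness the same would hold for an actual value b(y,y) with y critical in S, against `hnec`.
  have hD0 : (0 : I ⊕ J → ℝ) ∉ D := by
    rintro ⟨r, hr, hz⟩
    have hγ := hr _ hxΓ
    have hop : IsOpen ((fun γ => -γ) ⁻¹' O) := hOopen.preimage continuous_neg
    obtain ⟨_, hγO, ⟨y, ⟨hyS, hyC⟩, rfl⟩⟩ := mem_closure_iff.1 hγ _ hop (by
      have : -(b x x + r) = 0 - b x x - r := by abel
      rwa [mem_preimage, this])
    obtain ⟨z, hz, h1, h2⟩ := hγO
    exact hnec y hyS hyC z hz ⟨h1, h2⟩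
  obtain ⟨f, hf⟩ := geometric_hahn_banach_open_point hDconv hDopen hD0
  set e : I ⊕ J → ℝ := fun k => - f (Pi.single k 1) with he
  have hfe : ∀ d, f d = - ∑ k, e k * d k := by
    intro d
    conv_lhs => rw [pi_eq_sum_univ' d, map_sum]
    rw [← Finset.sum_neg_distrib]
    refine Finset.sum_congr rfl fun k _ => ?_
    rw [map_smul, smul_eq_mul, he]
    ring
  have hpos : ∀ d ∈ D, 0 < ∑ k, e k * d k := by
    intro d hd
    have := hf d hd
    rw [map_zero, hfe] at this
    linarith
  have key : ∀ r ∈ R, ∀ z ∈ S, ∀ s : I → ℝ, (∀ i, 0 < s i) →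
      0 < ∑ k, e k * b x x k + ∑ k, e k * r k + ∑ k, e k * L z k + ∑ i, e (Sum.inl i) * s i := by
    intro r hr z hz s hs
    have := hpos (b x x + r + L z + Sum.elim s 0) ⟨r, hr, z, hz, fun j => by
      simp only [Pi.add_apply, Pi.sub_apply, Sum.elim_inr, Pi.zero_apply]; ring, fun i => by
      simp only [Pi.add_apply, Pi.sub_apply, Sum.elim_inl]; linarith [hs i]⟩
    simp only [Pi.add_apply, mul_add, Finset.sum_add_distrib] at this
    rw [Fintype.sum_sum_type (fun k => e k * Sum.elim s 0 k)] at this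
    simpa only [Sum.elim_inl, Sum.elim_inr, Pi.zero_apply, mul_zero, Finset.sum_const_zero,
      add_zero] using this
  exact ⟨e, multiplier_properties hS L hR0 hRsmul key |>.imp id fun h =>
    ⟨h.1, h.2.1, fun r hr => h.2.2.1 r (hosc r hr), h.2.2.2⟩⟩

end AbstractMultipliers

theorem fderiv_fderiv_clm_comp {W Y Y' : Type*} [NormedAddCommGroup W] [NormedSpace ℝ W]
    [NormedAddCommGroup Y] [NormedSpace ℝ Y] [NormedAddCommGroup Y'] [NormedSpace ℝ Y']
    (Φ : Y →L[ℝ] Y') {f : W → Y} (hf : ContDiff ℝ 2 f) (w a : W) :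
    fderiv ℝ (fun w => Φ (f w)) w = Φ ∘L fderiv ℝ f w ∧
    fderiv ℝ (fderiv ℝ (fun w => Φ (f w))) w a = Φ ∘L fderiv ℝ (fderiv ℝ f) w a := by
  have h1 : fderiv ℝ (fun w => Φ (f w)) = fun w => Φ ∘L fderiv ℝ f w := by
    ext1 w
    exact (Φ.hasFDerivAt.comp w (hf.differentiable two_ne_zero w).hasFDerivAt).fderiv
  refine ⟨congrFun h1 w, ?_⟩
  rw [h1]
  have h2 := ((hf.fderiv_right (m := 1) (by norm_num)).differentiable one_ne_zero w).hasFDerivAt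
  have h3 := ((ContinuousLinearMap.compL ℝ W Y Y' Φ).hasFDerivAt.comp w h2).fderiv
  have h4 : (fun w => Φ ∘L fderiv ℝ f w) =
    (ContinuousLinearMap.compL ℝ W Y Y' Φ) ∘ fderiv ℝ f := rfl
  rw [h4, h3]
  rfl

/-! ### Bounded operators and quadratic forms on L² -/

section LpTools

variable {E W : Type*} [NormedAddCommGroup E] [NormedSpace ℝ E] [CompleteSpace E]
  [NormedAddCommGroup W] [NormedSpace ℝ W] {T : ℝ}

/-- The primitive of an `L¹` function as a bounded operator. -/
def primitiveL (hT : 0 ≤ T) : Lp E 1 (timeMeasure T) →L[ℝ] C(Icc (0 : ℝ) T, E) :=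
  LinearMap.mkContinuous
    { toFun := fun f => primitive T f
      map_add' := fun f g => by
        rw [← primitive_add hT (L1.integrable_coeFn f) (L1.integrable_coeFn g)]
        exact primitive_congr hT (L1.integrable_coeFn _) (Lp.coeFn_add f g)
      map_smul' := fun c f => by
        rw [RingHom.id_apply, ← primitive_smul hT (L1.integrable_coeFn f)]
        exact primitive_congr hT (L1.integrable_coeFn _) (Lp.coeFn_smul c f) }
    1 (fun f => by
      rw [one_mul, L1.norm_eq_integral_norm]
      exact norm_primitive_le hT (L1.integrable_coeFn f))

/-- The embedding of `C([0,T])` into `L²(0,T)`. -/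
def extendL (hT : 0 ≤ T) : C(Icc (0 : ℝ) T, E) →L[ℝ] Lp E 2 (timeMeasure T) :=
  LinearMap.mkContinuous
    { toFun := fun x => (memLp_extend hT x 2).toLp _
      map_add' := fun x y => by
        rw [← MemLp.toLp_add]; rfl
      map_smul' := fun c x => by
        rw [RingHom.id_apply, ← MemLp.toLp_const_smul]; rfl }
    ((timeMeasure T).real univ ^ ((2 : ENNReal).toReal⁻¹)) (fun x => by
      refine Lp.norm_le_of_ae_bound (norm_nonneg x) ?_
      filter_upwards [(memLp_extend hT x 2).coeFn_toLp] with t ht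
      simp only [LinearMap.coe_mk, AddHom.coe_mk]
      rw [ht]
      exact norm_extend_le hT x t)

theorem coeFn_extendL (hT : 0 ≤ T) (x : C(Icc (0 : ℝ) T, E)) :
    extendL hT x =ᵐ[timeMeasure T] extend hT x := (memLp_extend hT x 2).coeFn_toLp

/-- The operator `z ↦ (t ↦ B(t) z(t))` from `L²` to `L¹`. -/
def applyL {B : ℝ → W →L[ℝ] E} (hB : MemLp B ⊤ (timeMeasure T)) :
    Lp W 2 (timeMeasure T) →L[ℝ] Lp E 1 (timeMeasure T) :=
  (ContinuousLinearMap.id ℝ (W →L[ℝ] E)).holderL (timeMeasure T) 2 2 1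
    ((hB.mono_exponent le_top).toLp B)

theorem coeFn_applyL {B : ℝ → W →L[ℝ] E} (hB : MemLp B ⊤ (timeMeasure T))
    (z : Lp W 2 (timeMeasure T)) : applyL hB z =ᵐ[timeMeasure T] fun t => B t (z t) := by
  have h1 := (ContinuousLinearMap.id ℝ (W →L[ℝ] E)).coeFn_holder (r := 1)
    (((hB.mono_exponent le_top).toLp B : Lp (W →L[ℝ] E) 2 (timeMeasure T))) z
  filter_upwards [h1, (hB.mono_exponent (p := 2) le_top).coeFn_toLp] with t h1 h2
  rw [applyL, ContinuousLinearMap.holderL_apply_apply, h1, h2]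
  rfl

/-- The quadratic form `(g,h) ↦ ∫ N(t)(g(t),h(t)) dt` on `L²`. -/
def integralForm {N : ℝ → W →L[ℝ] W →L[ℝ] ℝ} (hN : MemLp N ⊤ (timeMeasure T)) :
    Lp W 2 (timeMeasure T) →L[ℝ] Lp W 2 (timeMeasure T) →L[ℝ] ℝ :=
  (ContinuousLinearMap.id ℝ (W →L[ℝ] ℝ)).lpPairing (timeMeasure T) 2 2 ∘L
    (ContinuousLinearMap.id ℝ (W →L[ℝ] W →L[ℝ] ℝ)).holderL (timeMeasure T) ⊤ 2 2 (hN.toLp N)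

theorem integralForm_apply {N : ℝ → W →L[ℝ] W →L[ℝ] ℝ} (hN : MemLp N ⊤ (timeMeasure T))
    (g h : Lp W 2 (timeMeasure T)) :
    integralForm hN g h = ∫ t, N t (g t) (h t) ∂(timeMeasure T) := by
  rw [integralForm, ContinuousLinearMap.comp_apply, ContinuousLinearMap.lpPairing_eq_integral]
  have h1 := ContinuousLinearMap.coeFn_holder (𝕜 := ℝ) (E := W →L[ℝ] W →L[ℝ] ℝ) (F := W)
    (G := W →L[ℝ] ℝ) (r := 2) (ContinuousLinearMap.id ℝ (W →L[ℝ] W →L[ℝ] ℝ)) (hN.toLp N) g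
  refine integral_congr_ae ?_
  filter_upwards [h1, MemLp.coeFn_toLp (E := W →L[ℝ] W →L[ℝ] ℝ) hN] with t h1 h2
  rw [ContinuousLinearMap.holderL_apply_apply, h1, h2]
  rfl

end LpTools

/-! ### Linearized solutions and the second variation on L² directions -/

namespace ControlSystem

variable {E Z : Type*} [NormedAddCommGroup E] [NormedSpace ℝ E] [FiniteDimensional ℝ E]
  [CompleteSpace E] [NormedAddCommGroup Z] [NormedSpace ℝ Z] [FiniteDimensional ℝ Z]
  [CompleteSpace Z] (sys : ControlSystem E Z)

/-- Directions: variations of the initial state and of the controls. -/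
abbrev Direction : Type _ := E × Lp Z 2 (timeMeasure sys.T)

/-- The partial derivative of the dynamics with respect to the controls. -/
def Dz (t : ℝ) : Z →L[ℝ] E := sys.D t ∘L ContinuousLinearMap.inr ℝ E Z

theorem memLp_Dz : MemLp sys.Dz ⊤ (timeMeasure sys.T) :=
  memLp_top_comp (f := fun w => fderiv ℝ sys.F w ∘L ContinuousLinearMap.inr ℝ E Z)
    ((sys.contDiff_F.continuous_fderiv two_ne_zero).clm_comp continuous_const) sys.memLp_ref

theorem D_apply (t : ℝ) (a : E) (c : Z) : sys.D t (a, c) = sys.A t a + sys.Dz t c := by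
  rw [A, Dz, ContinuousLinearMap.comp_apply, ContinuousLinearMap.comp_apply, ← map_add]
  simp

/-- The solution operator of the linearized state equation. -/
def solL : sys.Direction →L[ℝ] C(Icc (0 : ℝ) sys.T, E) :=
  resolvent sys.T_nonneg sys.memLp_A ∘L
    (ContinuousLinearMap.const ℝ (Icc (0 : ℝ) sys.T) ∘L ContinuousLinearMap.fst ℝ _ _ +
      primitiveL sys.T_nonneg ∘L applyL sys.memLp_Dz ∘L ContinuousLinearMap.snd ℝ _ _)

theorem integrableOn_Dz {z : ℝ → Z} (hz : IntegrableOn z (Icc 0 sys.T)) :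
    IntegrableOn (fun t => sys.Dz t (z t)) (Icc 0 sys.T) := integrableOn_apply sys.memLp_Dz hz

theorem integrableOn_coeFn {G : Type*} [NormedAddCommGroup G] {T : ℝ}
    (z : Lp G 2 (timeMeasure T)) : IntegrableOn z (Icc 0 T) :=
  (Lp.memLp z).integrable one_le_two

theorem integrableOn_D_extend (x : C(Icc (0 : ℝ) sys.T, E)) {z : ℝ → Z}
    (hz : IntegrableOn z (Icc 0 sys.T)) :
    IntegrableOn (fun t => sys.D t (extend sys.T_nonneg x t, z t)) (Icc 0 sys.T) := by
  simp only [D_apply]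
  exact (integrableOn_apply_extend sys.T_nonneg sys.memLp_A x).add (sys.integrableOn_Dz hz)

theorem primitive_D_extend (x : C(Icc (0 : ℝ) sys.T, E)) {z : ℝ → Z}
    (hz : IntegrableOn z (Icc 0 sys.T)) :
    primitive sys.T (fun t => sys.D t (extend sys.T_nonneg x t, z t)) =
      primitive sys.T (fun t => sys.A t (extend sys.T_nonneg x t)) +
      primitive sys.T (fun t => sys.Dz t (z t)) := by
  rw [← primitive_add sys.T_nonneg (integrableOn_apply_extend sys.T_nonneg sys.memLp_A x)
    (sys.integrableOn_Dz hz)]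
  simp only [D_apply]

theorem solL_eq_resolvent (X : sys.Direction) :
    sys.solL X = resolvent sys.T_nonneg sys.memLp_A
      (ContinuousMap.const _ X.1 + primitive sys.T (fun t => sys.Dz t (X.2 t))) := by
  rw [← primitive_congr sys.T_nonneg (L1.integrable_coeFn _) (coeFn_applyL sys.memLp_Dz X.2)]
  rfl

theorem solL_spec (X : sys.Direction) :
    sys.solL X = ContinuousMap.const _ X.1 +
      primitive sys.T (fun t => sys.D t (extend sys.T_nonneg (sys.solL X) t, X.2 t)) := by
  have h := resolvent_eq sys.T_nonneg sys.memLp_A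
    (ContinuousMap.const _ X.1 + primitive sys.T (fun t => sys.Dz t (X.2 t)))
  rw [← solL_eq_resolvent] at h
  rw [sys.primitive_D_extend _ (integrableOn_coeFn X.2)]
  conv_lhs => rw [h]
  abel

/-- The pair formed by the linearized state and the controls. -/
def jet : sys.Direction →L[ℝ] Lp (E × Z) 2 (timeMeasure sys.T) :=
  (ContinuousLinearMap.inl ℝ E Z).compLpL 2 (timeMeasure sys.T) ∘L extendL sys.T_nonneg ∘L
    sys.solL +
  (ContinuousLinearMap.inr ℝ E Z).compLpL 2 (timeMeasure sys.T) ∘L ContinuousLinearMap.snd ℝ _ _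

theorem coeFn_jet (X : sys.Direction) : sys.jet X =ᵐ[timeMeasure sys.T]
    fun t => (extend sys.T_nonneg (sys.solL X) t, X.2 t) := by
  have h1 := Lp.coeFn_add ((ContinuousLinearMap.inl ℝ E Z).compLpL 2 (timeMeasure sys.T)
    (extendL sys.T_nonneg (sys.solL X))) ((ContinuousLinearMap.inr ℝ E Z).compLpL 2
      (timeMeasure sys.T) X.2)
  filter_upwards [h1, (ContinuousLinearMap.inl ℝ E Z).coeFn_compLpL (p := 2)
    (extendL sys.T_nonneg (sys.solL X)), (ContinuousLinearMap.inr ℝ E Z).coeFn_compLpL (p := 2) X.2,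
    coeFn_extendL sys.T_nonneg (sys.solL X)] with t h1 h2 h3 h4
  change ((ContinuousLinearMap.inl ℝ E Z).compLpL 2 (timeMeasure sys.T)
    (extendL sys.T_nonneg (sys.solL X)) + (ContinuousLinearMap.inr ℝ E Z).compLpL 2
      (timeMeasure sys.T) X.2 : Lp (E × Z) 2 (timeMeasure sys.T)) t = _
  rw [h1, Pi.add_apply, h2, h3, h4]
  simp

/-- The endpoints of the linearized state. -/
def endsL : sys.Direction →L[ℝ] E × E :=
  (ContinuousLinearMap.fst ℝ _ _).prod
    (ContinuousMap.evalCLM ℝ ⟨sys.T, sys.T_nonneg, le_rfl⟩ ∘L sys.solL)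

theorem endsL_apply (X : sys.Direction) :
    sys.endsL X = (X.1, sys.solL X ⟨sys.T, sys.T_nonneg, le_rfl⟩) := rfl

/-- The endpoints of the reference trajectory. -/
def refEnds : E × E := (sys.x 0, sys.x sys.T)

/-- The directions with essentially bounded controls. -/
def boundedDirections : Submodule ℝ sys.Direction where
  carrier := {X | MemLp X.2 ⊤ (timeMeasure sys.T)}
  add_mem' := fun {X Y} hX hY => (hX.add hY).ae_eq (Lp.coeFn_add X.2 Y.2).symm
  zero_mem' := (MemLp.zero (ε := Z)).ae_eq (Lp.coeFn_zero Z 2 (timeMeasure sys.T)).symm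
  smul_mem' := fun c X hX => (hX.const_smul c).ae_eq (Lp.coeFn_smul c X.2).symm

theorem dense_boundedDirections : Dense (sys.boundedDirections : Set sys.Direction) := by
  have h : Dense {z : Lp Z 2 (timeMeasure sys.T) | MemLp z ⊤ (timeMeasure sys.T)} := by
    refine (Lp.simpleFunc.denseRange (E := Z) (μ := timeMeasure sys.T) (p := 2)
      ENNReal.ofNat_ne_top).mono ?_
    rintro _ ⟨f, rfl⟩
    exact ((Lp.simpleFunc.toSimpleFunc f).memLp_top _).ae_eq
      (Lp.simpleFunc.toSimpleFunc_eq_toFun f)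
  have := (dense_univ (X := E)).prod h
  refine this.mono fun X hX => hX.2

/-- The costate equation for a given final value. -/
def IsCostate (p : ℝ → E →L[ℝ] ℝ) : Prop :=
  HasDerivativeAE sys.T p (fun t => -(p t ∘L sys.A t))

theorem IsCostate.memLp {sys : ControlSystem E Z} {p : ℝ → E →L[ℝ] ℝ} (hp : sys.IsCostate p) :
    MemLp p ⊤ (timeMeasure sys.T) := by
  have hc := HasDerivativeAE.continuousOn hp sys.T_nonneg
  obtain ⟨C, hC⟩ := (isCompact_Icc (a := (0 : ℝ)) (b := sys.T)).exists_bound_of_continuousOn hc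
  exact memLp_top_of_bound (hc.aestronglyMeasurable measurableSet_Icc) C
    ((ae_restrict_mem measurableSet_Icc).mono hC)

theorem IsCostate.integral_eq {sys : ControlSystem E Z} {p : ℝ → E →L[ℝ] ℝ} (hp : sys.IsCostate p)
    {x g : ℝ → E} (hx : HasDerivativeAE sys.T x (fun t => sys.A t (x t) + g t)) :
    p sys.T (x sys.T) - p 0 (x 0) = ∫ t in (0 : ℝ)..sys.T, p t (g t) := by
  rw [← HasDerivativeAE.integral_apply hp hx sys.T_nonneg]
  refine intervalIntegral.integral_congr fun t _ => ?_
  simp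

/-- The second derivative of the Hamiltonian along the reference trajectory. -/
def hess (p : ℝ → E →L[ℝ] ℝ) (t : ℝ) : E × Z →L[ℝ] E × Z →L[ℝ] ℝ :=
  ContinuousLinearMap.compL ℝ (E × Z) E ℝ (p t) ∘L sys.S t

theorem hess_apply (p : ℝ → E →L[ℝ] ℝ) (t : ℝ) (a b : E × Z) :
    sys.hess p t a b = p t (sys.S t a b) := rfl

theorem memLp_hess {p : ℝ → E →L[ℝ] ℝ} (hp : MemLp p ⊤ (timeMeasure sys.T)) :
    MemLp (sys.hess p) ⊤ (timeMeasure sys.T) := by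
  obtain ⟨M, hM0, hM⟩ := exists_ae_norm_le_of_memLp_top hp
  obtain ⟨M', hM0', hM'⟩ := exists_ae_norm_le_of_memLp_top
    (G := E × Z →L[ℝ] E × Z →L[ℝ] E) sys.memLp_S
  have hm : AEStronglyMeasurable (sys.hess p) (timeMeasure sys.T) := by
    have h1 : Continuous fun q : (E →L[ℝ] ℝ) × (E × Z →L[ℝ] E × Z →L[ℝ] E) =>
        ContinuousLinearMap.compL ℝ (E × Z) E ℝ q.1 ∘L q.2 := by fun_prop
    exact h1.comp_aestronglyMeasurable (hp.1.prodMk sys.memLp_S.1)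
  refine memLp_top_of_bound (E := E × Z →L[ℝ] E × Z →L[ℝ] ℝ) hm (M * M') ?_
  filter_upwards [hM, hM'] with t h1 h2
  refine ContinuousLinearMap.opNorm_le_bound₂ _ (by positivity) fun a b => ?_
  rw [hess_apply]
  refine ((p t).le_opNorm _).trans ?_
  calc ‖p t‖ * ‖sys.S t a b‖ ≤ M * (M' * ‖a‖ * ‖b‖) := by
        gcongr
        refine ((sys.S t).le_opNorm₂ a b).trans ?_
        gcongr
    _ = M * M' * ‖a‖ * ‖b‖ := by ring

/-- The second variation associated with an endpoint function `g` and a costate `p`. -/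
def secondVariation (g : E × E → ℝ) {p : ℝ → E →L[ℝ] ℝ}
    (hp : MemLp p ⊤ (timeMeasure sys.T)) : sys.Direction →L[ℝ] sys.Direction →L[ℝ] ℝ :=
  (1 / 2 : ℝ) • ((fderiv ℝ (fderiv ℝ g) sys.refEnds).bilinearComp sys.endsL sys.endsL +
    (integralForm (sys.memLp_hess hp)).bilinearComp sys.jet sys.jet)

theorem secondVariation_apply (g : E × E → ℝ) {p : ℝ → E →L[ℝ] ℝ}
    (hp : MemLp p ⊤ (timeMeasure sys.T)) (X : sys.Direction) :
    sys.secondVariation g hp X X = (1 / 2 : ℝ) *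
      (fderiv ℝ (fderiv ℝ g) sys.refEnds (sys.endsL X) (sys.endsL X) +
        ∫ t, p t (sys.S t (extend sys.T_nonneg (sys.solL X) t, X.2 t)
          (extend sys.T_nonneg (sys.solL X) t, X.2 t)) ∂(timeMeasure sys.T)) := by
  rw [secondVariation, smul_apply, smul_apply, add_apply, add_apply, smul_eq_mul,
    ContinuousLinearMap.bilinearComp_apply, ContinuousLinearMap.bilinearComp_apply,
    integralForm_apply]
  congr 2
  refine integral_congr_ae ?_
  filter_upwards [sys.coeFn_jet X] with t ht
  rw [ht, hess_apply]

end ControlSystem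

/-! ### Oscillating controls -/

theorem tendsto_integral_mul_cos {T : ℝ} {f : ℝ → ℝ} (hf : IntegrableOn f (Icc 0 T)) :
    Tendsto (fun k : ℕ => ∫ t, f t * Real.cos (k * t) ∂(timeMeasure T)) atTop (𝓝 0) := by
  let f' : ℝ → ℂ := fun t => ((Icc 0 T).indicator f t : ℝ)
  -- Riemann–Lebesgue lemma; the integral against cos(kt) is the real part of the Fourier integral
  -- at frequency k/(2π).
  have h0 := Real.tendsto_integral_exp_smul_cocompact f'
  have hw : Tendsto (fun k : ℕ => (k : ℝ) / (2 * Real.pi)) atTop (cocompact ℝ) := by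
    refine Tendsto.mono_right ?_ atTop_le_cocompact
    exact tendsto_natCast_atTop_atTop.atTop_div_const (by positivity)
  have h1 := (Complex.continuous_re.tendsto 0).comp (h0.comp hw)
  rw [Complex.zero_re] at h1
  refine h1.congr fun k => ?_
  simp only [Function.comp]
  have hf' : Integrable f' := ((integrable_indicator_iff measurableSet_Icc).2 hf).ofReal
  have hint : Integrable fun v : ℝ => Real.fourierChar (-(v * (k / (2 * Real.pi)))) • f' v := by
    have := (Real.fourierIntegral_convergent_iff (μ := volume) (f := f')
      ((k : ℝ) / (2 * Real.pi))).2 hf'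
    refine this.congr (.of_forall fun v => ?_)
    simp [mul_comm]
  have h2 := Complex.reCLM.integral_comp_comm hint
  simp only [Complex.reCLM_apply] at h2
  rw [← h2, ← integral_indicator measurableSet_Icc]
  refine integral_congr_ae (.of_forall fun t => ?_)
  simp only [f', Circle.smul_def, Real.fourierChar_apply, smul_eq_mul, Complex.re_mul_ofReal]
  by_cases ht : t ∈ Icc 0 T
  · rw [indicator_of_mem ht, indicator_of_mem ht, mul_comm]
    congr 1
    rw [Complex.exp_ofReal_mul_I_re, ← Real.cos_neg]
    congr 1
    field_simp
  · rw [indicator_of_notMem ht, indicator_of_notMem ht, mul_zero]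

theorem tendsto_clm_of_weakly_null {X G : Type*} [NormedAddCommGroup X] [NormedSpace ℝ X]
    [NormedAddCommGroup G] [NormedSpace ℝ G] [FiniteDimensional ℝ G] {z : ℕ → X}
    (hz : ∀ φ : X →L[ℝ] ℝ, Tendsto (fun k => φ (z k)) atTop (𝓝 0)) (L : X →L[ℝ] G) :
    Tendsto (fun k => L (z k)) atTop (𝓝 0) := by
  let b := Module.finBasis ℝ G
  have h : ∀ k, L (z k) = ∑ i, ((b.coord i).toContinuousLinearMap ∘L L) (z k) • b i := fun k => by
    conv_lhs => rw [← b.sum_repr (L (z k))]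
    rfl
  simp_rw [h]
  have := tendsto_finsetSum Finset.univ fun i _ =>
    (hz ((b.coord i).toContinuousLinearMap ∘L L)).smul_const (b i)
  simpa using this

theorem aestronglyMeasurable_apply₂ {W : Type*} [NormedAddCommGroup W] [NormedSpace ℝ W]
    {T : ℝ} {N : ℝ → W →L[ℝ] W →L[ℝ] ℝ} {u v : ℝ → W}
    (hN : AEStronglyMeasurable N (timeMeasure T)) (hu : AEStronglyMeasurable u (timeMeasure T))
    (hv : AEStronglyMeasurable v (timeMeasure T)) :
    AEStronglyMeasurable (fun t => N t (u t) (v t)) (timeMeasure T) := by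
  have h1 : Continuous fun q : (W →L[ℝ] W →L[ℝ] ℝ) × W × W => q.1 q.2.1 q.2.2 := by fun_prop
  exact h1.comp_aestronglyMeasurable (hN.prodMk (hu.prodMk hv))

/-- The scalar oscillation `√2 cos(kt)` restricted to the set `B`. -/
def oscillation (B : Set ℝ) (k : ℕ) : ℝ → ℝ :=
  B.indicator fun t => √2 * Real.cos (k * t)

theorem abs_oscillation_le (B : Set ℝ) (k : ℕ) (t : ℝ) : |oscillation B k t| ≤ √2 := by
  by_cases ht : t ∈ B
  · rw [oscillation, indicator_of_mem ht, abs_mul, abs_of_nonneg (Real.sqrt_nonneg 2)]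
    exact mul_le_of_le_one_right (Real.sqrt_nonneg 2) (Real.abs_cos_le_one _)
  · rw [oscillation, indicator_of_notMem ht, abs_zero]; positivity

theorem memLp_oscillation {B : Set ℝ} (hB : MeasurableSet B) (k : ℕ) (T : ℝ) (q : ENNReal) :
    MemLp (oscillation B k) q (timeMeasure T) :=
  MemLp.of_bound ((Measurable.indicator (by fun_prop) hB).aestronglyMeasurable) (√2)
    (.of_forall fun t => abs_oscillation_le B k t)

theorem tendsto_integral_mul_oscillation {T : ℝ} {B : Set ℝ} (hB : MeasurableSet B) {f : ℝ → ℝ}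
    (hf : IntegrableOn f (Icc 0 T)) :
    Tendsto (fun k => ∫ t, f t * oscillation B k t ∂(timeMeasure T)) atTop (𝓝 0) := by
  have hf' : IntegrableOn (B.indicator f) (Icc 0 T) := hf.indicator hB
  have := (tendsto_integral_mul_cos hf').const_mul (√2)
  rw [mul_zero] at this
  refine this.congr fun k => ?_
  rw [← integral_const_mul]
  refine integral_congr_ae (.of_forall fun t => ?_)
  by_cases ht : t ∈ B
  · simp only [oscillation, indicator_of_mem ht]; ring
  · simp [oscillation, indicator_of_notMem ht]

/-- Since 2cos² = 1 + cos of the double angle, the factor √2 gives the squared oscillation mean one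
on B, and the double frequency part vanishes by Riemann–Lebesgue. -/
theorem tendsto_integral_mul_oscillation_sq {T : ℝ} {B : Set ℝ} (hB : MeasurableSet B)
    {f : ℝ → ℝ} (hf : IntegrableOn f (Icc 0 T)) :
    Tendsto (fun k => ∫ t, f t * oscillation B k t ^ 2 ∂(timeMeasure T)) atTop
      (𝓝 (∫ t, B.indicator f t ∂(timeMeasure T))) := by
  have hf' : IntegrableOn (B.indicator f) (Icc 0 T) := hf.indicator hB
  have h2 : Tendsto (fun k : ℕ => 2 * k) atTop atTop :=
    tendsto_id.const_mul_atTop' (by norm_num)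
  have := ((tendsto_integral_mul_cos hf').comp h2).const_add
    (∫ t, B.indicator f t ∂(timeMeasure T))
  rw [add_zero] at this
  refine this.congr fun k => ?_
  simp only [Function.comp]
  rw [← integral_add hf']
  · refine integral_congr_ae (.of_forall fun t => ?_)
    by_cases ht : t ∈ B
    · simp only [oscillation, indicator_of_mem ht, mul_pow]
      rw [Real.sq_sqrt zero_le_two]
      push_cast
      rw [mul_assoc 2 (k : ℝ) t, Real.cos_two_mul]
      ring
    · simp [oscillation, indicator_of_notMem ht]
  · refine hf'.mul_bdd (c := 1) (by fun_prop) (.of_forall fun t => ?_)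
    exact Real.abs_cos_le_one _

namespace ControlSystem

variable {E Z : Type*} [NormedAddCommGroup E] [NormedSpace ℝ E] [FiniteDimensional ℝ E]
  [CompleteSpace E] [NormedAddCommGroup Z] [NormedSpace ℝ Z] [FiniteDimensional ℝ Z]
  [CompleteSpace Z] (sys : ControlSystem E Z)

/-- The scalar oscillation as an element of `L²`. -/
def oscillationL {B : Set ℝ} (hB : MeasurableSet B) (k : ℕ) : Lp ℝ 2 (timeMeasure sys.T) :=
  (memLp_oscillation hB k sys.T 2).toLp _

/-- The oscillating control in the fixed direction `c`. -/
def oscillationDir {B : Set ℝ} (hB : MeasurableSet B) (c : Z) (k : ℕ) : sys.Direction :=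
  (0, (ContinuousLinearMap.toSpanSingleton ℝ c).compLpL 2 (timeMeasure sys.T)
    (sys.oscillationL hB k))

theorem coeFn_oscillationDir {B : Set ℝ} (hB : MeasurableSet B) (c : Z) (k : ℕ) :
    (sys.oscillationDir hB c k).2 =ᵐ[timeMeasure sys.T] fun t => oscillation B k t • c := by
  filter_upwards [(ContinuousLinearMap.toSpanSingleton ℝ c).coeFn_compLpL (p := 2)
    (sys.oscillationL hB k), (memLp_oscillation hB k sys.T 2).coeFn_toLp] with t h1 h2
  rw [oscillationDir, h1, oscillationL, h2]
  simp

theorem oscillationDir_mem {B : Set ℝ} (hB : MeasurableSet B) (c : Z) (k : ℕ) :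
    sys.oscillationDir hB c k ∈ sys.boundedDirections := by
  have : MemLp (fun t => oscillation B k t • c) ⊤ (timeMeasure sys.T) :=
    memLp_clm_comp (ContinuousLinearMap.toSpanSingleton ℝ c) (memLp_oscillation hB k sys.T ⊤)
  exact this.ae_eq (sys.coeFn_oscillationDir hB c k).symm

theorem exists_norm_oscillationDir_le {B : Set ℝ} (hB : MeasurableSet B) (c : Z) :
    ∃ C, ∀ k, ‖sys.oscillationDir hB c k‖ ≤ C := by
  refine ⟨(timeMeasure sys.T).real univ ^ ((2 : ENNReal).toReal⁻¹) * (√2 * ‖c‖), fun k => ?_⟩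
  refine max_le (by simp only [oscillationDir, norm_zero]; positivity) ?_
  refine Lp.norm_le_of_ae_bound (by positivity) ?_
  filter_upwards [sys.coeFn_oscillationDir hB c k] with t ht
  rw [ht, norm_smul]
  gcongr
  exact abs_oscillation_le B k t

/-- By the Riesz representation a functional of the scalar oscillation is an integral against a
fixed L² function. -/
theorem tendsto_oscillationDir {B : Set ℝ} (hB : MeasurableSet B) (c : Z)
    (φ : sys.Direction →L[ℝ] ℝ) :
    Tendsto (fun k => φ (sys.oscillationDir hB c k)) atTop (𝓝 0) := by
  let ψ : Lp ℝ 2 (timeMeasure sys.T) →L[ℝ] ℝ := φ ∘L ContinuousLinearMap.inr ℝ E _ ∘L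
    (ContinuousLinearMap.toSpanSingleton ℝ c).compLpL 2 (timeMeasure sys.T)
  obtain ⟨f, hf⟩ : ∃ f : Lp ℝ 2 (timeMeasure sys.T), ∀ e, ψ e = inner ℝ f e :=
    ⟨(InnerProductSpace.toDual ℝ _).symm ψ, fun e => by simp⟩
  have h := tendsto_integral_mul_oscillation hB (integrableOn_coeFn f)
  refine h.congr fun k => ?_
  change _ = ψ (sys.oscillationL hB k)
  rw [hf, L2.inner_def]
  refine integral_congr_ae ?_
  filter_upwards [(memLp_oscillation hB k sys.T 2).coeFn_toLp] with t ht
  rw [oscillationL, ht]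
  simp [mul_comm]

theorem extend_solL_oscillationDir_tendsto {B : Set ℝ} (hB : MeasurableSet B) (c : Z) (t : ℝ) :
    Tendsto (fun k => extend sys.T_nonneg (sys.solL (sys.oscillationDir hB c k)) t) atTop
      (𝓝 0) :=
  tendsto_clm_of_weakly_null (sys.tendsto_oscillationDir hB c)
    (ContinuousMap.evalCLM ℝ (projIcc 0 sys.T sys.T_nonneg t) ∘L sys.solL)

/-- The linearized states are uniformly bounded and converge to zero at each time, since point
evaluations are continuous functionals of the direction. All terms that contain the state disappear,
and the square of the oscillation averages to the indicator of B. -/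
theorem tendsto_secondVariation_oscillationDir (g : E × E → ℝ) {p : ℝ → E →L[ℝ] ℝ}
    (hp : MemLp p ⊤ (timeMeasure sys.T)) {B : Set ℝ} (hB : MeasurableSet B) (c : Z) :
    Tendsto (fun k => sys.secondVariation g hp (sys.oscillationDir hB c k)
      (sys.oscillationDir hB c k)) atTop
      (𝓝 ((1 / 2 : ℝ) * ∫ t, B.indicator (fun t => p t (sys.S t (0, c) (0, c))) t
        ∂(timeMeasure sys.T))) := by
  obtain ⟨C, hC⟩ := sys.exists_norm_oscillationDir_le hB c
  obtain ⟨M, hM0, hM⟩ := exists_ae_norm_le_of_memLp_top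
    (G := E × Z →L[ℝ] E × Z →L[ℝ] ℝ) (sys.memLp_hess hp)
  set x : ℕ → ℝ → E := fun k => extend sys.T_nonneg (sys.solL (sys.oscillationDir hB c k)) with hx
  set R := ‖sys.solL‖ * C with hR
  have hxR : ∀ k t, ‖x k t‖ ≤ R := fun k t =>
    (norm_extend_le _ _ _).trans ((sys.solL.le_opNorm _).trans
      (mul_le_mul_of_nonneg_left (hC k) (norm_nonneg _)))
  have hxm : ∀ k, Continuous (x k) := fun k => continuous_extend _ _
  have hR0 : 0 ≤ R := (norm_nonneg _).trans (hxR 0 0)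
  have hends : Tendsto (fun k => fderiv ℝ (fderiv ℝ g) sys.refEnds
      (sys.endsL (sys.oscillationDir hB c k)) (sys.endsL (sys.oscillationDir hB c k))) atTop
      (𝓝 0) := by
    have h1 := tendsto_clm_of_weakly_null (sys.tendsto_oscillationDir hB c) sys.endsL
    have h2 : Continuous fun e => fderiv ℝ (fderiv ℝ g) sys.refEnds e e := by fun_prop
    have := (h2.tendsto 0).comp h1
    rwa [map_zero] at this
  -- The part of the integrand that contains the state: it is dominated by a constant and tends to
  -- zero pointwise.
  set r : ℕ → ℝ → ℝ := fun k t => sys.hess p t (x k t, 0) (x k t, 0) +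
    oscillation B k t * (sys.hess p t (x k t, 0) (0, c) + sys.hess p t (0, c) (x k t, 0)) with hr
  have hHm : AEStronglyMeasurable (sys.hess p) (timeMeasure sys.T) := (sys.memLp_hess hp).1
  have hap : ∀ {u v : ℝ → E × Z}, AEStronglyMeasurable u (timeMeasure sys.T) →
      AEStronglyMeasurable v (timeMeasure sys.T) →
      AEStronglyMeasurable (fun t => sys.hess p t (u t) (v t)) (timeMeasure sys.T) := by
    exact fun hu hv => aestronglyMeasurable_apply₂ hHm hu hv
  have hx0 : ∀ k, AEStronglyMeasurable (fun t => (x k t, (0 : Z))) (timeMeasure sys.T) :=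
    fun k => ((hxm k).prodMk continuous_const).aestronglyMeasurable
  have hc0 : AEStronglyMeasurable (fun _ : ℝ => ((0 : E), c)) (timeMeasure sys.T) :=
    aestronglyMeasurable_const
  have hrm : ∀ k, AEStronglyMeasurable (r k) (timeMeasure sys.T) := fun k =>
    (hap (hx0 k) (hx0 k)).add ((memLp_oscillation hB k sys.T ⊤).1.mul
      ((hap (hx0 k) hc0).add (hap hc0 (hx0 k))))
  have hxn : ∀ k t, ‖((x k t, 0) : E × Z)‖ ≤ R := fun k t => by
    rw [Prod.norm_mk, norm_zero]; exact max_le (hxR k t) hR0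
  have hcn : ‖((0, c) : E × Z)‖ = ‖c‖ := by rw [Prod.norm_mk, norm_zero]; simp
  have hrb : ∀ k, ∀ᵐ t ∂(timeMeasure sys.T), ‖r k t‖ ≤ M * R * R +
      √2 * (M * R * ‖c‖ + M * ‖c‖ * R) := by
    intro k
    filter_upwards [hM] with t ht
    have hb : ∀ u v : E × Z, ‖sys.hess p t u v‖ ≤ M * ‖u‖ * ‖v‖ := fun u v =>
      ((sys.hess p t).le_opNorm₂ u v).trans (by gcongr)
    refine (norm_add_le _ _).trans (add_le_add ?_ ?_)
    · refine (hb _ _).trans ?_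
      gcongr <;> exact hxn k t
    · rw [norm_mul]
      refine mul_le_mul (abs_oscillation_le B k t) ((norm_add_le _ _).trans (add_le_add ?_ ?_))
        (norm_nonneg _) (Real.sqrt_nonneg 2)
      · refine (hb _ _).trans ?_
        rw [hcn]; gcongr; exact hxn k t
      · refine (hb _ _).trans ?_
        rw [hcn]; gcongr; exact hxn k t
  have hr0 : ∀ t, Tendsto (fun k => r k t) atTop (𝓝 0) := by
    intro t
    have h1 : Tendsto (fun k => ((x k t, 0) : E × Z)) atTop (𝓝 0) :=
      (sys.extend_solL_oscillationDir_tendsto hB c t).prodMk_nhds tendsto_const_nhds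
    have h2 : Tendsto (fun k => sys.hess p t (x k t, 0) (x k t, 0)) atTop (𝓝 0) := by
      have hc : Continuous fun u => sys.hess p t u u := by fun_prop
      have := (hc.tendsto 0).comp h1
      rwa [map_zero] at this
    have h3 : Tendsto (fun k => sys.hess p t (x k t, 0) (0, c) +
        sys.hess p t (0, c) (x k t, 0)) atTop (𝓝 0) := by
      have hc : Continuous fun u => sys.hess p t u (0, c) + sys.hess p t (0, c) u := by fun_prop
      have := (hc.tendsto 0).comp h1
      rwa [map_zero, map_zero, zero_apply, add_zero] at this
    have h4 : Tendsto (fun k => oscillation B k t * (sys.hess p t (x k t, 0) (0, c) +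
        sys.hess p t (0, c) (x k t, 0))) atTop (𝓝 0) := by
      refine squeeze_zero_norm (a := fun k => √2 * ‖sys.hess p t (x k t, 0) (0, c) +
        sys.hess p t (0, c) (x k t, 0)‖) (fun k => ?_) (by simpa using h3.norm.const_mul √2)
      rw [norm_mul]
      gcongr
      exact abs_oscillation_le B k t
    simpa using h2.add h4
  have hrlim : Tendsto (fun k => ∫ t, r k t ∂(timeMeasure sys.T)) atTop (𝓝 0) := by
    have := tendsto_integral_of_dominated_convergence (f := fun _ => (0 : ℝ))
      (fun _ => M * R * R + √2 * (M * R * ‖c‖ + M * ‖c‖ * R)) hrm (integrable_const _) hrb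
      (.of_forall hr0)
    simpa using this
  have haI : IntegrableOn (fun t => sys.hess p t (0, c) (0, c)) (Icc 0 sys.T) := by
    refine Integrable.of_bound (C := M * ‖c‖ * ‖c‖) (hap hc0 hc0) ?_
    filter_upwards [hM] with t ht
    refine ((sys.hess p t).le_opNorm₂ _ _).trans ?_
    rw [hcn]; gcongr
  have hmain := (hends.add (hrlim.add (tendsto_integral_mul_oscillation_sq hB haI))).const_mul
    (1 / 2 : ℝ)
  rw [zero_add, zero_add] at hmain
  refine hmain.congr fun k => ?_
  rw [secondVariation_apply]
  congr 2
  rw [← integral_add (Integrable.of_bound (hrm k) _ (hrb k))]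
  · refine integral_congr_ae ?_
    filter_upwards [sys.coeFn_oscillationDir hB c k] with t ht
    rw [ht]
    have : ((extend sys.T_nonneg (sys.solL (sys.oscillationDir hB c k)) t,
        oscillation B k t • c) : E × Z) = (x k t, 0) + oscillation B k t • ((0 : E), c) := by
      simp [hx]
    rw [this, ← hess_apply]
    simp only [map_add, map_smul, add_apply, smul_apply, smul_eq_mul, hr]
    ring
  · refine Integrable.mul_bdd (c := √2 ^ 2) haI ((memLp_oscillation hB k sys.T ⊤).1.pow 2)
      (.of_forall fun t => ?_)
    rw [norm_pow]
    gcongr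
    exact abs_oscillation_le B k t

end ControlSystem

theorem memLp_sum_smulRight {κ Θ Z : Type*} [Fintype κ] [NormedAddCommGroup Θ] [NormedSpace ℝ Θ]
    [NormedAddCommGroup Z] [NormedSpace ℝ Z] [FiniteDimensional ℝ Z] {T : ℝ} (l : κ → Θ →L[ℝ] ℝ) {z : κ → ℝ → Z}
    (hz : ∀ k, MemLp (z k) ⊤ (timeMeasure T)) :
    MemLp (fun t => ∑ k, (l k).smulRight (z k t)) ⊤ (timeMeasure T) := by
  have hc : Continuous fun q : κ → Z => ∑ k, (l k).smulRight (q k) :=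
    continuous_finsetSum _ fun k _ =>
      (ContinuousLinearMap.smulRightL ℝ Θ Z (l k)).continuous.comp (continuous_apply k)
  exact memLp_top_comp hc (.of_eval hz)

/-! ### From nearby trajectories to multipliers -/

namespace ControlSystem

variable {E Z : Type*} [NormedAddCommGroup E] [NormedSpace ℝ E] [FiniteDimensional ℝ E]
  [CompleteSpace E] [NormedAddCommGroup Z] [NormedSpace ℝ Z] [FiniteDimensional ℝ Z]
  [CompleteSpace Z] (sys : ControlSystem E Z)

/-- The perturbation spanned by finitely many directions with bounded controls. -/
def spanPerturbation {κ : Type*} [Fintype κ] (fam : κ → sys.Direction)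
    (h : ∀ k, fam k ∈ sys.boundedDirections) : Perturbation sys (κ → ℝ) where
  init := ∑ k, (ContinuousLinearMap.proj k : (κ → ℝ) →L[ℝ] ℝ).smulRight (fam k).1
  ctrl := fun t => ∑ k, (ContinuousLinearMap.proj k : (κ → ℝ) →L[ℝ] ℝ).smulRight ((fam k).2 t)
  memLp_ctrl := memLp_sum_smulRight _ h

section Span

variable {κ : Type*} [Fintype κ] [DecidableEq κ] (fam : κ → sys.Direction)
    (h : ∀ k, fam k ∈ sys.boundedDirections)

theorem spanPerturbation_init (k : κ) :
    (sys.spanPerturbation fam h).init (Pi.single k 1) = (fam k).1 := by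
  simp [spanPerturbation, Pi.single_apply]

theorem spanPerturbation_ctrl (k : κ) (t : ℝ) :
    (sys.spanPerturbation fam h).ctrl t (Pi.single k 1) = (fam k).2 t := by
  simp [spanPerturbation, Pi.single_apply]

theorem spanPerturbation_dir (k : κ) (t : ℝ) :
    (sys.spanPerturbation fam h).dir (sys.solL (fam k), Pi.single k 1) t =
      (extend sys.T_nonneg (sys.solL (fam k)) t, (fam k).2 t) := by
  rw [Perturbation.dir, spanPerturbation_ctrl]

theorem spanPerturbation_ends (k : κ) :
    (sys.spanPerturbation fam h).ends (sys.solL (fam k), Pi.single k 1) = sys.endsL (fam k) := by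
  rw [Perturbation.ends_apply, spanPerturbation_init, endsL_apply]

theorem spanPerturbation_linDefect (k : κ) :
    (sys.spanPerturbation fam h).linDefect (sys.solL (fam k), Pi.single k 1) = 0 := by
  rw [Perturbation.linDefect_apply, spanPerturbation_init, sub_sub, sub_eq_zero]
  simp only [spanPerturbation_dir]
  exact sys.solL_spec (fam k)

end Span

/-- A solution of the costate equation with final value the derivative of `g` with respect to the
final state. -/
def costate (g : E × E → ℝ) : ℝ → E →L[ℝ] ℝ :=
  (exists_costate sys.T_nonneg sys.memLp_A
    (fderiv ℝ g sys.refEnds ∘L ContinuousLinearMap.inr ℝ E E)).choose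

theorem isCostate_costate (g : E × E → ℝ) : sys.IsCostate (sys.costate g) :=
  (exists_costate sys.T_nonneg sys.memLp_A
    (fderiv ℝ g sys.refEnds ∘L ContinuousLinearMap.inr ℝ E E)).choose_spec.2.2

theorem costate_final (g : E × E → ℝ) :
    sys.costate g sys.T = fderiv ℝ g sys.refEnds ∘L ContinuousLinearMap.inr ℝ E E :=
  (exists_costate sys.T_nonneg sys.memLp_A
    (fderiv ℝ g sys.refEnds ∘L ContinuousLinearMap.inr ℝ E E)).choose_spec.2.1

theorem memLp_costate (g : E × E → ℝ) : MemLp (sys.costate g) ⊤ (timeMeasure sys.T) :=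
  (sys.isCostate_costate g).memLp

theorem hasDerivativeAE_resolvent {f : ℝ → E} (hf : IntegrableOn f (Icc 0 sys.T)) :
    HasDerivativeAE sys.T
      (extend sys.T_nonneg (resolvent sys.T_nonneg sys.memLp_A (primitive sys.T f)))
      (fun t => sys.A t (extend sys.T_nonneg
        (resolvent sys.T_nonneg sys.memLp_A (primitive sys.T f)) t) + f t) ∧
    extend sys.T_nonneg (resolvent sys.T_nonneg sys.memLp_A (primitive sys.T f)) 0 = 0 := by
  have h := resolvent_eq sys.T_nonneg sys.memLp_A (primitive sys.T f)
  set ξ := resolvent sys.T_nonneg sys.memLp_A (primitive sys.T f)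
  have hi := integrableOn_apply_extend sys.T_nonneg sys.memLp_A ξ
  refine hasDerivativeAE_extend_primitive sys.T_nonneg (hi.add hf) 0 ?_
  rw [add_comm, ← primitive_add sys.T_nonneg hi hf] at h
  have h0 : ContinuousMap.const (Icc (0 : ℝ) sys.T) (0 : E) = 0 := by ext; simp
  rw [h0, zero_add]
  exact h

/-- No nearby trajectory satisfies the equality constraints and decreases strictly all the other
endpoint functions. -/
def NoDecrease {I J : Type*} (g : I ⊕ J → E × E → ℝ) : Prop :=
  ∃ ρ > 0, ∀ (x : ℝ → E) (z : ℝ → Z), HasDerivativeAE sys.T x (fun t => sys.F (x t, z t)) →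
    MemLp z ⊤ (timeMeasure sys.T) → (∀ t ∈ Icc 0 sys.T, ‖x t - sys.x t‖ ≤ ρ) →
    (∀ᵐ t ∂(timeMeasure sys.T), ‖z t - sys.z t‖ ≤ ρ) →
    (∀ j, g (Sum.inr j) (x 0, x sys.T) = g (Sum.inr j) sys.refEnds) →
    ¬ ∀ i, g (Sum.inl i) (x 0, x sys.T) < g (Sum.inl i) sys.refEnds

section Constraints

variable {I J : Type*} [Fintype I] [Fintype J] (g : I ⊕ J → E × E → ℝ)

/-- The linearized endpoint functions. -/
def constraintL : sys.Direction →L[ℝ] (I ⊕ J → ℝ) :=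
  ContinuousLinearMap.pi fun k => fderiv ℝ (g k) sys.refEnds ∘L sys.endsL

theorem constraintL_apply (X : sys.Direction) (k : I ⊕ J) :
    sys.constraintL g X k = fderiv ℝ (g k) sys.refEnds (sys.endsL X) := rfl

/-- The second variations of all the endpoint functions. -/
def secondL : sys.Direction →L[ℝ] sys.Direction →L[ℝ] (I ⊕ J → ℝ) :=
  open Classical in
  ∑ k, (ContinuousLinearMap.compL ℝ sys.Direction ℝ (I ⊕ J → ℝ)
    (ContinuousLinearMap.toSpanSingleton ℝ (Pi.single k 1))) ∘L
      sys.secondVariation (g k) (sys.memLp_costate (g k))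

theorem secondL_apply (X Y : sys.Direction) (k : I ⊕ J) :
    sys.secondL g X Y k = sys.secondVariation (g k) (sys.memLp_costate (g k)) X Y := by
  classical
  have h : sys.secondL g X Y k = ∑ k', (sys.secondVariation (g k') (sys.memLp_costate (g k')) X Y •
      (Pi.single k' (1 : ℝ) : I ⊕ J → ℝ)) k := by
    rw [← Finset.sum_apply, secondL, sum_apply, sum_apply]
    rfl
  rw [h, Finset.sum_eq_single k (fun k' _ hk => by simp [hk.symm]) (by simp)]
  simp

/-- The second order term of the parabola is Y plus a state ξ that compensates the quadratic defect
of the dynamics along X. Pairing ξ with the costate of g_k converts its endpoint contribution into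
the integral part of the second variation. A choice of X and Y as excluded here therefore gives a
decreasing family of trajectories. -/
theorem not_decreasing_of_noDecrease (hg : ∀ k, ContDiff ℝ 2 (g k)) (hloc : sys.NoDecrease g)
    (hsurj : ∀ y : J → ℝ, ∃ X ∈ sys.boundedDirections, ∀ j, sys.constraintL g X (Sum.inr j) = y j)
    {X : sys.Direction} (hX : X ∈ sys.boundedDirections)
    (hXc : sys.constraintL g X ∈ criticalValues I J) {Y : sys.Direction}
    (hY : Y ∈ sys.boundedDirections) :
    ¬ ((∀ j, sys.constraintL g Y (Sum.inr j) = - sys.secondL g X X (Sum.inr j)) ∧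
        ∀ i, sys.constraintL g Y (Sum.inl i) < - sys.secondL g X X (Sum.inl i)) := by
  classical
  rintro ⟨h1, h2⟩
  choose ζ hζ hζ' using fun j : J => hsurj (Pi.single j 1)
  -- Finitely many bounded directions suffice: X, Y, and directions ζ j giving surjectivity of the
  -- linearized equalities. Spanning only these keeps every control of the family essentially
  -- bounded.
  let fam : Option (Option J) → sys.Direction := fun k => k.elim X fun k => k.elim Y ζ
  have hfam : ∀ k, fam k ∈ sys.boundedDirections := by
    rintro (_ | _ | j)
    exacts [hX, hY, hζ j]
  set B := sys.spanPerturbation fam hfam with hB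
  let η : E × E → J → ℝ := fun w j => g (Sum.inr j) w
  have hη : ContDiff ℝ 2 η := contDiff_pi.2 fun j => hg _
  have hη1 : ∀ w a j, fderiv ℝ η w a j = fderiv ℝ (g (Sum.inr j)) w a := fun w a j => by
    have := (fderiv_fderiv_clm_comp (ContinuousLinearMap.proj (R := ℝ) (φ := fun _ : J => ℝ) j)
      hη w a).1
    exact (DFunLike.congr_fun this a).symm
  have hη2 : ∀ w a b j, fderiv ℝ (fderiv ℝ η) w a b j =
      fderiv ℝ (fderiv ℝ (g (Sum.inr j))) w a b := fun w a b j => by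
    have := (fderiv_fderiv_clm_comp (ContinuousLinearMap.proj (R := ℝ) (φ := fun _ : J => ℝ) j)
      hη w a).2
    exact (DFunLike.congr_fun this b).symm
  set X₁ : C(Icc (0 : ℝ) sys.T, E) × (Option (Option J) → ℝ) :=
    (sys.solL X, Pi.single none 1) with hX₁
  set f : ℝ → E := fun t => (1 / 2 : ℝ) • sys.S t (B.dir X₁ t) (B.dir X₁ t) with hf
  have hfi : IntegrableOn f (Icc 0 sys.T) :=
    (Perturbation.integrableOn_top (B.memLp_S_dir X₁ X₁)).smul (1 / 2 : ℝ)
  -- The solution, with zero initial value, of the linearized equation with source ½S(X,X).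
  set ξ := resolvent sys.T_nonneg sys.memLp_A (primitive sys.T f) with hξ
  obtain ⟨hξd, hξ0⟩ := sys.hasDerivativeAE_resolvent hfi
  rw [← hξ] at hξd hξ0
  set X₂ : C(Icc (0 : ℝ) sys.T, E) × (Option (Option J) → ℝ) :=
    (sys.solL Y, Pi.single (some none) 1) + (ξ, 0) with hX₂
  have hdir₁ : ∀ t, B.dir X₁ t = (extend sys.T_nonneg (sys.solL X) t, X.2 t) :=
    fun t => sys.spanPerturbation_dir fam hfam none t
  have hlin₁ : B.linDefect X₁ = 0 := sys.spanPerturbation_linDefect fam hfam none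
  have hlin₂ : B.linDefect X₂ + (1 / 2 : ℝ) • B.quadDefect X₁ X₁ = 0 := by
    have e1 : B.linDefect (sys.solL Y, Pi.single (some none) 1) = 0 :=
      sys.spanPerturbation_linDefect fam hfam (some none)
    rw [hX₂, map_add, e1, zero_add, hξ, B.linDefect_resolvent, B.quadDefect_apply, hf,
      primitive_smul sys.T_nonneg (Perturbation.integrableOn_top (B.memLp_S_dir X₁ X₁)), smul_neg,
      add_neg_cancel]
  have hends₁ : B.ends X₁ = sys.endsL X := sys.spanPerturbation_ends fam hfam none
  have hends₂ : B.ends X₂ = sys.endsL Y + (0, extend sys.T_nonneg ξ sys.T) := by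
    have e1 : B.ends (sys.solL Y, Pi.single (some none) 1) = sys.endsL Y :=
      sys.spanPerturbation_ends fam hfam (some none)
    rw [hX₂, map_add, e1, B.ends_apply, extend_of_mem sys.T_nonneg ξ ⟨sys.T_nonneg, le_rfl⟩]
    simp
  have hsecond : ∀ k, fderiv ℝ (g k) sys.refEnds (B.ends X₂) + (1 / 2 : ℝ) *
      fderiv ℝ (fderiv ℝ (g k)) sys.refEnds (B.ends X₁) (B.ends X₁) =
      sys.constraintL g Y k + sys.secondL g X X k := by
    intro k
    -- As ξ vanishes at 0, the derivative of g_k in its final value is the integral of the costate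
    -- against the source.
    have e1 := (sys.isCostate_costate (g k)).integral_eq hξd
    rw [hξ0, map_zero, sub_zero, sys.costate_final, ← integral_time_eq sys.T_nonneg] at e1
    have e2 : fderiv ℝ (g k) sys.refEnds (0, extend sys.T_nonneg ξ sys.T) =
        ∫ t, sys.costate (g k) t (f t) ∂(timeMeasure sys.T) := by
      rw [← e1]; simp
    rw [hends₂, hends₁, map_add, e2, secondL_apply, secondVariation_apply, constraintL_apply]
    have e3 : ∫ t, sys.costate (g k) t (f t) ∂(timeMeasure sys.T) = (1 / 2 : ℝ) *
        ∫ t, sys.costate (g k) t (sys.S t (extend sys.T_nonneg (sys.solL X) t, X.2 t)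
          (extend sys.T_nonneg (sys.solL X) t, X.2 t)) ∂(timeMeasure sys.T) := by
      rw [← integral_const_mul]
      simp only [hf, hdir₁, map_smul, smul_eq_mul]
    rw [e3]
    ring
  obtain ⟨b, hb0, hb⟩ := B.exists_norm_dir_le
  obtain ⟨ρ, hρ, hloc⟩ := hloc
  -- The radius ρ controls the state variation, and ρ/b makes the control variation at most ρ almost
  -- everywhere.
  refine absurd (B.exists_decrease hη (φ := fun i => g (Sum.inl i))
    (fun i => hg _) (X₁ := X₁) (X₂ := X₂) (ρ := min ρ (ρ / b)) ?_ hlin₁ hlin₂ ?_ ?_ ?_ ?_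
    (by positivity)) ?_
  · intro y
    refine ⟨∑ j, y j • (sys.solL (ζ j), Pi.single (some (some j)) 1), ?_, ?_⟩
    · rw [map_sum]
      refine Finset.sum_eq_zero fun j _ => ?_
      have e1 : B.linDefect (sys.solL (ζ j), Pi.single (some (some j)) 1) = 0 :=
        sys.spanPerturbation_linDefect fam hfam (some (some j))
      rw [map_smul, e1, smul_zero]
    · ext j
      rw [hη1, map_sum, map_sum]
      have e1 : ∀ j', B.ends (sys.solL (ζ j'), Pi.single (some (some j')) 1) = sys.endsL (ζ j') :=
        fun j' => sys.spanPerturbation_ends fam hfam (some (some j'))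
      simp only [map_smul, e1]
      have e2 : ∀ j', fderiv ℝ (g (Sum.inr j)) (sys.x 0, sys.x sys.T) (sys.endsL (ζ j')) =
        Pi.single (M := fun _ => ℝ) j' 1 j := fun j' => hζ' j' j
      simp [e2, Pi.single_apply]
  · ext j
    rw [hη1, hends₁]
    exact hXc.1 j
  · ext j
    have := hsecond (Sum.inr j)
    rw [h1 j, neg_add_cancel] at this
    rw [Pi.add_apply, Pi.smul_apply, hη1, hη2, smul_eq_mul]
    exact this
  · intro i
    rw [hends₁]
    exact hXc.2 i
  · intro i
    have h3 := h2 i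
    have := hsecond (Sum.inl i)
    change fderiv ℝ (g (Sum.inl i)) sys.refEnds (B.ends X₂) + (1 / 2 : ℝ) *
      fderiv ℝ (fderiv ℝ (g (Sum.inl i))) sys.refEnds (B.ends X₁) (B.ends X₁) < 0
    rw [this]
    linarith
  · rintro ⟨W, hW1, hW2, hW3, hW4⟩
    obtain ⟨t1, t2⟩ := B.hasDerivativeAE_of_defect_eq_zero hW2
    have hends : (sys.x 0 + extend sys.T_nonneg W.1 0, sys.x sys.T + extend sys.T_nonneg W.1 sys.T) =
        sys.refEnds + B.ends W := by
      rw [t2, extend_of_mem sys.T_nonneg W.1 ⟨sys.T_nonneg, le_rfl⟩, B.ends_apply]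
      rfl
    refine hloc (fun t => sys.x t + extend sys.T_nonneg W.1 t) (fun t => sys.z t + B.ctrl t W.2)
      t1 (sys.memLp_z.add (memLp_apply (q := ⊤) B.memLp_ctrl (memLp_const W.2)))
      (fun t _ => ?_) ?_ (fun j => ?_) (fun i => ?_)
    · rw [add_sub_cancel_left]
      exact (norm_extend_le _ _ _).trans ((norm_fst_le W).trans (hW1.le.trans (min_le_left _ _)))
    · filter_upwards [hb] with t ht
      rw [add_sub_cancel_left]
      refine (norm_snd_le (B.dir W t)).trans ((ht W).trans ?_)
      have := hW1.le.trans (min_le_right _ _)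
      rwa [le_div_iff₀' hb0] at this
    · simp only [hends]
      exact congrFun hW3 j
    · simp only [hends]
      exact hW4 i

/-- Surjectivity of the linearized equalities passes to the dense subspace of bounded directions,
the target being finite-dimensional. The oscillating controls are bounded directions too, so their
limits are among those on which the abstract multiplier is nonnegative. -/
theorem exists_multiplier_of_noDecrease (hg : ∀ k, ContDiff ℝ 2 (g k)) (hloc : sys.NoDecrease g)
    (hsurj : ∀ y : J → ℝ, ∃ X, ∀ j, sys.constraintL g X (Sum.inr j) = y j)
    {X : sys.Direction} (hX : sys.constraintL g X ∈ criticalValues I J) :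
    ∃ e : I ⊕ J → ℝ, e ≠ 0 ∧ (∀ i, 0 ≤ e (Sum.inl i)) ∧
      (∀ Y, ∑ k, e k * fderiv ℝ (g k) sys.refEnds (sys.endsL Y) = 0) ∧
      (∀ (B : Set ℝ) (c : Z), MeasurableSet B → 0 ≤ ∑ k, e k * ((1 / 2 : ℝ) *
        ∫ t, B.indicator (fun t => sys.costate (g k) t (sys.S t (0, c) (0, c))) t
          ∂(timeMeasure sys.T))) ∧
      0 ≤ ∑ k, e k * sys.secondVariation (g k) (sys.memLp_costate (g k)) X X := by
  have hsurj' : ∀ y : J → ℝ, ∃ X ∈ sys.boundedDirections,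
      ∀ j, sys.constraintL g X (Sum.inr j) = y j := by
    obtain ⟨ρ, hρ1, hρ2⟩ := exists_correction sys.dense_boundedDirections (sys.constraintL g)
    intro y
    obtain ⟨Y, hY⟩ := hsurj y
    exact ⟨ρ (sys.constraintL g Y), hρ1 _, fun j => by rw [hρ2, hY]⟩
  obtain ⟨e, he1, he2, he3, he4, he5⟩ := exists_multiplier sys.dense_boundedDirections
    (sys.constraintL g) (sys.secondL g) hsurj'
    (fun X hX hXc Y hY => sys.not_decreasing_of_noDecrease g hg hloc hsurj' hX hXc hY) hX
  refine ⟨e, he1, he2, he3, fun B c hB => he4 _ ?_, ?_⟩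
  · refine ⟨sys.oscillationDir hB c, sys.oscillationDir_mem hB c,
      sys.exists_norm_oscillationDir_le hB c, sys.tendsto_oscillationDir hB c,
      tendsto_pi_nhds.2 fun k => ?_⟩
    simp only [secondL_apply]
    exact sys.tendsto_secondVariation_oscillationDir (g k) (sys.memLp_costate (g k)) hB c
  · simpa only [secondL_apply] using he5

end Constraints

end ControlSystem

/-! ### Convex hulls and combinations in finite dimension -/

theorem isCompact_convexHull_of_finiteDimensional {V : Type*} [NormedAddCommGroup V]
    [NormedSpace ℝ V] [FiniteDimensional ℝ V] {s : Set V} (hs : IsCompact s) :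
    IsCompact (convexHull ℝ s) := by
  classical
  rcases s.eq_empty_or_nonempty with rfl | ⟨v, hv⟩
  · simp
  -- Carathéodory: d points suffice, so the hull is a continuous image of a compact set. Shorter
  -- combinations are padded with weight zero at the fixed point v.
  let d := Module.finrank ℝ V + 1
  have hc := ((isCompact_stdSimplex ℝ (Fin d)).prod (isCompact_univ_pi fun _ : Fin d => hs)).image
    (f := fun q : (Fin d → ℝ) × (Fin d → V) => ∑ i, q.1 i • q.2 i) (by fun_prop)
  convert! hc using 1
  refine Subset.antisymm (fun x hx => ?_) ?_
  · obtain ⟨ι, _, z, w, hz, hind, hw, hw1, rfl⟩ := eq_pos_convex_span_of_mem_convexHull hx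
    have hcard : Fintype.card ι ≤ Fintype.card (Fin d) := by
      have := hind.card_le_finrank_succ
      rw [Fintype.card_fin]
      exact this.trans (Nat.succ_le_succ (Submodule.finrank_le _))
    obtain ⟨φ⟩ := Function.Embedding.nonempty_of_card_le hcard
    obtain ⟨W, hW, hW0⟩ : ∃ W : Fin d → ℝ, (∀ j, W (φ j) = w j) ∧ ∀ i, (¬∃ j, φ j = i) → W i = 0 :=
      ⟨Function.extend φ w 0, φ.injective.extend_apply w 0,
        fun i => Function.extend_apply' _ _ _⟩
    obtain ⟨Y, hY, hY0⟩ : ∃ Y : Fin d → V, (∀ j, Y (φ j) = z j) ∧ ∀ i, (¬∃ j, φ j = i) → Y i = v :=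
      ⟨Function.extend φ z fun _ => v, φ.injective.extend_apply z _,
        fun i => Function.extend_apply' _ _ _⟩
    refine ⟨(W, Y), ⟨⟨fun i => ?_, ?_⟩, fun i _ => ?_⟩, ?_⟩
    · by_cases h : ∃ j, φ j = i
      · obtain ⟨j, rfl⟩ := h
        exact (hw j).le.trans (hW j).ge
      · exact (hW0 i h).ge
    · rw [← hw1]
      exact (Finset.sum_of_injOn φ φ.injective.injOn (by simp)
        (fun i _ h => hW0 i (by simpa using h)) fun j _ => (hW j).symm).symm
    · by_cases h : ∃ j, φ j = i
      · obtain ⟨j, rfl⟩ := h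
        exact mem_of_eq_of_mem (hY j) (hz ⟨j, rfl⟩)
      · exact mem_of_eq_of_mem (hY0 i h) hv
    · refine (Finset.sum_of_injOn φ φ.injective.injOn (by simp) (fun i _ h => ?_)
        fun j _ => ?_).symm
      · change W i • Y i = 0
        rw [hW0 i (by simpa using h), zero_smul]
      · change w j • z j = W (φ j) • Y (φ j)
        rw [hW, hY]
  · rintro _ ⟨q, ⟨hq1, hq2⟩, rfl⟩
    exact (convex_convexHull ℝ s).sum_mem (fun i _ => hq1.1 i) hq1.2
      fun i _ => subset_convexHull ℝ s (hq2 i (mem_univ i))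

/-- The combination of the functions `g k` with coefficients `e k`. -/
def combination {K W : Type*} [Fintype K] (g : K → W → ℝ) (e : K → ℝ) (q : W) : ℝ :=
  ∑ k, e k * g k q

section Combination

variable {K W : Type*} [Fintype K] [NormedAddCommGroup W] [NormedSpace ℝ W] {g : K → W → ℝ}

theorem contDiff_combination (hg : ∀ k, ContDiff ℝ 2 (g k)) (e : K → ℝ) :
    ContDiff ℝ 2 (combination g e) :=
  ContDiff.sum fun k _ => contDiff_const.mul (hg k)

theorem fderiv_combination (hg : ∀ k, ContDiff ℝ 2 (g k)) (e : K → ℝ) (w : W) :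
    fderiv ℝ (combination g e) w = ∑ k, e k • fderiv ℝ (g k) w := by
  have h : combination g e = fun w => ∑ k, e k • g k w := rfl
  rw [h]
  exact (HasFDerivAt.fun_sum fun k _ =>
    ((hg k).differentiable two_ne_zero w).hasFDerivAt.const_smul (e k)).fderiv

theorem fderiv_fderiv_combination (hg : ∀ k, ContDiff ℝ 2 (g k)) (e : K → ℝ) (w a b : W) :
    fderiv ℝ (fderiv ℝ (combination g e)) w a b =
      ∑ k, e k * fderiv ℝ (fderiv ℝ (g k)) w a b := by
  have h : fderiv ℝ (combination g e) = fun w => ∑ k, e k • fderiv ℝ (g k) w :=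
    funext fun w => fderiv_combination hg e w
  rw [h]
  have h2 : HasFDerivAt (fun w => ∑ k, e k • fderiv ℝ (g k) w)
      (∑ k, e k • fderiv ℝ (fderiv ℝ (g k)) w) w := HasFDerivAt.fun_sum fun k _ =>
    ((((hg k).fderiv_right (m := 1) (by norm_num)).differentiable one_ne_zero
      w).hasFDerivAt.const_smul (e k))
  rw [h2.fderiv]
  simp [sum_apply]

end Combination

/-! ### Stationarity, the Legendre condition and the compact set of multipliers -/

namespace ControlSystem

variable {E Z : Type*} [NormedAddCommGroup E] [NormedSpace ℝ E] [FiniteDimensional ℝ E]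
  [CompleteSpace E] [NormedAddCommGroup Z] [NormedSpace ℝ Z] [FiniteDimensional ℝ Z]
  [CompleteSpace Z] (sys : ControlSystem E Z)

/-- The Legendre condition: the Hamiltonian of `p` has nonnegative curvature in the controls. -/
def Legendre (p : ℝ → E →L[ℝ] ℝ) : Prop :=
  ∀ᵐ t ∂(timeMeasure sys.T), ∀ c : Z, 0 ≤ p t (sys.S t (0, c) (0, c))

theorem integrableOn_hess {p : ℝ → E →L[ℝ] ℝ} (hp : MemLp p ⊤ (timeMeasure sys.T)) (a b : E × Z) :
    IntegrableOn (fun t => p t (sys.S t a b)) (Icc 0 sys.T) := by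
  have h1 := memLp_apply (G := E × Z) (H := E × Z →L[ℝ] ℝ) (sys.memLp_hess hp)
    (memLp_const (p := ⊤) a)
  have h2 := memLp_apply h1 (memLp_const (p := ⊤) b)
  exact h2.integrable le_top

/-- For each fixed c the integrals give the sign off a null set depending on c; a countable dense
set of c and continuity in c give one null set for all. The integrated form is what oscillations
test, and it is linear in p. -/
theorem legendre_iff {p : ℝ → E →L[ℝ] ℝ} (hp : MemLp p ⊤ (timeMeasure sys.T)) :
    sys.Legendre p ↔ ∀ (B : Set ℝ) (c : Z), MeasurableSet B →
      0 ≤ ∫ t, B.indicator (fun t => p t (sys.S t (0, c) (0, c))) t ∂(timeMeasure sys.T) := by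
  constructor
  · intro h B c _
    refine integral_nonneg_of_ae ?_
    filter_upwards [h] with t ht
    exact indicator_apply_nonneg fun _ => ht c
  · intro h
    have h1 : ∀ c : Z, ∀ᵐ t ∂(timeMeasure sys.T), 0 ≤ p t (sys.S t (0, c) (0, c)) := fun c =>
      ae_nonneg_of_forall_setIntegral_nonneg (sys.integrableOn_hess hp _ _) fun B hB _ => by
        rw [← integral_indicator hB]; exact h B c hB
    have h2 := ae_all_iff.2 fun k : ℕ => h1 (TopologicalSpace.denseSeq Z k)
    filter_upwards [h2] with t ht
    have hc : IsClosed {c : Z | 0 ≤ p t (sys.S t (0, c) (0, c))} :=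
      isClosed_le continuous_const (by fun_prop)
    intro c
    exact hc.closure_subset_iff.2 (range_subset_iff.2 ht)
      ((TopologicalSpace.denseRange_denseSeq Z) c)

theorem solL_hasDerivativeAE (X : sys.Direction) :
    HasDerivativeAE sys.T (extend sys.T_nonneg (sys.solL X))
      (fun t => sys.D t (extend sys.T_nonneg (sys.solL X) t, X.2 t)) ∧
    extend sys.T_nonneg (sys.solL X) 0 = X.1 :=
  hasDerivativeAE_extend_primitive sys.T_nonneg
    (sys.integrableOn_D_extend _ (integrableOn_coeFn X.2)) X.1 (sys.solL_spec X)

theorem endsL_eq (X : sys.Direction) :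
    sys.endsL X = (extend sys.T_nonneg (sys.solL X) 0, extend sys.T_nonneg (sys.solL X) sys.T) := by
  rw [endsL_apply, (sys.solL_hasDerivativeAE X).2,
    extend_of_mem sys.T_nonneg _ ⟨sys.T_nonneg, le_rfl⟩]

/-- Integrating the pairing of the costate with the linearized state eliminates the final state,
leaving the two independent data of a direction: its initial value and its control. -/
theorem IsCostate.apply_endsL {sys : ControlSystem E Z} {p : ℝ → E →L[ℝ] ℝ} (hp : sys.IsCostate p)
    {l : E × E →L[ℝ] ℝ} (hl : p sys.T = l ∘L ContinuousLinearMap.inr ℝ E E)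
    (X : sys.Direction) :
    l (sys.endsL X) = (l ∘L ContinuousLinearMap.inl ℝ E E + p 0) X.1 +
      ∫ t, p t (sys.Dz t (X.2 t)) ∂(timeMeasure sys.T) := by
  obtain ⟨h1, h2⟩ := sys.solL_hasDerivativeAE X
  simp only [D_apply] at h1
  have h3 := hp.integral_eq h1
  rw [integral_time_eq sys.T_nonneg, ← h3, endsL_eq, h2, hl]
  simp only [add_apply, ContinuousLinearMap.comp_apply, ContinuousLinearMap.inl_apply,
    ContinuousLinearMap.inr_apply]
  have h4 : ((X.1, extend sys.T_nonneg (sys.solL X) sys.T) : E × E) =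
    (X.1, 0) + (0, extend sys.T_nonneg (sys.solL X) sys.T) := by simp
  rw [h4, map_add]
  ring

/-- First order stationarity in terms of the costate. -/
theorem IsCostate.stationary_iff {sys : ControlSystem E Z} {p : ℝ → E →L[ℝ] ℝ}
    (hp : sys.IsCostate p) {l : E × E →L[ℝ] ℝ}
    (hl : p sys.T = l ∘L ContinuousLinearMap.inr ℝ E E) :
    (∀ X : sys.Direction, l (sys.endsL X) = 0) ↔
      p 0 = -(l ∘L ContinuousLinearMap.inl ℝ E E) ∧
        ∀ᵐ t ∂(timeMeasure sys.T), p t ∘L sys.Dz t = 0 := by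
  constructor
  · intro h
    have h0 : ∀ a : E, (l ∘L ContinuousLinearMap.inl ℝ E E + p 0) a = 0 := by
      intro a
      have := hp.apply_endsL hl ((a, 0) : sys.Direction)
      rw [h] at this
      have h1 : ∫ t, p t (sys.Dz t (((a, 0) : sys.Direction).2 t)) ∂(timeMeasure sys.T) = 0 := by
        refine integral_eq_zero_of_ae ?_
        filter_upwards [Lp.coeFn_zero Z 2 (timeMeasure sys.T)] with t ht
        change p t (sys.Dz t ((0 : Lp Z 2 (timeMeasure sys.T)) t)) = 0
        rw [ht]
        simp
      rw [h1, add_zero] at this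
      exact this.symm
    have h0' : l ∘L ContinuousLinearMap.inl ℝ E E + p 0 = 0 := ContinuousLinearMap.ext h0
    refine ⟨eq_neg_of_add_eq_zero_right h0', ?_⟩
    have hm : MemLp (fun t => p t ∘L sys.Dz t) ⊤ (timeMeasure sys.T) := by
      exact (ContinuousLinearMap.compL ℝ Z E ℝ).memLp_of_bilin ⊤ hp.memLp sys.memLp_Dz
    have hi : IntegrableOn (fun t => p t ∘L sys.Dz t) (Icc 0 sys.T) := hm.integrable le_top
    refine hi.ae_eq_zero_of_forall_setIntegral_eq_zero fun B hB _ => ?_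
    ext c
    rw [ContinuousLinearMap.integral_apply hi.integrableOn, zero_apply]
    -- Controls equal to c on B and zero elsewhere detect every set integral of p ∘ Dz.
    have hz : MemLp (B.indicator fun _ => c) 2 (timeMeasure sys.T) := (memLp_const c).indicator hB
    have := hp.apply_endsL hl ((0, hz.toLp _) : sys.Direction)
    rw [h, map_zero, zero_add] at this
    rw [← integral_indicator hB]
    refine Eq.trans (integral_congr_ae ?_) this.symm
    filter_upwards [hz.coeFn_toLp] with t ht
    rw [ht]
    by_cases htB : t ∈ B
    · simp [indicator_of_mem htB]
    · simp [indicator_of_notMem htB]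
  · rintro ⟨h1, h2⟩ X
    rw [hp.apply_endsL hl, h1, add_neg_cancel, zero_apply, zero_add]
    refine integral_eq_zero_of_ae ?_
    filter_upwards [h2] with t ht
    exact DFunLike.congr_fun ht (X.2 t)

section Multipliers

variable {I J : Type*} [Fintype I] [Fintype J] (g : I ⊕ J → E × E → ℝ)

/-- The costate associated with a combination of the endpoint functions. -/
def combinedCostate (e : I ⊕ J → ℝ) (t : ℝ) : E →L[ℝ] ℝ := ∑ k, e k • sys.costate (g k) t

theorem isCostate_combinedCostate (e : I ⊕ J → ℝ) : sys.IsCostate (sys.combinedCostate g e) := by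
  have key : ∀ s : Finset (I ⊕ J), sys.IsCostate (fun t => ∑ k ∈ s, e k • sys.costate (g k) t) := by
    intro s
    induction s using Finset.cons_induction with
    | empty =>
      simp only [Finset.sum_empty]
      refine ⟨?_, fun t _ => ?_⟩ <;> simp
    | cons k s hk ih =>
      simp only [Finset.sum_cons]
      refine (((sys.isCostate_costate (g k)).const_smul (e k)).add ih).congr sys.T_nonneg
        (fun _ _ => rfl) (.of_forall fun t => ?_)
      simp only [Pi.add_apply, Pi.smul_apply, ContinuousLinearMap.add_comp,
        ContinuousLinearMap.smul_comp, neg_add, smul_neg]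
  exact key _

theorem memLp_combinedCostate (e : I ⊕ J → ℝ) :
    MemLp (sys.combinedCostate g e) ⊤ (timeMeasure sys.T) :=
  (sys.isCostate_combinedCostate g e).memLp

variable {g} in
theorem combinedCostate_final (hg : ∀ k, ContDiff ℝ 2 (g k)) (e : I ⊕ J → ℝ) :
    sys.combinedCostate g e sys.T =
      fderiv ℝ (combination g e) sys.refEnds ∘L ContinuousLinearMap.inr ℝ E E := by
  rw [fderiv_combination hg, combinedCostate]
  ext a
  simp [costate_final, sum_apply]

/-- The normalized multipliers. -/
def normalizedMultipliers : Set (I ⊕ J → ℝ) :=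
  {e | ∑ k, |e k| = 1 ∧ (∀ i, 0 ≤ e (Sum.inl i)) ∧
    ∀ X : sys.Direction, fderiv ℝ (combination g e) sys.refEnds (sys.endsL X) = 0}

variable {g}

theorem fderiv_combination_endsL (hg : ∀ k, ContDiff ℝ 2 (g k)) (e : I ⊕ J → ℝ)
    (X : sys.Direction) : fderiv ℝ (combination g e) sys.refEnds (sys.endsL X) =
      ∑ k, e k * fderiv ℝ (g k) sys.refEnds (sys.endsL X) := by
  rw [fderiv_combination hg]
  simp [sum_apply]

theorem isCompact_normalizedMultipliers (hg : ∀ k, ContDiff ℝ 2 (g k)) :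
    IsCompact (sys.normalizedMultipliers g) := by
  refine Metric.isCompact_of_isClosed_isBounded ?_ ?_
  · have : sys.normalizedMultipliers g = {e | ∑ k, |e k| = 1} ∩
        ((⋂ i, {e | 0 ≤ e (Sum.inl i)}) ∩ ⋂ X : sys.Direction, {e : I ⊕ J → ℝ |
          ∑ k, e k * fderiv ℝ (g k) sys.refEnds (sys.endsL X) = 0}) := by
      ext e
      simp only [normalizedMultipliers, sys.fderiv_combination_endsL hg, mem_inter_iff,
        mem_iInter, mem_ofPred_eq]
    rw [this]
    refine (isClosed_eq (by fun_prop) continuous_const).inter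
      ((isClosed_iInter fun i => isClosed_le continuous_const (by fun_prop)).inter
        (isClosed_iInter fun X => isClosed_eq (by fun_prop) continuous_const))
  · refine (Metric.isBounded_closedBall (x := (0 : I ⊕ J → ℝ)) (r := 1)).subset fun e he => ?_
    rw [mem_closedBall_zero_iff, pi_norm_le_iff_of_nonneg zero_le_one]
    intro k
    rw [← he.1, Real.norm_eq_abs]
    exact Finset.single_le_sum (f := fun k => |e k|) (fun _ _ => abs_nonneg _) (Finset.mem_univ k)

theorem secondVariation_combination (hg : ∀ k, ContDiff ℝ 2 (g k)) (e : I ⊕ J → ℝ)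
    (X : sys.Direction) :
    sys.secondVariation (combination g e) (sys.memLp_combinedCostate g e) X X =
      ∑ k, e k * sys.secondVariation (g k) (sys.memLp_costate (g k)) X X := by
  have hi : ∀ {p : ℝ → E →L[ℝ] ℝ} (hp : MemLp p ⊤ (timeMeasure sys.T)),
      Integrable (fun t => p t (sys.S t (extend sys.T_nonneg (sys.solL X) t, X.2 t)
        (extend sys.T_nonneg (sys.solL X) t, X.2 t))) (timeMeasure sys.T) := by
    intro p hp
    have hj : MemLp (fun t => (extend sys.T_nonneg (sys.solL X) t, X.2 t)) 2 (timeMeasure sys.T) :=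
      (Lp.memLp (sys.jet X)).ae_eq (sys.coeFn_jet X)
    have h1 := memLp_apply (G := E × Z) (H := E × Z →L[ℝ] ℝ) (sys.memLp_hess hp) hj
    have h2 := (ContinuousLinearMap.id ℝ (E × Z →L[ℝ] ℝ)).memLp_of_bilin 1 h1 hj
    exact memLp_one_iff_integrable.1 h2
  simp only [secondVariation_apply, fderiv_fderiv_combination hg, combinedCostate, sum_apply,
    smul_apply, smul_eq_mul]
  rw [integral_finsetSum _ fun k _ => (hi (sys.memLp_costate (g k))).const_mul (e k),
    ← Finset.sum_add_distrib, Finset.mul_sum]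
  refine Finset.sum_congr rfl fun k _ => ?_
  rw [integral_const_mul]
  ring

/-- Expresses the Legendre condition as a family of linear inequalities in e: this makes it a closed
condition and matches it with the inequalities obtained on oscillation limits. -/
theorem legendre_combinedCostate_iff (e : I ⊕ J → ℝ) :
    sys.Legendre (sys.combinedCostate g e) ↔ ∀ (B : Set ℝ) (c : Z), MeasurableSet B →
      0 ≤ ∑ k, e k * ((1 / 2 : ℝ) * ∫ t, B.indicator
        (fun t => sys.costate (g k) t (sys.S t (0, c) (0, c))) t ∂(timeMeasure sys.T)) := by
  rw [sys.legendre_iff (sys.memLp_combinedCostate g e)]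
  refine forall₃_congr fun B c hB => ?_
  have : ∫ t, B.indicator (fun t => sys.combinedCostate g e t (sys.S t (0, c) (0, c))) t
      ∂(timeMeasure sys.T) = 2 * ∑ k, e k * ((1 / 2 : ℝ) * ∫ t, B.indicator
        (fun t => sys.costate (g k) t (sys.S t (0, c) (0, c))) t ∂(timeMeasure sys.T)) := by
    simp only [integral_indicator hB, combinedCostate, sum_apply, smul_apply, smul_eq_mul]
    rw [integral_finsetSum _ fun k _ => ((sys.integrableOn_hess (sys.memLp_costate (g k))
      _ _).integrableOn.const_mul (e k)), Finset.mul_sum]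
    refine Finset.sum_congr rfl fun k _ => ?_
    rw [integral_const_mul]
    ring
  rw [this]
  exact mul_nonneg_iff_of_pos_left two_pos

/-- Convex combinations of normalized multipliers satisfying the Legendre condition. -/
def legendreMultipliers (g : I ⊕ J → E × E → ℝ) : Set (I ⊕ J → ℝ) :=
  {e ∈ convexHull ℝ (sys.normalizedMultipliers g) | sys.Legendre (sys.combinedCostate g e)}

theorem isCompact_legendreMultipliers (hg : ∀ k, ContDiff ℝ 2 (g k)) :
    IsCompact (sys.legendreMultipliers g) := by
  refine (isCompact_convexHull_of_finiteDimensional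
    (sys.isCompact_normalizedMultipliers hg)).inter_right ?_
  change IsClosed {e | sys.Legendre (sys.combinedCostate g e)}
  simp only [legendre_combinedCostate_iff, ofPred_forall]
  exact isClosed_iInter fun B => isClosed_iInter fun c => isClosed_iInter fun _ =>
    isClosed_le continuous_const (by fun_prop)

/-- A nonzero form that vanishes on the range of the linearized equalities gives a multiplier
without inequality components. Since the equality components have no sign constraint, its opposite
is a multiplier as well, and 0 is their midpoint. -/
theorem zero_mem_convexHull_of_not_surjective (hg : ∀ k, ContDiff ℝ 2 (g k))
    (h : ¬ ∀ y : J → ℝ, ∃ X, ∀ j, sys.constraintL g X (Sum.inr j) = y j) :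
    (0 : I ⊕ J → ℝ) ∈ convexHull ℝ (sys.normalizedMultipliers g) := by
  classical
  let L : sys.Direction →ₗ[ℝ] (J → ℝ) :=
    LinearMap.funLeft ℝ ℝ Sum.inr ∘ₗ (sys.constraintL g).toLinearMap
  have hL : LinearMap.range L < ⊤ := by
    refine lt_top_iff_ne_top.2 fun htop => h fun y => ?_
    obtain ⟨X, hX⟩ := LinearMap.range_eq_top.1 htop y
    exact ⟨X, fun j => congrFun hX j⟩
  obtain ⟨f, hf, hLf⟩ := Submodule.exists_le_ker_of_lt_top _ hL
  have hfs : ∀ y : J → ℝ, f y = ∑ j, f (Pi.single j 1) * y j := by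
    intro y
    conv_lhs => rw [← Finset.univ_sum_single y]
    rw [map_sum]
    refine Finset.sum_congr rfl fun j _ => ?_
    rw [mul_comm, ← smul_eq_mul, ← map_smul]
    congr 1
    ext j'
    simp [Pi.single_apply]
  set N := ∑ j, |f (Pi.single j 1)| with hN
  have hNpos : 0 < N := by
    refine (Finset.sum_nonneg fun _ _ => abs_nonneg _).lt_of_ne fun h0 => hf ?_
    refine LinearMap.ext fun y => ?_
    rw [hfs, LinearMap.zero_apply]
    refine Finset.sum_eq_zero fun j hj => ?_
    have := (Finset.sum_eq_zero_iff_of_nonneg (fun _ _ => abs_nonneg _)).1 h0.symm j hj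
    rw [abs_eq_zero.1 this, zero_mul]
  have key : ∀ s : ℝ, |s| = 1 → (Sum.elim (fun _ => 0) fun j => s * (f (Pi.single j 1) / N)) ∈
      sys.normalizedMultipliers g := by
    intro s hs
    refine ⟨?_, fun i => le_rfl, fun X => ?_⟩
    · simp only [Fintype.sum_sum_type, Sum.elim_inl, Sum.elim_inr, abs_zero, Finset.sum_const_zero,
        zero_add, abs_mul, hs, one_mul, abs_div, abs_of_pos hNpos]
      rw [← Finset.sum_div, div_self hNpos.ne']
    · rw [sys.fderiv_combination_endsL hg]
      simp only [Fintype.sum_sum_type, Sum.elim_inl, Sum.elim_inr, zero_mul,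
        Finset.sum_const_zero, zero_add]
      have h1 : f (L X) = 0 := hLf ⟨X, rfl⟩
      rw [hfs] at h1
      have h2 : ∀ j, L X j = fderiv ℝ (g (Sum.inr j)) sys.refEnds (sys.endsL X) := fun _ => rfl
      simp only [h2] at h1
      rw [← mul_zero (s / N), ← h1, Finset.mul_sum]
      exact Finset.sum_congr rfl fun j _ => by ring
  have := convex_convexHull ℝ (sys.normalizedMultipliers g)
    (subset_convexHull ℝ _ (key 1 (by simp))) (subset_convexHull ℝ _ (key (-1) (by simp)))
    (a := 1 / 2) (b := 1 / 2) (by norm_num) (by norm_num) (by norm_num)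
  convert! this using 1
  ext k
  rcases k with i | j <;> simp

/-- In the surjective case the multiplier obtained by separation only has to be normalized, and no
proper convex combination is needed. In the degenerate case 0 is available, and both its Legendre
condition and its second variation are trivial. -/
theorem exists_legendreMultiplier (hg : ∀ k, ContDiff ℝ 2 (g k)) (hloc : sys.NoDecrease g)
    {X : sys.Direction} (hX : sys.constraintL g X ∈ criticalValues I J) :
    ∃ e ∈ sys.legendreMultipliers g,
      0 ≤ ∑ k, e k * sys.secondVariation (g k) (sys.memLp_costate (g k)) X X := by
  by_cases hsurj : ∀ y : J → ℝ, ∃ X, ∀ j, sys.constraintL g X (Sum.inr j) = y j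
  · obtain ⟨e, he0, he1, he2, he3, he4⟩ := sys.exists_multiplier_of_noDecrease g hg hloc hsurj hX
    set N := ∑ k, |e k| with hN
    have hNpos : 0 < N := by
      refine (Finset.sum_nonneg fun _ _ => abs_nonneg _).lt_of_ne fun h0 => he0 ?_
      ext k
      exact abs_eq_zero.1 ((Finset.sum_eq_zero_iff_of_nonneg (fun _ _ => abs_nonneg _)).1 h0.symm k
        (Finset.mem_univ k))
    have hsum : ∀ r : I ⊕ J → ℝ, ∑ k, (N⁻¹ • e) k * r k = N⁻¹ * ∑ k, e k * r k := fun r => by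
      rw [Finset.mul_sum]
      exact Finset.sum_congr rfl fun k _ => by rw [Pi.smul_apply, smul_eq_mul, mul_assoc]
    refine ⟨N⁻¹ • e, ⟨subset_convexHull ℝ _ ⟨?_, fun i => ?_, fun Y => ?_⟩,
      (sys.legendre_combinedCostate_iff _).2 fun B c hB => ?_⟩, ?_⟩
    · simp only [Pi.smul_apply, smul_eq_mul, abs_mul, abs_of_pos (inv_pos.2 hNpos)]
      rw [← Finset.mul_sum, inv_mul_cancel₀ hNpos.ne']
    · exact mul_nonneg (inv_nonneg.2 hNpos.le) (he1 i)
    · rw [sys.fderiv_combination_endsL hg, hsum, he2, mul_zero]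
    · rw [hsum]
      exact mul_nonneg (inv_nonneg.2 hNpos.le) (he3 B c hB)
    · rw [hsum]
      exact mul_nonneg (inv_nonneg.2 hNpos.le) he4
  · refine ⟨0, ⟨sys.zero_mem_convexHull_of_not_surjective hg hsurj, ?_⟩, by simp⟩
    exact (sys.legendre_combinedCostate_iff _).2 fun B c hB => by simp

/-- The second order necessary condition for a reference trajectory near which the endpoint
functions cannot be decreased. -/
theorem exists_isGreatest_secondVariation (hg : ∀ k, ContDiff ℝ 2 (g k))
    (hloc : sys.NoDecrease g) {X : sys.Direction}
    (hX : sys.constraintL g X ∈ criticalValues I J) :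
    ∃ M : ℝ, IsGreatest ((fun e => sys.secondVariation (combination g e)
      (sys.memLp_combinedCostate g e) X X) '' sys.legendreMultipliers g) M ∧ 0 ≤ M := by
  obtain ⟨e, he, he0⟩ := sys.exists_legendreMultiplier hg hloc hX
  simp only [sys.secondVariation_combination hg]
  obtain ⟨M, hM⟩ := ((sys.isCompact_legendreMultipliers hg).image (f := fun e =>
    ∑ k, e k * sys.secondVariation (g k) (sys.memLp_costate (g k)) X X)
    (by fun_prop)).exists_isGreatest ⟨_, mem_image_of_mem _ he⟩
  exact ⟨M, hM, he0.trans (hM.2 (mem_image_of_mem _ he))⟩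

end Multipliers

end ControlSystem

/-! ### Weak lower semicontinuity of the second variation -/

theorem exists_norm_le_of_weakly_null {X : Type*} [NormedAddCommGroup X] [NormedSpace ℝ X]
    {z : ℕ → X} (hz : ∀ φ : X →L[ℝ] ℝ, Tendsto (fun k => φ (z k)) atTop (𝓝 0)) :
    ∃ C, ∀ k, ‖z k‖ ≤ C := by
  obtain ⟨C, hC⟩ := banach_steinhaus (g := fun k => NormedSpace.inclusionInDoubleDual ℝ X (z k))
    fun φ => by
      obtain ⟨C, hC⟩ := (Metric.isBounded_range_of_tendsto _ (hz φ)).exists_norm_le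
      exact ⟨C, fun k => hC _ ⟨k, rfl⟩⟩
  refine ⟨C, fun k => ?_⟩
  rw [← (NormedSpace.inclusionInDoubleDualLi (E := X) ℝ).norm_map]
  exact hC k

/-- Dominated convergence. Linearized states of a weakly null sequence of directions are bounded and
converge pointwise, so this yields their strong convergence in L². -/
theorem tendsto_norm_extendL {E : Type*} [NormedAddCommGroup E] [NormedSpace ℝ E]
    [CompleteSpace E] {T : ℝ} (hT : 0 ≤ T) {x : ℕ → C(Icc (0 : ℝ) T, E)} {C : ℝ}
    (hx : ∀ k, ‖x k‖ ≤ C) (hx0 : ∀ t, Tendsto (fun k => extend hT (x k) t) atTop (𝓝 0)) :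
    Tendsto (fun k => ‖extendL hT (x k)‖) atTop (𝓝 0) := by
  have hn : ∀ k, ‖extendL hT (x k)‖ =
      (∫ t, ‖extend hT (x k) t‖ ^ (2 : ℝ) ∂(timeMeasure T)) ^ (2 : ℝ)⁻¹ := by
    intro k
    rw [Lp.norm_def, eLpNorm_congr_ae (coeFn_extendL hT (x k)),
      (memLp_extend hT (x k) 2).eLpNorm_eq_integral_rpow_norm two_ne_zero ENNReal.ofNat_ne_top,
      ENNReal.toReal_ofReal (by positivity), ENNReal.toReal_ofNat]
  have hlim : Tendsto (fun k => ∫ t, ‖extend hT (x k) t‖ ^ (2 : ℝ) ∂(timeMeasure T)) atTop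
      (𝓝 0) := by
    have := tendsto_integral_of_dominated_convergence (μ := timeMeasure T) (f := fun _ => (0 : ℝ))
      (F := fun k t => ‖extend hT (x k) t‖ ^ (2 : ℝ)) (fun _ => C ^ (2 : ℝ))
      (fun k => ((continuous_extend hT (x k)).norm.rpow_const
        fun _ => Or.inr zero_le_two).aestronglyMeasurable)
      (integrable_const _) (fun k => .of_forall fun t => ?_) (.of_forall fun t => ?_)
    · simpa using this
    · rw [Real.norm_of_nonneg (by positivity)]
      gcongr
      exact (norm_extend_le hT (x k) t).trans (hx k)
    · have h1 := (hx0 t).norm.rpow_const (p := 2) (Or.inr zero_le_two)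
      simpa using h1
  simp only [hn]
  have := hlim.rpow_const (p := (2 : ℝ)⁻¹) (Or.inr (by norm_num))
  simpa using this

namespace ControlSystem

variable {E Z : Type*} [NormedAddCommGroup E] [NormedSpace ℝ E] [FiniteDimensional ℝ E]
  [CompleteSpace E] [NormedAddCommGroup Z] [NormedSpace ℝ Z] [FiniteDimensional ℝ Z]
  [CompleteSpace Z] (sys : ControlSystem E Z)

/-- Up to a vanishing term, the second variation is nonnegative along a weakly null sequence when
the Legendre condition holds. -/
theorem Legendre.exists_tendsto_le {sys : ControlSystem E Z} {p : ℝ → E →L[ℝ] ℝ}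
    (hL : sys.Legendre p) (g : E × E → ℝ) (hp : MemLp p ⊤ (timeMeasure sys.T))
    {X : ℕ → sys.Direction}
    (hX : ∀ φ : sys.Direction →L[ℝ] ℝ, Tendsto (fun k => φ (X k)) atTop (𝓝 0)) :
    ∃ r : ℕ → ℝ, Tendsto r atTop (𝓝 0) ∧ ∀ k, r k ≤ sys.secondVariation g hp (X k) (X k) := by
  obtain ⟨C, hC⟩ := exists_norm_le_of_weakly_null hX
  have hx : Tendsto (fun k => ‖extendL sys.T_nonneg (sys.solL (X k))‖) atTop (𝓝 0) := by
    refine tendsto_norm_extendL sys.T_nonneg (C := ‖sys.solL‖ * C) (fun k => ?_) fun t => ?_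
    · exact (sys.solL.le_opNorm _).trans (mul_le_mul_of_nonneg_left (hC k) (norm_nonneg _))
    · exact tendsto_clm_of_weakly_null hX
        (ContinuousMap.evalCLM ℝ (projIcc 0 sys.T sys.T_nonneg t) ∘L sys.solL)
  set Q := integralForm (sys.memLp_hess hp) with hQ
  set ix := (ContinuousLinearMap.inl ℝ E Z).compLpL 2 (timeMeasure sys.T) with hix
  set iz := (ContinuousLinearMap.inr ℝ E Z).compLpL 2 (timeMeasure sys.T) with hiz
  set ξ := fun k => ix (extendL sys.T_nonneg (sys.solL (X k))) with hξ
  set ζ := fun k => iz (X k).2 with hζ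
  have hjet : ∀ k, sys.jet (X k) = ξ k + ζ k := fun k => rfl
  have hξ0 : Tendsto (fun k => ‖ξ k‖) atTop (𝓝 0) := by
    refine squeeze_zero (fun k => norm_nonneg _) (fun k => ix.le_opNorm _) ?_
    simpa using hx.const_mul ‖ix‖
  have hζC : ∀ k, ‖ζ k‖ ≤ ‖iz‖ * C := fun k => (iz.le_opNorm _).trans
    (mul_le_mul_of_nonneg_left ((norm_snd_le (X k)).trans (hC k)) (norm_nonneg _))
  have hC0 : 0 ≤ ‖iz‖ * C := (norm_nonneg _).trans (hζC 0)
  -- The state parts ξ k tend to zero in norm while the control parts ζ k stay bounded, so every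
  -- term with a state factor vanishes.
  have hr : Tendsto (fun k => Q (ξ k) (ξ k) + (Q (ξ k) (ζ k) + Q (ζ k) (ξ k))) atTop (𝓝 0) := by
    have h1 : Tendsto (fun k => Q (ξ k) (ξ k)) atTop (𝓝 0) := by
      refine squeeze_zero_norm (a := fun k => ‖Q‖ * ‖ξ k‖ * ‖ξ k‖) (fun k => Q.le_opNorm₂ _ _) ?_
      simpa using (hξ0.const_mul ‖Q‖).mul hξ0
    have h2 : Tendsto (fun k => Q (ξ k) (ζ k)) atTop (𝓝 0) := by
      refine squeeze_zero_norm (a := fun k => ‖Q‖ * ‖ξ k‖ * (‖iz‖ * C)) (fun k => ?_) ?_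
      · refine (Q.le_opNorm₂ _ _).trans ?_
        gcongr
        exact hζC k
      · simpa using (hξ0.const_mul ‖Q‖).mul_const (‖iz‖ * C)
    have h3 : Tendsto (fun k => Q (ζ k) (ξ k)) atTop (𝓝 0) := by
      refine squeeze_zero_norm (a := fun k => ‖Q‖ * (‖iz‖ * C) * ‖ξ k‖) (fun k => ?_) ?_
      · refine (Q.le_opNorm₂ _ _).trans ?_
        gcongr
        exact hζC k
      · simpa using hξ0.const_mul (‖Q‖ * (‖iz‖ * C))
    simpa using h1.add (h2.add h3)
  have hends : Tendsto (fun k => fderiv ℝ (fderiv ℝ g) sys.refEnds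
      (sys.endsL (X k)) (sys.endsL (X k))) atTop (𝓝 0) := by
    have h1 := tendsto_clm_of_weakly_null hX sys.endsL
    have h2 : Continuous fun e => fderiv ℝ (fderiv ℝ g) sys.refEnds e e := by fun_prop
    have := (h2.tendsto 0).comp h1
    rwa [map_zero] at this
  refine ⟨_, by simpa using (hends.add hr).const_mul (1 / 2 : ℝ), fun k => ?_⟩
  -- The remaining term is purely in the controls and is nonnegative by the Legendre condition.
  have hpos : 0 ≤ Q (ζ k) (ζ k) := by
    rw [hQ, integralForm_apply]
    refine integral_nonneg_of_ae ?_
    filter_upwards [hL, (ContinuousLinearMap.inr ℝ E Z).coeFn_compLpL (p := 2)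
      (μ := timeMeasure sys.T) (X k).2] with t ht h2
    rw [h2]
    exact ht _
  have hval : sys.secondVariation g hp (X k) (X k) = (1 / 2 : ℝ) *
      (fderiv ℝ (fderiv ℝ g) sys.refEnds (sys.endsL (X k)) (sys.endsL (X k)) +
        Q (sys.jet (X k)) (sys.jet (X k))) := rfl
  rw [hval, hjet]
  simp only [map_add, add_apply]
  linarith

/-- The Legendre condition implies weak lower semicontinuity of the second variation. -/
theorem Legendre.eventually_lt {sys : ControlSystem E Z} {p : ℝ → E →L[ℝ] ℝ}
    (hL : sys.Legendre p) (g : E × E → ℝ) (hp : MemLp p ⊤ (timeMeasure sys.T))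
    {X : ℕ → sys.Direction} {X' : sys.Direction}
    (hX : ∀ φ : sys.Direction →L[ℝ] ℝ, Tendsto (fun k => φ (X k)) atTop (𝓝 (φ X')))
    {c : ℝ} (hc : c < sys.secondVariation g hp X' X') :
    ∀ᶠ k in atTop, c < sys.secondVariation g hp (X k) (X k) := by
  have hY : ∀ φ : sys.Direction →L[ℝ] ℝ, Tendsto (fun k => φ (X k - X')) atTop (𝓝 0) := fun φ => by
    simpa using (hX φ).sub_const (φ X')
  obtain ⟨r, hr, hle⟩ := hL.exists_tendsto_le g hp hY
  set B := sys.secondVariation g hp with hB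
  have hlim : Tendsto (fun k => B X' X' + (B X' (X k - X') + B.flip X' (X k - X')) + r k) atTop
      (𝓝 (B X' X')) := by
    simpa using (((hY (B X')).add (hY (B.flip X'))).const_add (B X' X')).add hr
  filter_upwards [(tendsto_order.1 hlim).1 c hc] with k hk
  refine hk.trans_le ?_
  have h1 : B (X k) (X k) = B X' X' + (B X' (X k - X') + B.flip X' (X k - X')) +
      B (X k - X') (X k - X') := by
    simp only [ContinuousLinearMap.flip_apply, map_sub, sub_apply]
    ring
  rw [h1]
  linarith [hle k]

/-- Weak lower semicontinuity of the second variation along oscillating controls implies the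
Legendre condition. -/
theorem legendre_of_eventually_lt (g : E × E → ℝ) {p : ℝ → E →L[ℝ] ℝ}
    (hp : MemLp p ⊤ (timeMeasure sys.T))
    (h : ∀ {B : Set ℝ} (hB : MeasurableSet B) (c : Z), ∀ a < 0, ∀ᶠ k in atTop,
      a < sys.secondVariation g hp (sys.oscillationDir hB c k) (sys.oscillationDir hB c k)) :
    sys.Legendre p := by
  refine (sys.legendre_iff hp).2 fun B c hB => ?_
  have h1 := sys.tendsto_secondVariation_oscillationDir g hp hB c
  have h2 : 0 ≤ (1 / 2 : ℝ) * ∫ t, B.indicator (fun t => p t (sys.S t (0, c) (0, c))) t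
        ∂(timeMeasure sys.T) := by
    refine le_of_forall_lt fun a ha => ?_
    obtain ⟨a', ha', ha0⟩ := exists_between ha
    exact ha'.trans_le (ge_of_tendsto h1 ((h hB c a' ha0).mono fun _ h => h.le))
  linarith

end ControlSystem

/-! ### Partial derivatives as blocks of the full derivatives -/

section PartialDerivatives

variable {W Y V₁ V₂ : Type*} [NormedAddCommGroup W] [NormedSpace ℝ W] [NormedAddCommGroup Y]
  [NormedSpace ℝ Y] [NormedAddCommGroup V₁] [NormedSpace ℝ V₁] [NormedAddCommGroup V₂]
  [NormedSpace ℝ V₂] {f : W → Y}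

theorem fderiv_comp_affine (hf : ContDiff ℝ 2 f) {G : V₂ → W} {L : V₂ →L[ℝ] W} {b : V₂}
    (hG : HasFDerivAt G L b) : fderiv ℝ (fun b => f (G b)) b = fderiv ℝ f (G b) ∘L L :=
  (((hf.differentiable two_ne_zero (G b)).hasFDerivAt).comp b hG).fderiv

/-- One formula for every Hessian block. The inner partial derivative is f' at the moving point i a,
composed with the fixed map L₂. The base point b₀ may vary with a, as in the pure blocks, or be
constant, as in the mixed ones. -/
theorem fderiv_fderiv_comp_affine (hf : ContDiff ℝ 2 f) {i : V₁ → W} {L₁ : V₁ →L[ℝ] W} {a₀ : V₁}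
    (hi : HasFDerivAt i L₁ a₀) {G : V₁ → V₂ → W} {b₀ : V₁ → V₂} {L₂ : V₂ →L[ℝ] W}
    (hG : ∀ a, HasFDerivAt (G a) L₂ (b₀ a)) (hGi : ∀ a, G a (b₀ a) = i a) (a : V₁) (b : V₂) :
    fderiv ℝ (fun a => fderiv ℝ (fun b => f (G a b)) (b₀ a)) a₀ a b =
      fderiv ℝ (fderiv ℝ f) (i a₀) (L₁ a) (L₂ b) := by
  have h1 : (fun a => fderiv ℝ (fun b => f (G a b)) (b₀ a)) =
      fun a => (ContinuousLinearMap.compL ℝ V₂ W Y).flip L₂ (fderiv ℝ f (i a)) := by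
    ext1 a
    rw [fderiv_comp_affine hf (hG a), hGi]
    rfl
  rw [h1]
  have h2 := ((hf.fderiv_right (m := 1) (by norm_num)).differentiable one_ne_zero
    (i a₀)).hasFDerivAt.comp a₀ hi
  have h3 := (((ContinuousLinearMap.compL ℝ V₂ W Y).flip L₂).hasFDerivAt.comp a₀ h2).fderiv
  exact DFunLike.congr_fun (DFunLike.congr_fun h3 a) b

end PartialDerivatives

theorem memLp_pair {G G' : Type*} [NormedAddCommGroup G] [NormedSpace ℝ G] [NormedAddCommGroup G']
    [NormedSpace ℝ G'] {T : ℝ} {q : ENNReal} {u : ℝ → G} {v : ℝ → G'}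
    (hu : MemLp u q (timeMeasure T)) (hv : MemLp v q (timeMeasure T)) :
    MemLp (fun t => (u t, v t)) q (timeMeasure T) := by
  have h := (memLp_clm_comp (ContinuousLinearMap.inl ℝ G G') hu).add
    (memLp_clm_comp (ContinuousLinearMap.inr ℝ G G') hv)
  refine h.ae_eq (.of_forall fun t => ?_)
  simp

/-! ### The problem as a control system with control (u,v) -/

namespace Problem

variable {n l m dφ dη : ℕ} (P : Problem n l m dφ dη)

/-- The dynamics as a function of the pair formed by the state and both controls. -/
def dynamics (q : Vec n × Vec l × Vec m) : Vec n := P.F q.1 q.2.1 q.2.2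

theorem contDiff_dynamics (hP : P.Regular) : ContDiff ℝ 2 P.dynamics := by
  have h1 : ContDiff ℝ 2 fun q : Vec n × Vec l × Vec m => (q.1, q.2.1) := by fun_prop
  refine (hP.1.1.comp h1).add (ContDiff.sum fun i _ => ?_)
  have h2 : ContDiff ℝ 2 fun q : Vec n × Vec l × Vec m => q.2.2 i := by fun_prop
  exact h2.smul ((hP.2.1 i).1.comp h1)

/-- The control system of the problem, with a given reference trajectory. -/
def system (hT : 0 < P.T) (hP : P.Regular) {w : Triple n l m} (hw : P.IsTrajectory w) :
    ControlSystem (Vec n) (Vec l × Vec m) where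
  T := P.T
  T_pos := hT
  F := P.dynamics
  contDiff_F := P.contDiff_dynamics hP
  x := w.x
  z := fun t => (w.u t, w.v t)
  memLp_z := memLp_pair hw.1.2.1 hw.1.2.2
  hasDerivativeAE_x := hw.2

/-- All the endpoint functions. -/
def endpoint : Fin (dφ + 1) ⊕ Fin dη → Vec n × Vec n → ℝ := Sum.elim P.φ P.η

theorem contDiff_endpoint (hP : P.Regular) : ∀ k, ContDiff ℝ 2 (P.endpoint k)
  | Sum.inl i => (hP.2.2.1 i).1
  | Sum.inr j => (hP.2.2.2 j).1

/-- The scalar components of a multiplier. -/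
def coefficients : Multiplier n dφ dη →ₗ[ℝ] (Fin (dφ + 1) ⊕ Fin dη → ℝ) where
  toFun lam := Sum.elim lam.1 lam.2.1
  map_add' a b := by ext (i | j) <;> rfl
  map_smul' c a := by ext (i | j) <;> rfl

theorem ell_eq (lam : Multiplier n dφ dη) :
    P.ell lam = combination P.endpoint (coefficients lam) := by
  ext q
  simp [ell, combination, coefficients, endpoint]

section Derivatives

variable (hT : 0 < P.T) (hP : P.Regular) {w : Triple n l m} (hw : P.IsTrajectory w)
  (lam : Multiplier n dφ dη) (t : ℝ)

theorem hasFDerivAt_state (u : Vec l) (v : Vec m) (x : Vec n) :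
    HasFDerivAt (fun x : Vec n => (x, u, v)) (ContinuousLinearMap.inl ℝ (Vec n) (Vec l × Vec m))
      x := hasFDerivAt_prodMk_left x (u, v)

theorem hasFDerivAt_control (x : Vec n) (v : Vec m) (u : Vec l) :
    HasFDerivAt (fun u : Vec l => (x, u, v)) (ContinuousLinearMap.inr ℝ (Vec n) (Vec l × Vec m) ∘L
      ContinuousLinearMap.inl ℝ (Vec l) (Vec m)) u :=
  (hasFDerivAt_prodMk_right x (u, v)).comp u (hasFDerivAt_prodMk_left u v)

theorem hasFDerivAt_affineControl (x : Vec n) (u : Vec l) (v : Vec m) :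
    HasFDerivAt (fun v : Vec m => (x, u, v)) (ContinuousLinearMap.inr ℝ (Vec n) (Vec l × Vec m) ∘L
      ContinuousLinearMap.inr ℝ (Vec l) (Vec m)) v :=
  (hasFDerivAt_prodMk_right x (u, v)).comp v (hasFDerivAt_prodMk_right u v)

theorem contDiff_hamiltonian (hP : P.Regular) (p : Covec n) :
    ContDiff ℝ 2 fun q => p (P.dynamics q) := p.contDiff.comp (P.contDiff_dynamics hP)

theorem fderiv_hamiltonian (hP : P.Regular) (p : Covec n) (q : Vec n × Vec l × Vec m) :
    fderiv ℝ (fun q => p (P.dynamics q)) q = p ∘L fderiv ℝ P.dynamics q :=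
  (fderiv_fderiv_clm_comp p (P.contDiff_dynamics hP) q q).1

theorem fderiv_fderiv_hamiltonian (hP : P.Regular) (p : Covec n) (q a b : Vec n × Vec l × Vec m) :
    fderiv ℝ (fderiv ℝ fun q => p (P.dynamics q)) q a b =
      p (fderiv ℝ (fderiv ℝ P.dynamics) q a b) :=
  DFunLike.congr_fun (fderiv_fderiv_clm_comp p (P.contDiff_dynamics hP) q a).2 b

theorem Fx_eq : P.Fx w t = (P.system hT hP hw).A t :=
  fderiv_comp_affine (P.contDiff_dynamics hP) (hasFDerivAt_state (w.u t) (w.v t) (w.x t))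

theorem Fu_eq : P.Fu w t = (P.system hT hP hw).Dz t ∘L ContinuousLinearMap.inl ℝ _ _ :=
  fderiv_comp_affine (P.contDiff_dynamics hP) (hasFDerivAt_control (w.x t) (w.v t) (w.u t))

theorem Fv_eq : P.Fv w t = (P.system hT hP hw).Dz t ∘L ContinuousLinearMap.inr ℝ _ _ :=
  fderiv_comp_affine (P.contDiff_dynamics hP) (hasFDerivAt_affineControl (w.x t) (w.u t) (w.v t))

theorem F_linearized_eq (a : Vec n) (b : Vec l) (c : Vec m) :
    P.Fx w t a + P.Fu w t b + P.Fv w t c = (P.system hT hP hw).D t (a, b, c) := by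
  rw [P.Fx_eq hT hP hw, P.Fu_eq hT hP hw, P.Fv_eq hT hP hw, ControlSystem.D_apply, add_assoc,
    ContinuousLinearMap.comp_apply, ContinuousLinearMap.comp_apply, ← map_add]
  simp

theorem Hx_eq : P.Hx lam w t = lam.2.2 t ∘L (P.system hT hP hw).A t := by
  have := fderiv_comp_affine (P.contDiff_hamiltonian hP (lam.2.2 t))
    (hasFDerivAt_state (w.u t) (w.v t) (w.x t))
  rw [fderiv_hamiltonian P hP] at this
  exact this

theorem Hu_eq : P.Hu lam w t = lam.2.2 t ∘L (P.system hT hP hw).Dz t ∘L ContinuousLinearMap.inl ℝ _ _ := by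
  have := fderiv_comp_affine (P.contDiff_hamiltonian hP (lam.2.2 t))
    (hasFDerivAt_control (w.x t) (w.v t) (w.u t))
  rw [fderiv_hamiltonian P hP] at this
  exact this

theorem Hv_eq : P.Hv lam w t = lam.2.2 t ∘L (P.system hT hP hw).Dz t ∘L ContinuousLinearMap.inr ℝ _ _ := by
  have := fderiv_comp_affine (P.contDiff_hamiltonian hP (lam.2.2 t))
    (hasFDerivAt_affineControl (w.x t) (w.u t) (w.v t))
  rw [fderiv_hamiltonian P hP] at this
  exact this

theorem Hxx_eq (a b : Vec n) :
    P.Hxx lam w t a b = lam.2.2 t ((P.system hT hP hw).S t (a, 0, 0) (b, 0, 0)) :=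
  (fderiv_fderiv_comp_affine (P.contDiff_hamiltonian hP (lam.2.2 t)) (b₀ := fun x => x)
    (hasFDerivAt_state (w.u t) (w.v t) (w.x t)) (fun x => hasFDerivAt_state (w.u t) (w.v t) x)
    (fun _ => rfl) a b).trans (P.fderiv_fderiv_hamiltonian hP _ _ _ _)

theorem Hux_eq (a : Vec n) (b : Vec l) :
    P.Hux lam w t a b = lam.2.2 t ((P.system hT hP hw).S t (a, 0, 0) (0, b, 0)) :=
  (fderiv_fderiv_comp_affine (P.contDiff_hamiltonian hP (lam.2.2 t)) (b₀ := fun _ => w.u t)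
    (hasFDerivAt_state (w.u t) (w.v t) (w.x t)) (fun x => hasFDerivAt_control x (w.v t) (w.u t))
    (fun _ => rfl) a b).trans (P.fderiv_fderiv_hamiltonian hP _ _ _ _)

theorem Hvx_eq (a : Vec n) (b : Vec m) :
    P.Hvx lam w t a b = lam.2.2 t ((P.system hT hP hw).S t (a, 0, 0) (0, 0, b)) :=
  (fderiv_fderiv_comp_affine (P.contDiff_hamiltonian hP (lam.2.2 t)) (b₀ := fun _ => w.v t)
    (hasFDerivAt_state (w.u t) (w.v t) (w.x t))
    (fun x => hasFDerivAt_affineControl x (w.u t) (w.v t))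
    (fun _ => rfl) a b).trans (P.fderiv_fderiv_hamiltonian hP _ _ _ _)

theorem Huu_eq (a b : Vec l) :
    P.Huu lam w t a b = lam.2.2 t ((P.system hT hP hw).S t (0, a, 0) (0, b, 0)) :=
  (fderiv_fderiv_comp_affine (P.contDiff_hamiltonian hP (lam.2.2 t)) (b₀ := fun u => u)
    (hasFDerivAt_control (w.x t) (w.v t) (w.u t)) (fun u => hasFDerivAt_control (w.x t) (w.v t) u)
    (fun _ => rfl) a b).trans (P.fderiv_fderiv_hamiltonian hP _ _ _ _)

theorem Hvu_eq (a : Vec l) (b : Vec m) :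
    P.Hvu lam w t a b = lam.2.2 t ((P.system hT hP hw).S t (0, a, 0) (0, 0, b)) :=
  (fderiv_fderiv_comp_affine (P.contDiff_hamiltonian hP (lam.2.2 t)) (b₀ := fun _ => w.v t)
    (hasFDerivAt_control (w.x t) (w.v t) (w.u t))
    (fun u => hasFDerivAt_affineControl (w.x t) u (w.v t))
    (fun _ => rfl) a b).trans (P.fderiv_fderiv_hamiltonian hP _ _ _ _)

/-- The dynamics is affine in `v`. -/
theorem S_affine (a b : Vec m) : (P.system hT hP hw).S t (0, 0, a) (0, 0, b) = 0 := by
  have h1 := fderiv_fderiv_comp_affine (P.contDiff_dynamics hP) (b₀ := fun v => v)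
    (hasFDerivAt_affineControl (w.x t) (w.u t) (w.v t))
    (fun v => hasFDerivAt_affineControl (w.x t) (w.u t) v) (fun _ => rfl) a b
  refine Eq.trans h1.symm ?_
  -- The derivative in v is M at every v; being constant, it has zero derivative.
  let M : Vec m →L[ℝ] Vec n :=
    ∑ i, (EuclideanSpace.proj i : Vec m →L[ℝ] ℝ).smulRight (P.f i (w.x t, w.u t))
  have h2 : ∀ v : Vec m, HasFDerivAt (fun v' => P.dynamics (w.x t, w.u t, v')) M v := by
    intro v
    have h3 : (fun v' => P.dynamics (w.x t, w.u t, v')) = fun v' => P.f₀ (w.x t, w.u t) + M v' := by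
      ext1 v'
      simp [dynamics, F, M, sum_apply]
    rw [h3]
    exact M.hasFDerivAt.const_add _
  simp only [(h2 _).fderiv]
  simp

/-- By symmetry each mixed block occurs twice in the full quadratic form, which explains the absence
of ½ on the mixed terms; the block in v alone vanishes. -/
theorem second_derivative_eq (a : Vec n) (b : Vec l) (c : Vec m) :
    (1 / 2) * P.Hxx lam w t a a + P.Hux lam w t a b + P.Hvx lam w t a c +
      (1 / 2) * P.Huu lam w t b b + P.Hvu lam w t b c =
      (1 / 2 : ℝ) * lam.2.2 t ((P.system hT hP hw).S t (a, b, c) (a, b, c)) := by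
  rw [P.Hxx_eq hT hP hw, P.Hux_eq hT hP hw, P.Hvx_eq hT hP hw, P.Huu_eq hT hP hw,
    P.Hvu_eq hT hP hw]
  have h1 : ((a, b, c) : Vec n × Vec l × Vec m) = (a, 0, 0) + (0, b, 0) + (0, 0, c) := by simp
  rw [h1]
  simp only [map_add, add_apply]
  rw [P.S_affine hT hP hw, (P.system hT hP hw).S_symm t (0, b, 0) (a, 0, 0), (P.system hT hP hw).S_symm t (0, 0, c) (a, 0, 0),
    (P.system hT hP hw).S_symm t (0, 0, c) (0, b, 0), map_zero]
  ring

/-- The Legendre condition in terms of both controls. -/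
theorem legendre_iff : (∀ c : Vec l × Vec m, 0 ≤ lam.2.2 t ((P.system hT hP hw).S t (0, c) (0, c))) ↔
    (∀ a : Vec l, 0 ≤ P.Huu lam w t a a) ∧ P.Hvu lam w t = 0 := by
  have key : ∀ (a : Vec l) (b : Vec m), lam.2.2 t ((P.system hT hP hw).S t (0, a, b) (0, a, b)) =
      P.Huu lam w t a a + 2 * P.Hvu lam w t a b := by
    intro a b
    have := P.second_derivative_eq hT hP hw lam t 0 a b
    simp only [map_zero, zero_apply, mul_zero, zero_add] at this
    linarith
  constructor
  · intro h
    have h1 : ∀ (a : Vec l), 0 ≤ P.Huu lam w t a a := fun a => by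
      have := h (a, 0)
      rw [key, map_zero, mul_zero, add_zero] at this
      exact this
    refine ⟨h1, ?_⟩
    ext a b
    by_contra hne
    set y := P.Hvu lam w t a b with hy
    have hy0 : y ≠ 0 := hne
    -- The multiple of b is chosen so that the form takes the value -1: it is affine in the
    -- v-component, with nonzero slope 2y.
    have := h (a, (-(P.Huu lam w t a a + 1) / (2 * y)) • b)
    rw [key, map_smul, ← hy, smul_eq_mul] at this
    have h2 : 2 * (-(P.Huu lam w t a a + 1) / (2 * y) * y) = -(P.Huu lam w t a a + 1) := by
      field_simp
    linarith
  · rintro ⟨h1, h2⟩ ⟨a, b⟩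
    rw [key, h2]
    simpa using h1 a

theorem ellx0_eq (hP : P.Regular) (w : Triple n l m) (lam : Multiplier n dφ dη) : P.ellx0 lam w =
    fderiv ℝ (combination P.endpoint (coefficients lam)) (w.x 0, w.x P.T) ∘L
      ContinuousLinearMap.inl ℝ _ _ := by
  rw [ellx0, ell_eq]
  exact fderiv_comp_affine (contDiff_combination (P.contDiff_endpoint hP) _)
    (hasFDerivAt_prodMk_left (w.x 0) (w.x P.T))

theorem ellxT_eq (hP : P.Regular) (w : Triple n l m) (lam : Multiplier n dφ dη) : P.ellxT lam w =
    fderiv ℝ (combination P.endpoint (coefficients lam)) (w.x 0, w.x P.T) ∘L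
      ContinuousLinearMap.inr ℝ _ _ := by
  rw [ellxT, ell_eq]
  exact fderiv_comp_affine (contDiff_combination (P.contDiff_endpoint hP) _)
    (hasFDerivAt_prodMk_right (w.x 0) (w.x P.T))

end Derivatives

end Problem

/-- The operator `z ↦ (t ↦ B(t) z(t))` on `L²`. -/
def multiplyL {E W : Type*} [NormedAddCommGroup E] [NormedSpace ℝ E]
    [NormedAddCommGroup W] [NormedSpace ℝ W] {T : ℝ} {B : ℝ → W →L[ℝ] E}
    (hB : MemLp B ⊤ (timeMeasure T)) : Lp W 2 (timeMeasure T) →L[ℝ] Lp E 2 (timeMeasure T) :=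
  (ContinuousLinearMap.id ℝ (W →L[ℝ] E)).holderL (timeMeasure T) ⊤ 2 2 (hB.toLp B)

theorem coeFn_multiplyL {E W : Type*} [NormedAddCommGroup E] [NormedSpace ℝ E]
    [NormedAddCommGroup W] [NormedSpace ℝ W] {T : ℝ} {B : ℝ → W →L[ℝ] E}
    (hB : MemLp B ⊤ (timeMeasure T)) (z : Lp W 2 (timeMeasure T)) :
    multiplyL hB z =ᵐ[timeMeasure T] fun t => B t (z t) := by
  have h1 := (ContinuousLinearMap.id ℝ (W →L[ℝ] E)).coeFn_holder (r := 2) (hB.toLp B) z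
  filter_upwards [h1, hB.coeFn_toLp] with t h1 h2
  rw [multiplyL, ContinuousLinearMap.holderL_apply_apply, h1, h2]
  rfl

/-! ### Weak convergence in L² and W^{1,2} -/

section L2

variable {k : ℕ} {T : ℝ}

theorem inner_toLp_eq {h : ℝ → Vec k} (hh : MemLp h 2 (timeMeasure T))
    {z : Lp (Vec k) 2 (timeMeasure T)} {y : ℝ → Vec k} (hy : y =ᵐ[timeMeasure T] z) :
    ∫ t, inner ℝ (y t) (h t) ∂(timeMeasure T) = inner ℝ (hh.toLp h) z := by
  rw [L2.inner_def]
  refine integral_congr_ae ?_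
  filter_upwards [hy, hh.coeFn_toLp] with t h1 h2
  rw [h1, h2, real_inner_comm]

theorem WeaklyConvergesL2.tendsto {y : ℕ → ℝ → Vec k} {y' : ℝ → Vec k}
    (h : WeaklyConvergesL2 T y y') {z : ℕ → Lp (Vec k) 2 (timeMeasure T)}
    {z' : Lp (Vec k) 2 (timeMeasure T)} (hz : ∀ j, y j =ᵐ[timeMeasure T] z j)
    (hz' : y' =ᵐ[timeMeasure T] z') (φ : Lp (Vec k) 2 (timeMeasure T) →L[ℝ] ℝ) :
    Tendsto (fun j => φ (z j)) atTop (𝓝 (φ z')) := by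
  obtain ⟨f, hf⟩ : ∃ f : Lp (Vec k) 2 (timeMeasure T), ∀ e, φ e = inner ℝ f e :=
    ⟨(InnerProductSpace.toDual ℝ _).symm φ, fun e => by simp⟩
  have h1 := h f (Lp.memLp f)
  simp only [inner_toLp_eq (Lp.memLp f) (hz _), inner_toLp_eq (Lp.memLp f) hz', Lp.toLp_coeFn] at h1
  simpa only [hf] using h1

theorem weaklyConvergesL2_of_tendsto {X : Type*} [NormedAddCommGroup X] [NormedSpace ℝ X]
    {ξ : ℕ → X} {ξ' : X} (h : ∀ φ : X →L[ℝ] ℝ, Tendsto (fun j => φ (ξ j)) atTop (𝓝 (φ ξ')))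
    (L : X →L[ℝ] Lp (Vec k) 2 (timeMeasure T)) {y : ℕ → ℝ → Vec k} {y' : ℝ → Vec k}
    (hy : ∀ j, y j =ᵐ[timeMeasure T] L (ξ j)) (hy' : y' =ᵐ[timeMeasure T] L ξ') :
    WeaklyConvergesL2 T y y' := by
  intro g hg
  simp only [inner_toLp_eq hg (hy _), inner_toLp_eq hg hy']
  exact h (innerSL ℝ (hg.toLp g) ∘L L)

/-- The weight t - T vanishes at T, so integration by parts against it leaves only the initial
value. -/
theorem hasDerivativeAE_affine (a : Covec k) :
    HasDerivativeAE T (fun t => (t - T) • a) (fun _ => a) := by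
  refine ⟨integrable_const _, fun t _ => ?_⟩
  rw [intervalIntegral.integral_const]
  module

/-- The initial value of an absolutely continuous function in terms of integrals. -/
theorem HasDerivativeAE.inner_initial {x y : ℝ → Vec k} (h : HasDerivativeAE T x y) (hT : 0 ≤ T)
    (a : Vec k) : ∫ t, inner ℝ (x t) a ∂(timeMeasure T) +
      ∫ t, inner ℝ (y t) ((t - T) • a) ∂(timeMeasure T) = T * inner ℝ (x 0) a := by
  have h1 := (hasDerivativeAE_affine (T := T) (innerSL ℝ a)).integral_apply h hT
  have hx : Integrable (fun t => inner ℝ (x t) a) (timeMeasure T) :=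
    ((h.continuousOn hT).inner continuousOn_const).integrableOn_Icc
  have hy : Integrable (fun t => inner ℝ (y t) ((t - T) • a)) (timeMeasure T) := by
    have hy' : Integrable (fun t => inner ℝ (y t) a) (timeMeasure T) := h.1.inner_const a
    have := hy'.bdd_mul (c := T) (f := fun t => t - T)
      (by fun_prop) ((ae_restrict_mem measurableSet_Icc).mono fun t ht => by
        rw [Real.norm_eq_abs, abs_le]; constructor <;> linarith [ht.1, ht.2])
    refine this.congr (.of_forall fun t => ?_)
    simp only [inner_smul_right]
  rw [← integral_add hx hy, integral_time_eq hT]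
  have h2 : ∀ t, inner ℝ (x t) a + inner ℝ (y t) ((t - T) • a) =
      innerSL ℝ a (x t) + ((t - T) • innerSL ℝ a) (y t) := fun t => by
    simp only [smul_apply, innerSL_apply_apply, inner_smul_right, smul_eq_mul]
    rw [real_inner_comm, real_inner_comm a (y t)]
  simp only [h2]
  rw [h1]
  simp only [sub_self, zero_smul, zero_apply, zero_sub, smul_apply, innerSL_apply_apply,
    smul_eq_mul]
  rw [real_inner_comm]
  ring

/-- T⟨x(0),a⟩ is the sum of an L² pairing of x and one of its derivative, both continuous for the
weak convergence; taking for a the coordinate vectors gives norm convergence. -/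
theorem WeaklyConvergesW12.tendsto_initial {x : ℕ → ℝ → Vec k} {x' : ℝ → Vec k} (hT : 0 < T)
    (h : WeaklyConvergesW12 T x x') : Tendsto (fun j => x j 0) atTop (𝓝 (x' 0)) := by
  obtain ⟨h1, y, y', hy, hy', h2⟩ := h
  have key : ∀ a : Vec k, Tendsto (fun j => inner ℝ (x j 0) a) atTop (𝓝 (inner ℝ (x' 0) a)) := by
    intro a
    have hm : MemLp (fun t => (t - T) • a) 2 (timeMeasure T) := by
      refine MemLp.of_bound (by fun_prop) (T * ‖a‖)
        ((ae_restrict_mem measurableSet_Icc).mono fun t ht => ?_)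
      rw [norm_smul, Real.norm_eq_abs]
      gcongr
      rw [abs_le]; constructor <;> linarith [ht.1, ht.2]
    have h3 := ((h1 (fun _ => a) (memLp_const a)).add (h2 _ hm)).const_mul T⁻¹
    simp only [(hy _).inner_initial hT.le, hy'.inner_initial hT.le,
      inv_mul_cancel_left₀ hT.ne'] at h3
    exact h3
  have h4 : ∀ v : Vec k, v = WithLp.toLp 2 fun i => inner ℝ v (EuclideanSpace.single i 1) := by
    intro v
    ext i
    simp [EuclideanSpace.inner_single_right]
  rw [h4 (x' 0), funext fun j => h4 (x j 0)]
  exact ((PiLp.continuous_toLp 2 _).tendsto _).comp (tendsto_pi_nhds.2 fun i => key _)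

end L2

/-! ### Correspondence between triples and directions -/

namespace ControlSystem

variable {n l m : ℕ} (sys : ControlSystem (Vec n) (Vec l × Vec m))

/-- The triple `b` solves the linearized state equation in the direction `X`. -/
def Represents (X : sys.Direction) (b : Triple n l m) : Prop :=
  EqOn b.x (extend sys.T_nonneg (sys.solL X)) (Icc 0 sys.T) ∧
    (fun t => (b.u t, b.v t)) =ᵐ[timeMeasure sys.T] X.2

/-- The triple associated with a direction. -/
def tripleOf (X : sys.Direction) : Triple n l m where
  x := extend sys.T_nonneg (sys.solL X)
  u := fun t => (X.2 t).1
  v := fun t => (X.2 t).2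

theorem represents_tripleOf (X : sys.Direction) : sys.Represents X (sys.tripleOf X) :=
  ⟨fun _ _ => rfl, .rfl⟩

theorem memW2_tripleOf (X : sys.Direction) : MemW2 sys.T (sys.tripleOf X) := by
  have hz : MemLp X.2 2 (timeMeasure sys.T) := Lp.memLp X.2
  exact ⟨⟨_, memLp_apply sys.memLp_D (memLp_pair (memLp_extend sys.T_nonneg (sys.solL X) 2) hz),
    (sys.solL_hasDerivativeAE X).1⟩, memLp_clm_comp (ContinuousLinearMap.fst ℝ _ _) hz,
    memLp_clm_comp (ContinuousLinearMap.snd ℝ _ _) hz⟩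

theorem exists_represents {b : Triple n l m} (hb : MemW2 sys.T b)
    (hd : HasDerivativeAE sys.T b.x (fun t => sys.D t (b.x t, b.u t, b.v t))) :
    ∃ X, sys.Represents X b := by
  have hz := memLp_pair hb.2.1 hb.2.2
  set X : sys.Direction := (b.x 0, hz.toLp _) with hX
  have hXz : X.2 =ᵐ[timeMeasure sys.T] fun t => (b.u t, b.v t) := hz.coeFn_toLp
  refine ⟨X, ?_, hXz.symm⟩
  obtain ⟨h1, h2⟩ := sys.solL_hasDerivativeAE X
  simp only [ControlSystem.D_apply] at h1 hd
  have h3 := h1.congr (y' := fun t => sys.A t (extend sys.T_nonneg (sys.solL X) t) +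
    sys.Dz t (b.u t, b.v t)) sys.T_nonneg (fun _ _ => rfl) (by
      filter_upwards [hXz] with t ht
      rw [ht])
  exact linear_ode_unique sys.T_nonneg sys.memLp_A hd h3 h2.symm

section Represents

variable {sys}

theorem Represents.endsL {X : sys.Direction} {b : Triple n l m} (h : sys.Represents X b) :
    sys.endsL X = (b.x 0, b.x sys.T) := by
  rw [ControlSystem.endsL_eq, h.1 ⟨le_rfl, sys.T_nonneg⟩, h.1 ⟨sys.T_nonneg, le_rfl⟩]

/-- A direction consists of the initial value and the two controls, so a functional splits
accordingly. The initial values converge in norm and the controls weakly. -/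
theorem Represents.tendsto {X : ℕ → sys.Direction}
    {X' : sys.Direction} {b : ℕ → Triple n l m} {b' : Triple n l m}
    (hb : ∀ j, sys.Represents (X j) (b j)) (hb' : sys.Represents X' b')
    (h : WeaklyConvergesW2 sys.T b b') (φ : sys.Direction →L[ℝ] ℝ) :
    Tendsto (fun j => φ (X j)) atTop (𝓝 (φ X')) := by
  obtain ⟨hx, hu, hv⟩ := h
  have hinit := hx.tendsto_initial sys.T_pos
  let Iu := (ContinuousLinearMap.inl ℝ (Vec l) (Vec m)).compLpL 2 (timeMeasure sys.T)
  let Iv := (ContinuousLinearMap.inr ℝ (Vec l) (Vec m)).compLpL 2 (timeMeasure sys.T)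
  let Ju := (ContinuousLinearMap.fst ℝ (Vec l) (Vec m)).compLpL 2 (timeMeasure sys.T)
  let Jv := (ContinuousLinearMap.snd ℝ (Vec l) (Vec m)).compLpL 2 (timeMeasure sys.T)
  have hdecomp : ∀ z : Lp (Vec l × Vec m) 2 (timeMeasure sys.T), z = Iu (Ju z) + Iv (Jv z) := by
    intro z
    refine Lp.ext ?_
    filter_upwards [Lp.coeFn_add (Iu (Ju z)) (Iv (Jv z)),
      (ContinuousLinearMap.inl ℝ (Vec l) (Vec m)).coeFn_compLpL (p := 2) (Ju z),
      (ContinuousLinearMap.inr ℝ (Vec l) (Vec m)).coeFn_compLpL (p := 2) (Jv z),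
      (ContinuousLinearMap.fst ℝ (Vec l) (Vec m)).coeFn_compLpL (p := 2) z,
      (ContinuousLinearMap.snd ℝ (Vec l) (Vec m)).coeFn_compLpL (p := 2) z] with t h1 h2 h3 h4 h5
    rw [h1, Pi.add_apply, h2, h3, h4, h5]
    simp
  have hJu : ∀ {X : sys.Direction} {b : Triple n l m},
      sys.Represents X b → b.u =ᵐ[timeMeasure sys.T] Ju X.2 := by
    intro X b h
    filter_upwards [h.2, (ContinuousLinearMap.fst ℝ (Vec l) (Vec m)).coeFn_compLpL (p := 2)
      (μ := timeMeasure sys.T) X.2] with t h1 h2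
    rw [h2, ← h1]
    simp
  have hJv : ∀ {X : sys.Direction} {b : Triple n l m},
      sys.Represents X b → b.v =ᵐ[timeMeasure sys.T] Jv X.2 := by
    intro X b h
    filter_upwards [h.2, (ContinuousLinearMap.snd ℝ (Vec l) (Vec m)).coeFn_compLpL (p := 2)
      (μ := timeMeasure sys.T) X.2] with t h1 h2
    rw [h2, ← h1]
    simp
  have hX0 : ∀ {X : sys.Direction} {b : Triple n l m},
      sys.Represents X b → X.1 = b.x 0 := fun h => congrArg Prod.fst h.endsL
  let φx : Vec n →L[ℝ] ℝ := φ ∘L ContinuousLinearMap.inl ℝ _ _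
  let φz : Lp (Vec l × Vec m) 2 (timeMeasure sys.T) →L[ℝ] ℝ := φ ∘L ContinuousLinearMap.inr ℝ _ _
  have hφ : ∀ {X : sys.Direction} {b : Triple n l m},
      sys.Represents X b →
      φ X = φx (b.x 0) + ((φz ∘L Iu) (Ju X.2) + (φz ∘L Iv) (Jv X.2)) := by
    intro X b h
    have h1 : (φz ∘L Iu) (Ju X.2) + (φz ∘L Iv) (Jv X.2) = φz X.2 := by
      conv_rhs => rw [hdecomp X.2, map_add]
      rfl
    rw [h1, ← hX0 h]
    simp only [φx, φz, ContinuousLinearMap.comp_apply, ContinuousLinearMap.inl_apply,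
      ContinuousLinearMap.inr_apply, ← map_add, Prod.mk_add_mk, add_zero, zero_add]
  simp only [hφ (hb _), hφ hb']
  exact ((φx.continuous.tendsto _).comp hinit).add
    ((hu.tendsto (fun j => hJu (hb j)) (hJu hb') _).add
      (hv.tendsto (fun j => hJv (hb j)) (hJv hb') _))

end Represents

/-- State, state derivative and controls are all images of the direction under bounded operators
into L², and such operators preserve weak convergence. -/
theorem weaklyConvergesW2_tripleOf {X : ℕ → sys.Direction}
    {X' : sys.Direction}
    (h : ∀ φ : sys.Direction →L[ℝ] ℝ, Tendsto (fun j => φ (X j)) atTop (𝓝 (φ X'))) :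
    WeaklyConvergesW2 sys.T (fun j => sys.tripleOf (X j)) (sys.tripleOf X') := by
  have hD : ∀ X : sys.Direction,
      (fun t => sys.D t (extend sys.T_nonneg (sys.solL X) t, X.2 t))
        =ᵐ[timeMeasure sys.T] multiplyL sys.memLp_D (sys.jet X) := by
    intro X
    filter_upwards [coeFn_multiplyL sys.memLp_D (sys.jet X),
      sys.coeFn_jet X] with t h1 h2
    rw [h1, h2]
  refine ⟨⟨?_, _, _, fun j => (sys.solL_hasDerivativeAE (X j)).1,
    (sys.solL_hasDerivativeAE X').1, ?_⟩, ?_, ?_⟩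
  · exact weaklyConvergesL2_of_tendsto h (extendL sys.T_nonneg ∘L sys.solL)
      (fun j => (coeFn_extendL sys.T_nonneg _).symm) (coeFn_extendL sys.T_nonneg _).symm
  · exact weaklyConvergesL2_of_tendsto h
      (multiplyL sys.memLp_D ∘L sys.jet) (fun j => hD (X j)) (hD X')
  · exact weaklyConvergesL2_of_tendsto h
      ((ContinuousLinearMap.fst ℝ (Vec l) (Vec m)).compLpL 2 (timeMeasure sys.T) ∘L
        ContinuousLinearMap.snd ℝ _ _)
      (fun j => ((ContinuousLinearMap.fst ℝ (Vec l) (Vec m)).coeFn_compLpL _).symm)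
      ((ContinuousLinearMap.fst ℝ (Vec l) (Vec m)).coeFn_compLpL _).symm
  · exact weaklyConvergesL2_of_tendsto h
      ((ContinuousLinearMap.snd ℝ (Vec l) (Vec m)).compLpL 2 (timeMeasure sys.T) ∘L
        ContinuousLinearMap.snd ℝ _ _)
      (fun j => ((ContinuousLinearMap.snd ℝ (Vec l) (Vec m)).coeFn_compLpL _).symm)
      ((ContinuousLinearMap.snd ℝ (Vec l) (Vec m)).coeFn_compLpL _).symm

end ControlSystem

namespace ControlSystem

variable {E Z : Type*} [NormedAddCommGroup E] [NormedSpace ℝ E] [FiniteDimensional ℝ E]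
  [CompleteSpace E] [NormedAddCommGroup Z] [NormedSpace ℝ Z] [FiniteDimensional ℝ Z]
  [CompleteSpace Z] (sys : ControlSystem E Z) {I J : Type*} [Fintype I] [Fintype J]
  (g : I ⊕ J → E × E → ℝ)

theorem combinedCostate_add (e e' : I ⊕ J → ℝ) (t : ℝ) :
    sys.combinedCostate g (e + e') t = sys.combinedCostate g e t + sys.combinedCostate g e' t := by
  simp only [combinedCostate, Pi.add_apply, add_smul, Finset.sum_add_distrib]

theorem combinedCostate_smul (c : ℝ) (e : I ⊕ J → ℝ) (t : ℝ) :
    sys.combinedCostate g (c • e) t = c • sys.combinedCostate g e t := by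
  simp only [combinedCostate, Pi.smul_apply, smul_eq_mul, mul_smul, Finset.smul_sum]

end ControlSystem

/-! ### Transfer of multipliers and second variations to the problem -/

namespace Problem

variable {n l m dφ dη : ℕ} (P : Problem n l m dφ dη) (hT : 0 < P.T) (hP : P.Regular)
  {w : Triple n l m} (hw : P.IsTrajectory w)

theorem exists_represents {b : Triple n l m} (hb : b ∈ P.linearizedSolutions w) :
    ∃ X, (P.system hT hP hw).Represents X b := by
  refine (P.system hT hP hw).exists_represents hb.1 ?_
  have hd := hb.2
  simp only [P.F_linearized_eq hT hP hw] at hd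
  exact hd

theorem tripleOf_mem (X : (P.system hT hP hw).Direction) :
    (P.system hT hP hw).tripleOf X ∈ P.linearizedSolutions w := by
  refine ⟨(P.system hT hP hw).memW2_tripleOf X, ?_⟩
  simp only [P.F_linearized_eq hT hP hw]
  exact ((P.system hT hP hw).solL_hasDerivativeAE X).1

theorem omega_eq {X : (P.system hT hP hw).Direction} {b : Triple n l m}
    (h : (P.system hT hP hw).Represents X b) (lam : Multiplier n dφ dη) {p : ℝ → Covec n}
    (hp : MemLp p ⊤ (timeMeasure (P.system hT hP hw).T)) (hlam : EqOn lam.2.2 p (Icc 0 P.T)) :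
    P.Omega w lam b = (P.system hT hP hw).secondVariation
      (combination P.endpoint (coefficients lam)) hp X X := by
  refine Eq.trans ?_ ((P.system hT hP hw).secondVariation_apply _ hp X).symm
  rw [Omega, h.endsL, P.ell_eq, mul_add]
  simp only [P.second_derivative_eq hT hP hw]
  refine congrArg₂ (· + ·) rfl ?_
  rw [← integral_time_eq hT.le, ← integral_const_mul]
  refine integral_congr_ae ?_
  have h2 : (fun t => (b.u t, b.v t)) =ᵐ[timeMeasure P.T] X.2 := h.2
  filter_upwards [h2, ae_restrict_mem measurableSet_Icc] with t h1 h2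
  rw [h.1 h2, hlam h2, ← h1]

/-- All inequality constraints vanish at the reference, so a strict decrease keeps them satisfied,
and the equalities keep their value zero. Within radius δ the controls remain in U × V. The
competitor is thus feasible and contradicts minimality. -/
theorem noDecrease_of_isWeakMinimum (hint : P.ControlsInterior w) (hmin : P.IsWeakMinimum w)
    (hactive : ∀ i : Fin dφ, P.φ i.succ (w.x 0, w.x P.T) = 0) :
    (P.system hT hP hw).NoDecrease P.endpoint := by
  obtain ⟨δ, hδ, hint⟩ := hint
  obtain ⟨hfeas, ε, hε, hmin⟩ := hmin
  -- Halving ε turns the non-strict almost everywhere bound into the strict bound on essential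
  -- suprema.
  refine ⟨min δ (ε / 2), by positivity, fun x z hxz hz hx hz' hη hφ => ?_⟩
  have hcont := P.contDiff_dynamics hP
  have hxc : ContinuousOn x (Icc 0 P.T) := hxz.continuousOn hT.le
  have hxm : MemLp x ⊤ (timeMeasure P.T) := by
    obtain ⟨C, hC⟩ := (isCompact_Icc (a := (0 : ℝ)) (b := P.T)).exists_bound_of_continuousOn hxc
    exact memLp_top_of_bound (hxc.aestronglyMeasurable measurableSet_Icc) C
      ((ae_restrict_mem measurableSet_Icc).mono hC)
  have hρ : ENNReal.ofReal (min δ (ε / 2)) < ENNReal.ofReal ε :=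
    (ENNReal.ofReal_lt_ofReal_iff hε).2 ((min_le_right _ _).trans_lt (by linarith))
  have hbound : ∀ {k : ℕ} {f : ℝ → Vec k}, (∀ᵐ t ∂(timeMeasure P.T), ‖f t‖ ≤ min δ (ε / 2)) →
      eLpNorm f ⊤ (timeMeasure P.T) < ENNReal.ofReal ε := fun h => by
    rw [eLpNorm_exponent_top]
    exact (eLpNormEssSup_le_of_ae_bound h).trans_lt hρ
  have hzb : ∀ᵐ t ∂(timeMeasure P.T), ‖z t - (w.u t, w.v t)‖ ≤ min δ (ε / 2) := hz'
  let y : Triple n l m := ⟨x, fun t => (z t).1, fun t => (z t).2⟩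
  have hy : P.IsFeasible y := by
    refine ⟨⟨⟨⟨_, memLp_top_comp hcont.continuous (memLp_pair hxm hz), hxz⟩,
      memLp_clm_comp (ContinuousLinearMap.fst ℝ _ _) hz,
      memLp_clm_comp (ContinuousLinearMap.snd ℝ _ _) hz⟩, hxz⟩, fun j => ?_, fun i => ?_, ?_⟩
    · exact (hη j).trans (hfeas.2.1 j)
    · exact (hφ i.succ).le.trans (hactive i).le
    · filter_upwards [hzb, hint] with t h1 h2
      have h3 : z t ∈ Metric.closedBall (w.u t, w.v t) δ := by
        rw [mem_closedBall_iff_norm]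
        exact h1.trans (min_le_left _ _)
      exact h2 h3
  refine (hφ 0).not_ge (hmin y hy ?_ ?_ ?_)
  · exact hbound ((ae_restrict_mem measurableSet_Icc).mono hx)
  · exact hbound (hzb.mono fun t ht => (norm_fst_le _).trans ht)
  · exact hbound (hzb.mono fun t ht => (norm_snd_le _).trans ht)

theorem sum_abs_coefficients (lam : Multiplier n dφ dη) :
    ∑ k, |coefficients lam k| = ∑ i, |lam.1 i| + ∑ j, |lam.2.1 j| := by
  simp [coefficients]

theorem isCostate_iff (lam : Multiplier n dφ dη) :
    HasDerivativeAE P.T lam.2.2 (fun t => -P.Hx lam w t) ↔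
      (P.system hT hP hw).IsCostate lam.2.2 := by
  simp only [P.Hx_eq hT hP hw]
  rfl

theorem stationary_iff (lam : Multiplier n dφ dη) (t : ℝ) :
    (P.Hu lam w t = 0 ∧ P.Hv lam w t = 0) ↔ lam.2.2 t ∘L (P.system hT hP hw).Dz t = 0 := by
  rw [P.Hu_eq hT hP hw, P.Hv_eq hT hP hw, ← ContinuousLinearMap.comp_assoc,
    ← ContinuousLinearMap.comp_assoc]
  constructor
  · rintro ⟨h1, h2⟩
    refine ContinuousLinearMap.ext fun c => ?_
    have h3 := congrArg₂ (· + ·) (DFunLike.congr_fun h1 c.1) (DFunLike.congr_fun h2 c.2)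
    simp only [ContinuousLinearMap.comp_apply, zero_apply, add_zero, ← map_add] at h3 ⊢
    simpa using h3
  · intro h
    rw [h]
    simp

/-- Given the costate equation and the final condition, the initial condition and H_u = H_v = 0
together say that the derivative of ℓ vanishes on the endpoints of all linearized solutions, a
condition on the scalar components alone. Membership of p in W^{1,∞} is automatic from the equation.
-/
theorem mem_multipliers_iff (lam : Multiplier n dφ dη) : lam ∈ P.multipliers w ↔
    coefficients lam ∈ (P.system hT hP hw).normalizedMultipliers P.endpoint ∧
    (P.system hT hP hw).IsCostate lam.2.2 ∧ lam.2.2 P.T =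
      fderiv ℝ (combination P.endpoint (coefficients lam)) (w.x 0, w.x P.T) ∘L
        ContinuousLinearMap.inr ℝ _ _ := by
  simp only [multipliers, mem_ofPred_eq, P.isCostate_iff hT hP hw, P.ellx0_eq hP, P.ellxT_eq hP,
    P.stationary_iff hT hP hw, ControlSystem.normalizedMultipliers, sum_abs_coefficients]
  constructor
  · rintro ⟨-, h1, h2, h3, h4, h5, h6⟩
    exact ⟨⟨h1, h2, (h3.stationary_iff h5).2 ⟨h4, h6⟩⟩, h3, h5⟩
  · rintro ⟨⟨h1, h2, h3⟩, h4, h5⟩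
    obtain ⟨h6, h7⟩ := (h4.stationary_iff h5).1 h3
    refine ⟨⟨_, ?_, h4⟩, h1, h2, h4, h6, h5, h7⟩
    have : MemLp (fun t => lam.2.2 t ∘L (P.system hT hP hw).A t) ⊤
        (timeMeasure (P.system hT hP hw).T) := by
      exact (ContinuousLinearMap.compL ℝ (Vec n) (Vec n) ℝ).memLp_of_bilin ⊤ h4.memLp
        (P.system hT hP hw).memLp_A
    exact this.neg

/-- The multiplier determined by its scalar components. -/
def multiplierOf : (Fin (dφ + 1) ⊕ Fin dη → ℝ) →ₗ[ℝ] Multiplier n dφ dη where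
  toFun e := (fun i => e (Sum.inl i), fun j => e (Sum.inr j),
    (P.system hT hP hw).combinedCostate P.endpoint e)
  map_add' e e' := by
    exact Prod.ext rfl (Prod.ext rfl (funext fun t =>
      (P.system hT hP hw).combinedCostate_add P.endpoint e e' t))
  map_smul' c e := by
    exact Prod.ext rfl (Prod.ext rfl (funext fun t =>
      (P.system hT hP hw).combinedCostate_smul P.endpoint c e t))

theorem coefficients_multiplierOf (e : Fin (dφ + 1) ⊕ Fin dη → ℝ) :
    coefficients (P.multiplierOf hT hP hw e) = e := by
  ext (i | j) <;> rfl

theorem multiplierOf_mem_convexHull {e : Fin (dφ + 1) ⊕ Fin dη → ℝ}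
    (he : e ∈ convexHull ℝ ((P.system hT hP hw).normalizedMultipliers P.endpoint)) :
    P.multiplierOf hT hP hw e ∈ convexHull ℝ (P.multipliers w) := by
  have h := mem_image_of_mem (P.multiplierOf hT hP hw) he
  rw [LinearMap.image_convexHull] at h
  refine convexHull_mono ?_ h
  rintro _ ⟨e, he, rfl⟩
  refine (P.mem_multipliers_iff hT hP hw _).2 ?_
  rw [coefficients_multiplierOf]
  exact ⟨he, (P.system hT hP hw).isCostate_combinedCostate P.endpoint e,
    (P.system hT hP hw).combinedCostate_final (P.contDiff_endpoint hP) e⟩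

/-- On [0,T] the final value problem determines the costate by the scalar components, and this
dependence is linear, so it survives convex combinations. Values of p off [0,T] are free, hence
equality on the interval only. -/
theorem coefficients_mem_convexHull {lam : Multiplier n dφ dη}
    (hlam : lam ∈ convexHull ℝ (P.multipliers w)) :
    coefficients lam ∈ convexHull ℝ ((P.system hT hP hw).normalizedMultipliers P.endpoint) ∧
      EqOn lam.2.2 ((P.system hT hP hw).combinedCostate P.endpoint (coefficients lam))
        (Icc 0 P.T) := by
  constructor
  · have h := mem_image_of_mem coefficients hlam
    rw [LinearMap.image_convexHull] at h
    refine convexHull_mono ?_ h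
    rintro _ ⟨lam, hlam, rfl⟩
    exact ((P.mem_multipliers_iff hT hP hw lam).1 hlam).1
  · have hsub : P.multipliers w ⊆ {lam | EqOn lam.2.2
        ((P.system hT hP hw).combinedCostate P.endpoint (coefficients lam)) (Icc 0 P.T)} := by
      intro lam hlam
      obtain ⟨-, h1, h2⟩ := (P.mem_multipliers_iff hT hP hw lam).1 hlam
      exact costate_unique hT.le (P.system hT hP hw).memLp_A h1
        ((P.system hT hP hw).isCostate_combinedCostate P.endpoint _)
        (h2.trans ((P.system hT hP hw).combinedCostate_final (P.contDiff_endpoint hP) _).symm)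
    refine convexHull_min hsub ?_ hlam
    intro a ha b hb s r _ _ _ t ht
    have h1 := congrArg (fun lam : Multiplier n dφ dη => lam.2.2 t)
      ((P.multiplierOf hT hP hw).map_add (s • coefficients a) (r • coefficients b))
    have h2 := congrArg (fun lam : Multiplier n dφ dη => lam.2.2 t)
      ((P.multiplierOf hT hP hw).map_smul s (coefficients a))
    have h3 := congrArg (fun lam : Multiplier n dφ dη => lam.2.2 t)
      ((P.multiplierOf hT hP hw).map_smul r (coefficients b))
    rw [map_add, map_smul, map_smul]
    refine Eq.trans ?_ h1.symm
    refine Eq.trans ?_ (congrArg₂ (· + ·) h2 h3).symm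
    exact congrArg₂ (· + ·) (congrArg (s • ·) (ha ht)) (congrArg (r • ·) (hb ht))

theorem ae_legendre_iff {lam : Multiplier n dφ dη} {p : ℝ → Covec n}
    (hlam : EqOn lam.2.2 p (Icc 0 P.T)) : (P.system hT hP hw).Legendre p ↔
      ∀ᵐ t ∂(timeMeasure P.T), (∀ a : Vec l, 0 ≤ P.Huu lam w t a a) ∧ P.Hvu lam w t = 0 := by
  simp only [← P.legendre_iff hT hP hw]
  refine eventually_congr ?_
  filter_upwards [ae_restrict_mem measurableSet_Icc] with t ht
  rw [hlam ht]

theorem weaklyLSC_iff {lam : Multiplier n dφ dη} {p : ℝ → Covec n}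
    (hp : MemLp p ⊤ (timeMeasure (P.system hT hP hw).T)) (hlam : EqOn lam.2.2 p (Icc 0 P.T)) :
    P.WeaklyLSC w (P.Omega w lam) ↔ (P.system hT hP hw).Legendre p := by
  constructor
  · intro h
    refine (P.system hT hP hw).legendre_of_eventually_lt
      (combination P.endpoint (coefficients lam)) hp fun {B} hB c a ha => ?_
    have hlim : ∀ φ : (P.system hT hP hw).Direction →L[ℝ] ℝ,
        Tendsto (fun k => φ ((P.system hT hP hw).oscillationDir hB c k)) atTop (𝓝 (φ 0)) :=
      fun φ => by
        rw [map_zero]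
        exact (P.system hT hP hw).tendsto_oscillationDir hB c φ
    have h0 := P.omega_eq hT hP hw ((P.system hT hP hw).represents_tripleOf 0) lam hp hlam
    rw [map_zero] at h0
    have := h (fun k => (P.system hT hP hw).tripleOf ((P.system hT hP hw).oscillationDir hB c k))
      ((P.system hT hP hw).tripleOf 0) (fun k => P.tripleOf_mem hT hP hw _)
      (P.tripleOf_mem hT hP hw 0) ((P.system hT hP hw).weaklyConvergesW2_tripleOf hlim) a
      (ha.trans_eq h0.symm)
    filter_upwards [this] with k hk
    rwa [P.omega_eq hT hP hw ((P.system hT hP hw).represents_tripleOf _) lam hp hlam] at hk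
  · intro hL b b' hb hb' hconv c hc
    choose X hX using fun j => P.exists_represents hT hP hw (hb j)
    obtain ⟨X', hX'⟩ := P.exists_represents hT hP hw hb'
    rw [P.omega_eq hT hP hw hX' lam hp hlam] at hc
    filter_upwards [hL.eventually_lt _ hp (ControlSystem.Represents.tendsto hX hX' hconv) hc]
      with k hk
    rwa [P.omega_eq hT hP hw (hX k) lam hp hlam]

theorem coSharp_eq (hT : 0 < P.T) (hP : P.Regular) {w : Triple n l m} (hw : P.IsTrajectory w) :
    P.coSharp w = {lam | lam ∈ convexHull ℝ (P.multipliers w) ∧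
    ∀ᵐ t ∂(timeMeasure P.T), (∀ a : Vec l, 0 ≤ P.Huu lam w t a a) ∧ P.Hvu lam w t = 0} := by
  ext lam
  refine and_congr_right fun hlam => ?_
  obtain ⟨-, h⟩ := P.coefficients_mem_convexHull hT hP hw hlam
  exact (P.weaklyLSC_iff hT hP hw ((P.system hT hP hw).memLp_combinedCostate _ _) h).trans
    (P.ae_legendre_iff hT hP hw h)

/-- Passing to scalar components in one direction and rebuilding the costate in the other preserves
both the Legendre condition and the value of Ω. The maximum over multipliers with costates is
thereby reduced to one over a compact subset of a finite-dimensional space. -/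
theorem image_omega_coSharp {X : (P.system hT hP hw).Direction} {b : Triple n l m}
    (hX : (P.system hT hP hw).Represents X b) :
    (fun lam => P.Omega w lam b) '' P.coSharp w =
      (fun e => (P.system hT hP hw).secondVariation (combination P.endpoint e)
        ((P.system hT hP hw).memLp_combinedCostate P.endpoint e) X X) ''
        (P.system hT hP hw).legendreMultipliers P.endpoint := by
  have hm := (P.system hT hP hw).memLp_combinedCostate P.endpoint
  refine Subset.antisymm ?_ ?_
  · rintro _ ⟨lam, ⟨hlam, hlsc⟩, rfl⟩
    obtain ⟨h1, h2⟩ := P.coefficients_mem_convexHull hT hP hw hlam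
    have hL := (P.weaklyLSC_iff hT hP hw (hm (coefficients lam)) h2).1 hlsc
    have hO := P.omega_eq hT hP hw hX lam (hm (coefficients lam)) h2
    exact ⟨coefficients lam, ⟨h1, hL⟩, hO.symm⟩
  · rintro _ ⟨e, ⟨he, hL⟩, rfl⟩
    have h2 : EqOn (P.multiplierOf hT hP hw e).2.2
      ((P.system hT hP hw).combinedCostate P.endpoint e) (Icc 0 P.T) := fun _ _ => rfl
    have hO := P.omega_eq hT hP hw hX (P.multiplierOf hT hP hw e) (hm e) h2
    rw [coefficients_multiplierOf] at hO
    exact ⟨P.multiplierOf hT hP hw e, ⟨P.multiplierOf_mem_convexHull hT hP hw he,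
      (P.weaklyLSC_iff hT hP hw (hm e) h2).2 hL⟩, hO⟩

end Problem

end PartiallyAffine

end

theorem theorem3p5 {n l m dφ dη : ℕ} (P : PartiallyAffine.Problem n l m dφ dη)
    (hT : 0 < P.T) (hU : IsOpen P.U) (hV : IsOpen P.V) (hP : P.Regular)
    (w : PartiallyAffine.Triple n l m)
    (hint : P.ControlsInterior w)
    (hactive : ∀ i : Fin dφ, P.φ i.succ (w.x 0, w.x P.T) = 0)
    (hmin : P.IsWeakMinimum w) :
    (∀ b ∈ P.criticalCone w, ∃ M : ℝ,
      IsGreatest ((fun lam => P.Omega w lam b) '' P.coSharp w) M ∧ 0 ≤ M) ∧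
    P.coSharp w =
      {lam | lam ∈ convexHull ℝ (P.multipliers w) ∧ ∀ᵐ t ∂(PartiallyAffine.timeMeasure P.T),
        (∀ a : PartiallyAffine.Vec l, 0 ≤ P.Huu lam w t a a) ∧ P.Hvu lam w t = 0} := by
  have hw : P.IsTrajectory w := hmin.1.1
  refine ⟨fun b hb => ?_, P.coSharp_eq hT hP hw⟩
  obtain ⟨X, hX⟩ := P.exists_represents hT hP hw hb.1
  rw [P.image_omega_coSharp hT hP hw hX]
  have hends := hX.endsL
  refine (P.system hT hP hw).exists_isGreatest_secondVariation (P.contDiff_endpoint hP)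
    (P.noDecrease_of_isWeakMinimum hT hP hw hint hmin hactive) ⟨fun j => ?_, fun i => ?_⟩
  · rw [PartiallyAffine.ControlSystem.constraintL_apply, hends]
    exact hb.2.1 j
  · rw [PartiallyAffine.ControlSystem.constraintL_apply, hends]
    exact hb.2.2 i
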